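/- **Setting.** Let $L,M\ge 1$, $K\ge 0$ be integers, $T_s>0$, and let $L$ base stations with $M$ antennas each have array responses $a_\ell(p)\in\mathbb C^M$ with $|a_{\ell,m}(p)|^2=1/M$ and delays $\tau_\ell(p)\in\mathbb R$, for $p\in\mathbb R^{K}$; put $\Delta_{ij}(p)=\tau_i(p)-\tau_j(p)$. The received signals are $$r_\ell[n]=b_\ell\,a_\ell(p_\star)\,s(nT_s-\tau_\ell(p_\star))+v_\ell[n]\in\mathbb C^M ,$$ where $p_\star$ is the emitter position and $b_\ell\in\mathbb C$. Here $s$ is a stationary zero-mean circular complex normal process on $\mathbb R$ with $\mathbb E[s(t)s^*(t-t_0)]=R_s(t_0)$. The $v_\ell[n]$ are spatially and temporally independent zero-mean circular complex normal vectors with covariance $\sigma_\ell^2I_M$, $\sigma^2_\ell\ge0$, independent of $s$ and across stations. Assume that the sampled signal is ergodic, i.e. $\frac1N\sum_{m=0}^{N-1}|R_s(mT_s)|^2\to0$ as $N\to\infty$, that $\rho_\ell^2:=|b_\ell|^2R_s(0)/M+\sigma_\ell^2>0$ for all $\ell$, and that all $\tau_\ell(p_\star)$ lie in $T_s\mathbb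 Z$. Call $p$ *admissible* if all $\tau_\ell(p)$ lie in $T_s\mathbb Z$; for such $p$, a covariance "at $\Delta_{ij}(p)$" is the one at the integer lag $\Delta_{ij}(p)/T_s$. Let $R^{(i,j)}[m]=\mathbb E[r_i[n]r_j^{H}[n-m]]$ and $\bar R^{(i,j)}[m]=R^{(i,j)}[m]/(\rho_i\rho_j)$. The one-bit data are $y_\ell[n]=\mathcal Q(r_\ell[n])$, with $\mathcal Q(z)=\frac1{\sqrt2}(\operatorname{sgn}\Re z+\mathrm j\operatorname{sgn}\Im z)$ elementwise and $\operatorname{sgn}\in\{-1,1\}$, $\operatorname{sgn}0=1$. From $N$ samples $n=1,\dots,N$ with normalized DFT coefficients $\bar r_\ell[k]$, $\bar y_\ell[k]$ at the frequencies $\omega_k=2\pi(k-1)/(NT_s)$, $k=1,\dots,N$, define $$\widehat{\bar R}^{(i,j)}[\Delta_{ij}(p)]=\operatorname{sine}\Big(\frac\pi2\cdot\frac1N\sum_{k=1}^N\bar y_i[k]\bar y_j^{H}[k]e^{\mathrm j\omega_k\Delta_{ij}(p)}\Big),\qquad \bar D_{ij}(p)=N\,a_i^H(p)\widehat{\bar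 R}^{(i,j)}[\Delta_{ij}(p)]a_j(p),$$ where $\operatorname{sine}(z)=\sin\Re z+\mathrm j\sin\Im z$ elementwise. The unquantized DPD matrix is $D(p)=U^H(p)U(p)$, where $U(p)\in\mathbb C^{N\times L}$ has the entries $d_\ell[k]=e^{-\mathrm j\omega_k\tau_\ell(p)}\bar r_\ell^H[k]a_\ell(p)$. Put $D^\infty_{ij}(p)=a_i^H(p)\bar R^{(i,j)}[\Delta_{ij}(p)]a_j(p)$. Let $\Theta\subseteq\mathbb R^{K}$ be a set of candidate positions, all of them admissible, on which each $\Delta_{ij}$ is bounded (for instance a finite grid). An OB-DPD estimate is a maximizer over $\Theta$ of $\lambda_{\max}(\bar D(p))$. A DPD estimate is a minimizer over $\Theta$ of the least-squares cost $$Q(p)=\min_{S\in\mathbb C^N,\ \beta\in\mathbb C^L,\ \|\beta\|=1}\ \sum_{\ell=1}^L\sum_{k=1}^N\big\|\bar r_\ell[k]-\beta_\ell S[k]e^{-\mathrm j\omega_k\tau_\ell(p)}a_\ell(p)\big\|^2 .$$ Position estimates are supposed to satisfy their defining property almost surely, for every $N$. The *parallel scenario* has $b_\ell/\rho_\ell$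 and $\sigma_\ell^2/\rho_\ell^2$ in place of $b_\ell$ and $\sigma_\ell^2$, and everything else, including $p_\star$, unchanged. Limits are as $N\to\infty$, $\xrightarrow{P}$ is convergence in probability, and matrices converge entrywise. **Claim.** 1. $\mathbb E[r_i[n]r_j^H[n-m]]$ does not depend on $n$, and it equals $b_ib_j^*R_s(mT_s-\Delta_{ij}(p_\star))a_i(p_\star)a_j^H(p_\star)+\delta_{ij}\delta_{m0}\sigma_i^2I_M$. 2. For every admissible $p$ and all $i,j$, $\widehat{\bar R}^{(i,j)}[\Delta_{ij}(p)]\xrightarrow{P}\bar R^{(i,j)}[\Delta_{ij}(p)]$, and $\frac1N\bar D(p)\xrightarrow{P}D^\infty(p)$. 3. If all $\rho_\ell$ equal some $\rho$ (Scenario $\mathcal H$), then for every admissible $p$, $\widehat{\bar R}^{(i,j)}[\Delta_{ij}(p)]\xrightarrow{P}\rho^{-2}R^{(i,j)}[\Delta_{ij}(p)]$ and $\frac1N\big(\bar D(p)-\rho^{-2}D(p)\big)\xrightarrow{P}0$. 4. In general, the parallel scenario satisfies all the assumptions, has all its $\rho_\ell$ equal to $1$, and is realized by the same $s$ and the noises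 $v_\ell[n]/\rho_\ell$. If $D^{(\mathcal H)}(p)$ is the DPD matrix of the unquantized data of any realization of the parallel scenario on the same probability space, then $\frac1N\big(\bar D(p)-D^{(\mathcal H)}(p)\big)\xrightarrow{P}0$ for every admissible $p$. 5. Let $\hat p_{\mathrm{OB},N}$ be OB-DPD estimates, and let $\hat p^{(\mathcal H)}_N$ be DPD estimates from the unquantized data of any realization of the parallel scenario on the same probability space or, if all $\rho_\ell$ are equal, from the unquantized data $r_\ell[n]$ themselves. Each of the two sequences asymptotically maximizes $\lambda_{\max}(D^\infty(\cdot))$ over $\Theta$: for every $\varepsilon>0$, the (outer) probability that some $p\in\Theta$ has $\lambda_{\max}(D^\infty(p))\ge\lambda_{\max}(D^\infty(\hat p_N))+\varepsilon$ tends to $0$. If, moreover, $\lambda_{\max}(D^\infty(\cdot))$ has a well-separated maximum point $p_0\in\Theta$ (for every $\varepsilon>0$ there is $\delta>0$ with $\lambda_{\max}(D^\infty(p))\le\lambda_{\max}(D^\infty(p_0))-\delta$ for all $p\in\Theta$ with $\|p-p_0\|\ge\varepsilon$; for finite $\Theta$: $p_0$ is the unique maximum point), then $\hat p_{\mathrm{OB},N}\xrightarrow{P}p_0$,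 $\hat p^{(\mathcal H)}_N\xrightarrow{P}p_0$ and $\|\hat p_{\mathrm{OB},N}-\hat p^{(\mathcal H)}_N\|\xrightarrow{P}0$. -/

import Mathlib

open MeasureTheory ProbabilityTheory Filter Topology
open scoped ComplexConjugate Matrix

namespace OBDPD

/-! ### One-bit quantization and the elementwise sine -/

/-- The sign function with values in `{-1, 1}`. -/
noncomputable def sgn (x : ℝ) : ℝ := if 0 ≤ x then 1 else -1

/-- The complex one-bit quantizer `(sgn (Re z) + j sgn (Im z)) / √2`. -/
noncomputable def quantize (z : ℂ) : ℂ :=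
  ((sgn z.re : ℂ) + Complex.I * (sgn z.im : ℂ)) / ((Real.sqrt 2 : ℝ) : ℂ)

/-- `sine z = sin (Re z) + j sin (Im z)`. -/
noncomputable def csine (z : ℂ) : ℂ :=
  (Real.sin z.re : ℂ) + Complex.I * (Real.sin z.im : ℂ)

/-- The largest (real) eigenvalue of a square complex matrix. -/
noncomputable def lambdaMax {L : ℕ} (A : Matrix (Fin L) (Fin L) ℂ) : ℝ :=
  sSup {x : ℝ | (x : ℂ) ∈ spectrum ℂ A}

/-! ### The scenario and its random signals -/

/-- The deterministic parameters of a scenario with `L` base stations of `M` antennas each and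
positions in `ℝ^K`. -/
structure Scenario (L M K : ℕ) where
  /-- sampling period -/
  Ts : ℝ
  /-- array responses `a_ℓ(p) ∈ ℂ^M` -/
  a : Fin L → EuclideanSpace ℝ (Fin K) → Fin M → ℂ
  /-- delays `τ_ℓ(p)` -/
  τ : Fin L → EuclideanSpace ℝ (Fin K) → ℝ
  /-- channel coefficients `b_ℓ` -/
  b : Fin L → ℂ
  /-- noise variances `σ²_ℓ` -/
  σsq : Fin L → ℝ
  /-- autocorrelation function of the emitted signal -/
  Rs : ℝ → ℂ
  /-- true emitter position -/
  pos : EuclideanSpace ℝ (Fin K)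

namespace Scenario

variable {L M K : ℕ} (P : Scenario L M K)

/-- `Δ_ij(p) = τ_i(p) - τ_j(p)`. -/
def delta (i j : Fin L) (p : EuclideanSpace ℝ (Fin K)) : ℝ := P.τ i p - P.τ j p

/-- All delays at `p` are integer multiples of the sampling period. -/
def IntegerDelays (p : EuclideanSpace ℝ (Fin K)) : Prop :=
  ∀ ℓ, ∃ k : ℤ, P.τ ℓ p = k * P.Ts

/-- `Δ_ij(p)` in units of the sampling period (exact whenever the delays at `p` are integer
multiples of it). -/
noncomputable def lag (i j : Fin L) (p : EuclideanSpace ℝ (Fin K)) : ℤ :=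
  round (P.delta i j p / P.Ts)

/-- `ρ_ℓ² = |b_ℓ|² R_s(0) / M + σ²_ℓ`, the variance of each antenna output of station `ℓ`. -/
noncomputable def ρsq (ℓ : Fin L) : ℝ := ‖P.b ℓ‖ ^ 2 * (P.Rs 0).re / M + P.σsq ℓ

/-- `ρ_ℓ`. -/
noncomputable def ρ (ℓ : Fin L) : ℝ := Real.sqrt (P.ρsq ℓ)

/-- The parallel scenario: `b_ℓ` and `σ²_ℓ` are replaced by `b_ℓ / ρ_ℓ` and `σ²_ℓ / ρ_ℓ²`. -/
noncomputable def parallel : Scenario L M K :=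
  { P with
    b := fun ℓ => P.b ℓ / (P.ρ ℓ : ℂ)
    σsq := fun ℓ => P.σsq ℓ / P.ρsq ℓ }

/-- Standing assumptions on the parameters. The last one is ergodicity of the sampled Gaussian
signal, which is what consistency of sample covariances amounts to. -/
structure Admissible : Prop where
  Ts_pos : 0 < P.Ts
  gain : ∀ ℓ p m, ‖P.a ℓ p m‖ ^ 2 = 1 / (M : ℝ)
  σsq_nonneg : ∀ ℓ, 0 ≤ P.σsq ℓ
  ρsq_pos : ∀ ℓ, 0 < P.ρsq ℓ
  pos_delays : P.IntegerDelays P.pos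
  ergodic : Tendsto
    (fun N : ℕ => (1 / (N : ℝ)) * ∑ m ∈ Finset.range N, ‖P.Rs ((m : ℝ) * P.Ts)‖ ^ 2)
    atTop (𝓝 0)

variable {Ω : Type*} [MeasurableSpace Ω]

/-- `s` is a stationary zero-mean circular complex normal process on `ℝ` with autocorrelation `R_s`;
the noises `v_ℓ[n]` are spatially and temporally independent, zero-mean circular complex normal
with covariance matrix `σ²_ℓ I`, and independent of `s`. -/
structure IsModel (μ : Measure Ω) (s : ℝ → Ω → ℂ) (v : Fin L → ℤ → Fin M → Ω → ℂ) : Prop where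
  signal_gaussian : IsGaussianProcess s μ
  signal_mean : ∀ t, ∫ ω, s t ω ∂μ = 0
  signal_circular : ∀ t t', ∫ ω, s t ω * s t' ω ∂μ = 0
  signal_cov : ∀ t t₀, ∫ ω, s t ω * conj (s (t - t₀) ω) ∂μ = P.Rs t₀
  noise_gaussian : ∀ ℓ n m, HasGaussianLaw (v ℓ n m) μ
  noise_mean : ∀ ℓ n m, ∫ ω, v ℓ n m ω ∂μ = 0
  noise_circular : ∀ ℓ n m, ∫ ω, v ℓ n m ω * v ℓ n m ω ∂μ = 0
  noise_var : ∀ ℓ n m, ∫ ω, ‖v ℓ n m ω‖ ^ 2 ∂μ = P.σsq ℓ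
  noise_indep : iIndepFun (fun i : Fin L × ℤ × Fin M => v i.1 i.2.1 i.2.2) μ
  signal_noise_indep :
    IndepFun (fun ω t => s t ω) (fun ω (i : Fin L × ℤ × Fin M) => v i.1 i.2.1 i.2.2 ω) μ

/-- The received signals `r_ℓ[n] = b_ℓ a_ℓ(pos) s(n T_s - τ_ℓ(pos)) + v_ℓ[n]`. -/
def received (s : ℝ → Ω → ℂ) (v : Fin L → ℤ → Fin M → Ω → ℂ) (ω : Ω) :
    Fin L → ℤ → Fin M → ℂ :=
  fun ℓ n m => P.b ℓ * P.a ℓ P.pos m * s ((n : ℝ) * P.Ts - P.τ ℓ P.pos) ω + v ℓ n m ω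

/-- The one-bit measurements. -/
noncomputable def oneBit (s : ℝ → Ω → ℂ) (v : Fin L → ℤ → Fin M → Ω → ℂ) (ω : Ω) :
    Fin L → ℤ → Fin M → ℂ :=
  fun ℓ n m => quantize (P.received s v ω ℓ n m)

/-- `E[r_i[n] r_j[n - m]^H]`. -/
noncomputable def covAt (μ : Measure Ω) (s : ℝ → Ω → ℂ) (v : Fin L → ℤ → Fin M → Ω → ℂ)
    (i j : Fin L) (n m : ℤ) : Matrix (Fin M) (Fin M) ℂ :=
  Matrix.of fun c d => ∫ ω, P.received s v ω i n c * conj (P.received s v ω j (n - m) d) ∂μ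

/-- The (cross-)covariance `R^{(i,j)}[m]`; by stationarity the time index is immaterial. -/
noncomputable def cov (μ : Measure Ω) (s : ℝ → Ω → ℂ) (v : Fin L → ℤ → Fin M → Ω → ℂ)
    (i j : Fin L) (m : ℤ) : Matrix (Fin M) (Fin M) ℂ :=
  P.covAt μ s v i j 0 m

/-- The normalized covariance `R^{(i,j)}[m] / (ρ_i ρ_j)`. -/
noncomputable def normCov (μ : Measure Ω) (s : ℝ → Ω → ℂ) (v : Fin L → ℤ → Fin M → Ω → ℂ)
    (i j : Fin L) (m : ℤ) : Matrix (Fin M) (Fin M) ℂ :=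
  Matrix.of fun c d => P.cov μ s v i j m c d / ((P.ρ i : ℂ) * (P.ρ j : ℂ))

/-! ### Statistics of data `x_ℓ[n]`, `n = 1, …, N` -/

/-- `ω_k = 2π(k-1)/(N T_s)`, with `k - 1` running through `0, …, N - 1`. -/
noncomputable def freq (N : ℕ) (k : Fin N) : ℝ := 2 * Real.pi * (k : ℝ) / ((N : ℝ) * P.Ts)

/-- The normalized DFT of `x[1], …, x[N]`. -/
noncomputable def dft (N : ℕ) (x : ℤ → ℂ) (k : Fin N) : ℂ :=
  (1 / ((Real.sqrt N : ℝ) : ℂ)) * ∑ n : Fin N, x ((n : ℤ) + 1) *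
    Complex.exp (-Complex.I * ((P.freq N k * ((n : ℝ) * P.Ts) : ℝ) : ℂ))

/-- `(1/N) ∑_k x̄_i[k] x̄_j[k]^H exp(j ω_k Δ_ij(p))`. -/
noncomputable def sampleCov (N : ℕ) (x : Fin L → ℤ → Fin M → ℂ) (i j : Fin L)
    (p : EuclideanSpace ℝ (Fin K)) : Matrix (Fin M) (Fin M) ℂ :=
  Matrix.of fun c d => (1 / (N : ℂ)) * ∑ k : Fin N,
    P.dft N (fun n => x i n c) k * conj (P.dft N (fun n => x j n d) k) *
      Complex.exp (Complex.I * ((P.freq N k * P.delta i j p : ℝ) : ℂ))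

/-- The one-bit estimate `sine ((π/2) (1/N) ∑_k ȳ_i[k] ȳ_j[k]^H exp(j ω_k Δ_ij(p)))` of the
normalized covariance. -/
noncomputable def oneBitCov (N : ℕ) (y : Fin L → ℤ → Fin M → ℂ) (i j : Fin L)
    (p : EuclideanSpace ℝ (Fin K)) : Matrix (Fin M) (Fin M) ℂ :=
  Matrix.of fun c d => csine (((Real.pi / 2 : ℝ) : ℂ) * P.sampleCov N y i j p c d)

/-- The matrix with entries `a_i(p)^H C^{(i,j)} a_j(p)`. -/
def beamform (C : Fin L → Fin L → Matrix (Fin M) (Fin M) ℂ)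
    (p : EuclideanSpace ℝ (Fin K)) : Matrix (Fin L) (Fin L) ℂ :=
  Matrix.of fun i j => star (P.a i p) ⬝ᵥ (C i j *ᵥ P.a j p)

/-- The one-bit matrix `D̄(p)`, with entries `N a_i(p)^H R̂̄^{(i,j)} a_j(p)`. -/
noncomputable def Dbar (N : ℕ) (y : Fin L → ℤ → Fin M → ℂ) (p : EuclideanSpace ℝ (Fin K)) :
    Matrix (Fin L) (Fin L) ℂ :=
  (N : ℂ) • P.beamform (fun i j => P.oneBitCov N y i j p) p

/-- The matrix `U(p)` with entries `d_ℓ[k] = exp(-j ω_k τ_ℓ(p)) r̄_ℓ[k]^H a_ℓ(p)`. -/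
noncomputable def Umat (N : ℕ) (r : Fin L → ℤ → Fin M → ℂ) (p : EuclideanSpace ℝ (Fin K)) :
    Matrix (Fin N) (Fin L) ℂ :=
  Matrix.of fun k ℓ => Complex.exp (-Complex.I * ((P.freq N k * P.τ ℓ p : ℝ) : ℂ)) *
    ∑ m : Fin M, conj (P.dft N (fun n => r ℓ n m) k) * P.a ℓ p m

/-- The DPD matrix `D(p) = U(p)^H U(p)`. -/
noncomputable def D (N : ℕ) (r : Fin L → ℤ → Fin M → ℂ) (p : EuclideanSpace ℝ (Fin K)) :
    Matrix (Fin L) (Fin L) ℂ :=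
  (P.Umat N r p)ᴴ * P.Umat N r p

/-- The nonlinear least-squares cost `Q(p)`: the minimum over `S ∈ ℂ^N` and unit `β ∈ ℂ^L` of
`∑_ℓ ‖r̄_ℓ - β_ℓ S_ℓ ⊗ a_ℓ(p)‖²`, where `S_ℓ[k] = S[k] exp(-j ω_k τ_ℓ(p))`. -/
noncomputable def nlsCost (N : ℕ) (r : Fin L → ℤ → Fin M → ℂ)
    (p : EuclideanSpace ℝ (Fin K)) : ℝ :=
  ⨅ q : (Fin N → ℂ) × {β : Fin L → ℂ // ∑ ℓ, ‖β ℓ‖ ^ 2 = 1},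
    ∑ ℓ, ∑ k, ∑ m, ‖P.dft N (fun n => r ℓ n m) k - q.2.1 ℓ *
      (q.1 k * Complex.exp (-Complex.I * ((P.freq N k * P.τ ℓ p : ℝ) : ℂ)) * P.a ℓ p m)‖ ^ 2

/-! ### Position estimates over a set of candidate positions -/

/-- Candidate positions: integer delays, and bounded delay differences (as is automatic for finite
grids and for physical propagation delays). -/
structure IsCandidateSet (Θ : Set (EuclideanSpace ℝ (Fin K))) : Prop where
  integerDelays : ∀ p ∈ Θ, P.IntegerDelays p
  bounded : ∀ i j, ∃ C : ℝ, ∀ p ∈ Θ, |P.delta i j p| ≤ C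

/-- `p̂` is a DPD estimate for the data `r`: it minimizes the least-squares cost over `Θ`. -/
def IsDPDEstimate (Θ : Set (EuclideanSpace ℝ (Fin K))) (N : ℕ) (r : Fin L → ℤ → Fin M → ℂ)
    (phat : EuclideanSpace ℝ (Fin K)) : Prop :=
  phat ∈ Θ ∧ ∀ p ∈ Θ, P.nlsCost N r phat ≤ P.nlsCost N r p

/-- `p̂` is a one-bit DPD estimate for the data `y`: it maximizes `λ_max(D̄(p))` over `Θ`. -/
def IsOBDPDEstimate (Θ : Set (EuclideanSpace ℝ (Fin K))) (N : ℕ) (y : Fin L → ℤ → Fin M → ℂ)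
    (phat : EuclideanSpace ℝ (Fin K)) : Prop :=
  phat ∈ Θ ∧ ∀ p ∈ Θ, lambdaMax (P.Dbar N y p) ≤ lambdaMax (P.Dbar N y phat)

/-- The matrix with entries `a_i(p)^H R̄^{(i,j)}[Δ_ij(p)] a_j(p)`. -/
noncomputable def Dlim (μ : Measure Ω) (s : ℝ → Ω → ℂ) (v : Fin L → ℤ → Fin M → Ω → ℂ)
    (p : EuclideanSpace ℝ (Fin K)) : Matrix (Fin L) (Fin L) ℂ :=
  P.beamform (fun i j => P.normCov μ s v i j (P.lag i j p)) p

end Scenario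

/-- The estimates `p̂_N` maximize `F` over `Θ` asymptotically in probability. -/
def AsymptoticallyMaximizes {Ω E : Type*} [MeasurableSpace Ω] (μ : Measure Ω) (F : E → ℝ)
    (Θ : Set E) (phat : ℕ → Ω → E) : Prop :=
  ∀ ε : ℝ, 0 < ε →
    Tendsto (fun N => μ {ω | ∃ p ∈ Θ, F (phat N ω) + ε ≤ F p}) atTop (𝓝 0)

/-- `p₀` is a well-separated maximum point of `F` over `Θ`; if `Θ` is finite this says that `p₀` is
its unique maximum point. -/
def IsWellSeparatedMax {E : Type*} [PseudoMetricSpace E] (F : E → ℝ) (Θ : Set E) (p₀ : E) : Prop :=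
  p₀ ∈ Θ ∧ ∀ ε : ℝ, 0 < ε → ∃ δ : ℝ, 0 < δ ∧ ∀ p ∈ Θ, ε ≤ dist p p₀ → F p + δ ≤ F p₀

end OBDPD

namespace OBDPD

/-! ### Rayleigh quotients -/

/-! Everything rests on one consistency statement about sample correlations. Antenna outputs at all
times form a centered circular Gaussian process with the explicit covariance `modelCov`, since each
output is a linear combination of a signal value and an independent noise sample. At an integer lag
the frequency-domain correlation is exactly a circular time correlation (`dftCorr_eq`). It differs
from the linear correlation in at most `|d|` terms, whose mean contribution is O(1/N). The linear
correlation is an average of a function of the Gaussian pairs `(r_i[n], r_j[n-d])`, so a weak law of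
large numbers for dependent Gaussian vectors applies (`tendsto_integral_norm_average`).

The weak law needs no rate. If the cross-covariance of two Gaussian vectors with common law tends to
zero, their joint law tends to the product law, by Lévy's continuity theorem. Hence bounded
continuous functions of weakly correlated vectors are uniformly almost uncorrelated. Ergodicity
makes the squared covariances vanish on average, so the remaining pairs are negligible in the
variance of the average. An L¹ approximation then passes to any integrable function, including the
discontinuous one-bit products.

For unquantized data the limit is the covariance itself. For one-bit data it is given by the arcsine
law, which the elementwise sine inverts, leaving the normalized covariance
(`csine_integral_quantize`). The normalized covariances of a scenario are the covariances of its
parallel scenario, so both kinds of data have the same limits. When all `ρ_ℓ` agree, the unquantized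
data themselves do so after scaling by `ρ⁻²`. Since `D(p)/N` and `D̄(p)/N` are the same fixed linear
functions of these correlations, the matrix statements follow.

For the position estimates, eliminating signal and channel from the least-squares cost leaves a
constant minus `λ_max(D(p))` (`nlsCost_eq`). The largest eigenvalue is Lipschitz on Hermitian
matrices. Bounded delay differences that are multiples of the sampling period allow only finitely
many lags on `Θ`, so the convergence of the objective is uniform over `Θ`. The usual argmax argument
concludes. -/

lemma exists_eigenvector_lambdaMax {L : ℕ} (hL : 0 < L) {A : Matrix (Fin L) (Fin L) ℂ}
    (hA : A.IsHermitian) :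
    (∃ x : Fin L → ℂ, ∑ i, ‖x i‖ ^ 2 = 1 ∧ (star x ⬝ᵥ A *ᵥ x).re = lambdaMax A) ∧
      ∀ y : ℝ, (y : ℂ) ∈ spectrum ℂ A → y ≤ lambdaMax A := by
  have : Nonempty (Fin L) := ⟨⟨0, hL⟩⟩
  have hS : {x : ℝ | (x : ℂ) ∈ spectrum ℂ A} = Set.range hA.eigenvalues := by
    ext x
    rw [Set.mem_ofPred_eq, hA.spectrum_eq_image_range]
    constructor
    · rintro ⟨y, hy, hxy⟩
      rwa [← Complex.ofReal_injective hxy]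
    · intro hx
      exact ⟨x, hx, rfl⟩
  obtain ⟨i₀, hi₀⟩ := Finite.exists_max hA.eigenvalues
  have hgreat : IsGreatest {x : ℝ | (x : ℂ) ∈ spectrum ℂ A} (hA.eigenvalues i₀) := by
    rw [hS]
    exact ⟨⟨i₀, rfl⟩, by rintro _ ⟨j, rfl⟩; exact hi₀ j⟩
  have hmax : lambdaMax A = hA.eigenvalues i₀ := hgreat.csSup_eq
  refine ⟨⟨(hA.eigenvectorBasis i₀).ofLp, ?_, ?_⟩, fun y hy => hmax ▸ hgreat.2 hy⟩
  · have h := hA.eigenvectorBasis.orthonormal.1 i₀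
    rw [← EuclideanSpace.norm_sq_eq, h, one_pow]
  · have h := hA.eigenvectorBasis.orthonormal.1 i₀
    have h2 : star (hA.eigenvectorBasis i₀).ofLp ⬝ᵥ (hA.eigenvectorBasis i₀).ofLp = (1 : ℂ) := by
      have h3 := inner_self_eq_norm_sq_to_K (𝕜 := ℂ) (hA.eigenvectorBasis i₀)
      rw [h, EuclideanSpace.inner_eq_star_dotProduct, dotProduct_comm] at h3
      simpa using h3
    rw [hA.mulVec_eigenvectorBasis, dotProduct_smul, h2, hmax]
    simp

-- The spectrum of `λ_max · 1 - A` consists of the differences `λ_max - y ≥ 0`, so this Hermitian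
-- matrix is positive semidefinite. Nonnegativity of its quadratic form at `x` is the bound.
open scoped ComplexOrder in
lemma rayleigh_le_lambdaMax {L : ℕ} (hL : 0 < L) {A : Matrix (Fin L) (Fin L) ℂ}
    (hA : A.IsHermitian) (x : Fin L → ℂ) :
    (star x ⬝ᵥ A *ᵥ x).re ≤ lambdaMax A * ∑ i, ‖x i‖ ^ 2 := by
  have hle := (exists_eigenvector_lambdaMax hL hA).2
  have hpos : (algebraMap ℂ (Matrix (Fin L) (Fin L) ℂ) (lambdaMax A : ℂ) - A).PosSemidef := by
    rw [Matrix.posSemidef_iff_isHermitian_and_spectrum_nonneg]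
    constructor
    · refine Matrix.IsHermitian.sub ?_ hA
      rw [Matrix.algebraMap_eq_diagonal]
      refine Matrix.isHermitian_diagonal_of_self_adjoint _ ?_
      ext i
      simp
    · rw [← spectrum.singleton_sub_eq]
      rintro z ⟨_, rfl, w, hw, rfl⟩
      have hw' := hw
      rw [hA.spectrum_eq_image_range] at hw'
      obtain ⟨y, -, rfl⟩ := hw'
      have := hle y hw
      change (0 : ℂ) ≤ (lambdaMax A : ℂ) - (y : ℂ)
      rw [← Complex.ofReal_sub]
      exact_mod_cast sub_nonneg.2 this
  have h := (Complex.le_def.1 (hpos.dotProduct_mulVec_nonneg x)).1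
  rw [Matrix.sub_mulVec, dotProduct_sub, Complex.sub_re, Complex.zero_re, sub_nonneg] at h
  refine h.trans (le_of_eq ?_)
  rw [Matrix.algebraMap_eq_diagonal]
  simp only [dotProduct, Matrix.mulVec_diagonal, Complex.re_sum, Finset.mul_sum]
  refine Finset.sum_congr rfl fun i _ => ?_
  simp [Complex.sq_norm, Complex.normSq_apply]
  ring

/-- Replaces the supremum over the spectrum by a variational problem, so that the effect of scaling
can be read off from quadratic forms. -/
lemma lambdaMax_eq_of_isGreatest {L : ℕ} (hL : 0 < L) {A : Matrix (Fin L) (Fin L) ℂ}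
    (hA : A.IsHermitian) {r : ℝ}
    (h : ∃ x : Fin L → ℂ, ∑ i, ‖x i‖ ^ 2 = 1 ∧ (star x ⬝ᵥ A *ᵥ x).re = r)
    (h' : ∀ x : Fin L → ℂ, ∑ i, ‖x i‖ ^ 2 = 1 → (star x ⬝ᵥ A *ᵥ x).re ≤ r) :
    lambdaMax A = r := by
  obtain ⟨x, hx, hxr⟩ := h
  obtain ⟨y, hy, hyr⟩ := (exists_eigenvector_lambdaMax hL hA).1
  refine le_antisymm (hyr ▸ h' y hy) ?_
  have := rayleigh_le_lambdaMax hL hA x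
  rw [hx, mul_one, hxr] at this
  exact this

lemma lambdaMax_smul {L : ℕ} (hL : 0 < L) {A : Matrix (Fin L) (Fin L) ℂ}
    (hA : A.IsHermitian) {c : ℝ} (hc : 0 ≤ c) :
    lambdaMax ((c : ℂ) • A) = c * lambdaMax A := by
  have hcA : ((c : ℂ) • A).IsHermitian := by
    rw [Matrix.IsHermitian, Matrix.conjTranspose_smul, hA.eq]
    simp
  have hr (x : Fin L → ℂ) :
      (star x ⬝ᵥ ((c : ℂ) • A) *ᵥ x).re = c * (star x ⬝ᵥ A *ᵥ x).re := by
    rw [Matrix.smul_mulVec, dotProduct_smul, smul_eq_mul, Complex.re_ofReal_mul]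
  obtain ⟨y, hy, hyr⟩ := (exists_eigenvector_lambdaMax hL hA).1
  refine lambdaMax_eq_of_isGreatest hL hcA ⟨y, hy, by rw [hr, hyr]⟩ fun x hx => ?_
  have := rayleigh_le_lambdaMax hL hA x
  rw [hx, mul_one] at this
  rw [hr]
  gcongr

/-- A top unit eigenvector of `A` is a test vector for `B`. Its coordinates have modulus at most
one, so the difference of the two quadratic forms is at most the sum of the entrywise differences.
-/
lemma lambdaMax_sub_le {L : ℕ} (hL : 0 < L) {A B : Matrix (Fin L) (Fin L) ℂ}
    (hA : A.IsHermitian) (hB : B.IsHermitian) :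
    lambdaMax A - lambdaMax B ≤ ∑ i, ∑ j, ‖A i j - B i j‖ := by
  obtain ⟨x, hx, hxr⟩ := (exists_eigenvector_lambdaMax hL hA).1
  have hxB := rayleigh_le_lambdaMax hL hB x
  rw [hx, mul_one] at hxB
  have hx1 (i : Fin L) : ‖x i‖ ≤ 1 := by
    have : ‖x i‖ ^ 2 ≤ 1 := hx ▸ Finset.single_le_sum (f := fun i => ‖x i‖ ^ 2)
      (fun _ _ => by positivity) (Finset.mem_univ i)
    exact (sq_le_one_iff₀ (norm_nonneg _)).1 this
  have hd : (star x ⬝ᵥ A *ᵥ x).re - (star x ⬝ᵥ B *ᵥ x).re ≤ ∑ i, ∑ j, ‖A i j - B i j‖ := by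
    rw [← Complex.sub_re, ← dotProduct_sub, ← Matrix.sub_mulVec]
    refine (Complex.re_le_norm _).trans ?_
    simp only [dotProduct, Matrix.mulVec, Finset.mul_sum]
    refine (norm_sum_le _ _).trans (Finset.sum_le_sum fun i _ => (norm_sum_le _ _).trans
      (Finset.sum_le_sum fun j _ => ?_))
    rw [norm_mul, norm_mul, Pi.star_apply, norm_star, Matrix.sub_apply]
    calc ‖x i‖ * (‖A i j - B i j‖ * ‖x j‖) ≤ 1 * (‖A i j - B i j‖ * 1) := by
          gcongr
          exacts [hx1 i, hx1 j]
      _ = _ := by ring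
  linarith

lemma abs_lambdaMax_sub_le {L : ℕ} (hL : 0 < L) {A B : Matrix (Fin L) (Fin L) ℂ}
    (hA : A.IsHermitian) (hB : B.IsHermitian) :
    |lambdaMax A - lambdaMax B| ≤ ∑ i, ∑ j, ‖A i j - B i j‖ := by
  rw [abs_le']
  refine ⟨lambdaMax_sub_le hL hA hB, ?_⟩
  rw [neg_sub]
  refine (lambdaMax_sub_le hL hB hA).trans (le_of_eq ?_)
  simp_rw [norm_sub_rev]

namespace Scenario

variable {L M K : ℕ} (P : Scenario L M K)

/-! ### The least-squares cost -/

lemma isHermitian_D (N : ℕ) (r : Fin L → ℤ → Fin M → ℂ) (p : EuclideanSpace ℝ (Fin K)) :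
    (P.D N r p).IsHermitian :=
  Matrix.isHermitian_conjTranspose_mul_self _

lemma rayleigh_D (N : ℕ) (r : Fin L → ℤ → Fin M → ℂ) (p : EuclideanSpace ℝ (Fin K))
    (x : Fin L → ℂ) :
    (star x ⬝ᵥ P.D N r p *ᵥ x).re = ∑ k, ‖(P.Umat N r p *ᵥ x) k‖ ^ 2 := by
  rw [D, ← Matrix.mulVec_mulVec, Matrix.dotProduct_mulVec, Matrix.vecMul_conjTranspose, star_star,
    dotProduct, Complex.re_sum]
  refine Finset.sum_congr rfl fun k _ => ?_
  simp [Complex.sq_norm, Complex.normSq_apply]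

/-- Completing the square in `S`: along a unit vector `g` the best amplitude is the conjugate of the
correlation of `r` with `g`, and it removes exactly the squared modulus of that correlation. -/
lemma sum_sq_residual {ι : Type*} (s : Finset ι) (r g : ι → ℂ) (S : ℂ)
    (hg : ∑ i ∈ s, ‖g i‖ ^ 2 = 1) :
    ∑ i ∈ s, ‖r i - g i * S‖ ^ 2 = ∑ i ∈ s, ‖r i‖ ^ 2 - ‖∑ i ∈ s, conj (r i) * g i‖ ^ 2 +
      ‖S - conj (∑ i ∈ s, conj (r i) * g i)‖ ^ 2 := by
  have h1 (i : ι) : ‖r i - g i * S‖ ^ 2 =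
      ‖r i‖ ^ 2 - 2 * (conj (r i) * g i * S).re + ‖g i‖ ^ 2 * ‖S‖ ^ 2 := by
    simp only [Complex.sq_norm, Complex.normSq_apply, Complex.sub_re, Complex.sub_im,
      Complex.mul_re, Complex.mul_im, Complex.conj_re, Complex.conj_im]
    ring
  simp_rw [h1]
  rw [Finset.sum_add_distrib, Finset.sum_sub_distrib, ← Finset.mul_sum, ← Complex.re_sum,
    ← Finset.sum_mul, ← Finset.sum_mul, hg]
  generalize ∑ i ∈ s, conj (r i) * g i = w
  simp only [Complex.sq_norm, Complex.normSq_apply, Complex.sub_re, Complex.sub_im,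
      Complex.mul_re, Complex.conj_re, Complex.conj_im]
  ring

/-- Minimizing the least-squares cost over the signal and the channel leaves the largest eigenvalue
of the DPD matrix. -/
lemma nlsCost_eq (hL : 0 < L) (hM : 0 < M) (hgain : ∀ ℓ p m, ‖P.a ℓ p m‖ ^ 2 = 1 / (M : ℝ))
    (N : ℕ) (r : Fin L → ℤ → Fin M → ℂ) (p : EuclideanSpace ℝ (Fin K)) :
    P.nlsCost N r p =
      ∑ ℓ, ∑ k, ∑ m, ‖P.dft N (fun n => r ℓ n m) k‖ ^ 2 - lambdaMax (P.D N r p) := by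
  have hcost (S : Fin N → ℂ) (β : Fin L → ℂ) (hβ : ∑ ℓ, ‖β ℓ‖ ^ 2 = 1) :
      ∑ ℓ, ∑ k, ∑ m, ‖P.dft N (fun n => r ℓ n m) k - β ℓ *
        (S k * Complex.exp (-Complex.I * ((P.freq N k * P.τ ℓ p : ℝ) : ℂ)) * P.a ℓ p m)‖ ^ 2 =
      ∑ ℓ, ∑ k, ∑ m, ‖P.dft N (fun n => r ℓ n m) k‖ ^ 2 - (star β ⬝ᵥ P.D N r p *ᵥ β).re +
        ∑ k, ‖S k - conj ((P.Umat N r p *ᵥ β) k)‖ ^ 2 := by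
    rw [rayleigh_D, Finset.sum_comm]
    conv_rhs => enter [1, 1]; rw [Finset.sum_comm]
    rw [← Finset.sum_sub_distrib, ← Finset.sum_add_distrib]
    refine Finset.sum_congr rfl fun k _ => ?_
    -- At a fixed frequency the pairs (station, antenna) index the residual, and the direction `g`
    -- has the entries `β_ℓ e^{-jω_kτ_ℓ} a_{ℓ,m}`. Its norm is one because `β` is a unit vector, the
    -- phases are unimodular and the `M` gains of a station add up to one.
    have hU : (P.Umat N r p *ᵥ β) k = ∑ i : Fin L × Fin M,
        conj (P.dft N (fun n => r i.1 n i.2) k) * (β i.1 *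
          Complex.exp (-Complex.I * ((P.freq N k * P.τ i.1 p : ℝ) : ℂ)) * P.a i.1 p i.2) := by
      rw [Fintype.sum_prod_type]
      simp only [Matrix.mulVec, dotProduct, Umat, Matrix.of_apply, Finset.mul_sum, Finset.sum_mul]
      refine Finset.sum_congr rfl fun ℓ _ => Finset.sum_congr rfl fun m _ => ?_
      ring
    rw [hU, ← Fintype.sum_prod_type', ← Fintype.sum_prod_type', ← sum_sq_residual]
    · refine Finset.sum_congr rfl fun i _ => ?_
      congr 3
      ring
    · rw [Fintype.sum_prod_type, ← hβ]
      refine Finset.sum_congr rfl fun ℓ _ => ?_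
      have he : ‖Complex.exp (-Complex.I * ((P.freq N k * P.τ ℓ p : ℝ) : ℂ))‖ = 1 := by
        rw [neg_mul, mul_comm, ← neg_mul, ← Complex.ofReal_neg, Complex.norm_exp_ofReal_mul_I]
      simp only [norm_mul, he, mul_pow, hgain]
      rw [Finset.sum_const, Finset.card_univ, Fintype.card_fin, nsmul_eq_mul]
      field_simp
  obtain ⟨β, hβ, hβr⟩ := (exists_eigenvector_lambdaMax hL (P.isHermitian_D N r p)).1
  -- The minimizer: a top eigenvector of `D(p)` as the channel, together with the signal that makes
  -- the completed square vanish.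
  let q : (Fin N → ℂ) × {β : Fin L → ℂ // ∑ ℓ, ‖β ℓ‖ ^ 2 = 1} :=
    (fun k => conj ((P.Umat N r p *ᵥ β) k), ⟨β, hβ⟩)
  have : Nonempty ((Fin N → ℂ) × {β : Fin L → ℂ // ∑ ℓ, ‖β ℓ‖ ^ 2 = 1}) := ⟨q⟩
  refine le_antisymm ((ciInf_le ⟨0, ?_⟩ q).trans (le_of_eq ?_)) (le_ciInf fun q => ?_)
  · rintro _ ⟨q, rfl⟩
    positivity
  · rw [hcost _ _ q.2.2]
    simp [q, hβr]
  · rw [hcost _ _ q.2.2]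
    have := rayleigh_le_lambdaMax hL (P.isHermitian_D N r p) q.2.1
    rw [q.2.2, mul_one] at this
    have h0 : 0 ≤ ∑ k, ‖q.1 k - conj ((P.Umat N r p *ᵥ q.2.1) k)‖ ^ 2 := by positivity
    linarith

lemma IsDPDEstimate.lambdaMax_D_le {P : Scenario L M K} (hL : 0 < L) (hM : 0 < M)
    (hgain : ∀ ℓ p m, ‖P.a ℓ p m‖ ^ 2 = 1 / (M : ℝ)) {Θ : Set (EuclideanSpace ℝ (Fin K))} {N : ℕ}
    {r : Fin L → ℤ → Fin M → ℂ} {phat : EuclideanSpace ℝ (Fin K)}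
    (h : P.IsDPDEstimate Θ N r phat) {p : EuclideanSpace ℝ (Fin K)} (hp : p ∈ Θ) :
    lambdaMax (P.D N r p) ≤ lambdaMax (P.D N r phat) := by
  have := h.2 p hp
  rw [P.nlsCost_eq hL hM hgain, P.nlsCost_eq hL hM hgain] at this
  linarith

end Scenario

/-! ### The circular correlation theorem -/

/-- A geometric sum whose ratio is an `N`-th root of unity, equal to one exactly when `N` divides
`a`. -/
lemma sum_exp_two_pi_div {N : ℕ} (hN : N ≠ 0) (a : ℤ) :
    ∑ k : Fin N, Complex.exp (2 * Real.pi * Complex.I * (k : ℕ) * a / N) =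
      if (N : ℤ) ∣ a then (N : ℂ) else 0 := by
  have hN' : (N : ℂ) ≠ 0 := by exact_mod_cast hN
  set z := Complex.exp (2 * Real.pi * Complex.I * a / N) with hz
  have hpow (k : ℕ) : Complex.exp (2 * Real.pi * Complex.I * k * a / N) = z ^ k := by
    rw [hz, ← Complex.exp_nat_mul]
    congr 1
    ring
  have hone : z = 1 ↔ (N : ℤ) ∣ a := by
    rw [hz, Complex.exp_eq_one_iff]
    refine exists_congr fun n => ?_
    rw [div_eq_iff hN']
    constructor
    · intro h
      have h2 : (2 * Real.pi * Complex.I : ℂ) * a = (2 * Real.pi * Complex.I) * (N * n) := by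
        rw [h]; ring
      exact_mod_cast mul_left_cancel₀ Complex.two_pi_I_ne_zero h2
    · rintro rfl
      push_cast
      ring
  rw [Fin.sum_univ_eq_sum_range (fun k => Complex.exp (2 * Real.pi * Complex.I * k * a / N)) N]
  simp_rw [hpow]
  split_ifs with h
  · simp [hone.2 h]
  · have hz1 : z ≠ 1 := fun h' => h (hone.1 h')
    rw [geom_sum_eq hz1, ← hpow N]
    have : Complex.exp (2 * Real.pi * Complex.I * N * a / N) = 1 := by
      rw [Complex.exp_eq_one_iff]
      exact ⟨a, by field_simp⟩
    rw [this, sub_self, zero_div]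

namespace Scenario

variable {L M K : ℕ} (P : Scenario L M K)

/-- The normalized correlation at lag `d` of two signals, computed from their DFT coefficients. -/
noncomputable def dftCorr (N : ℕ) (x x' : ℤ → ℂ) (d : ℤ) : ℂ :=
  (1 / (N : ℂ)) * ∑ k : Fin N, P.dft N x k * conj (P.dft N x' k) *
    Complex.exp (Complex.I * ((P.freq N k * (d * P.Ts) : ℝ) : ℂ))

/-- After both transforms are expanded, orthogonality of the characters keeps only the pairs with
`n' ≡ n - d` modulo `N`. The residue is taken of the zero-based index; the outer `+ 1` returns to
samples numbered from one. -/
lemma dftCorr_eq (hTs : P.Ts ≠ 0) {N : ℕ} (hN : N ≠ 0) (x x' : ℤ → ℂ) (d : ℤ) :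
    P.dftCorr N x x' d = (1 / (N : ℂ)) *
      ∑ n ∈ Finset.range N, x ((n : ℤ) + 1) * conj (x' (((n : ℤ) - d) % N + 1)) := by
  have hN' : (N : ℂ) ≠ 0 := by exact_mod_cast hN
  have hTs' : (P.Ts : ℂ) ≠ 0 := by exact_mod_cast hTs
  rw [dftCorr]
  congr 1
  have hterm (k : Fin N) : P.dft N x k * conj (P.dft N x' k) *
      Complex.exp (Complex.I * ((P.freq N k * (d * P.Ts) : ℝ) : ℂ)) =
      (1 / (N : ℂ)) * ∑ n : Fin N, ∑ n' : Fin N, x ((n : ℤ) + 1) * conj (x' ((n' : ℤ) + 1)) *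
        Complex.exp (2 * Real.pi * Complex.I * (k : ℕ) * ((n' - n + d : ℤ) : ℂ) / N) := by
    have hsq : (1 / ((Real.sqrt N : ℝ) : ℂ)) * (1 / ((Real.sqrt N : ℝ) : ℂ)) = 1 / (N : ℂ) := by
      rw [div_mul_div_comm, one_mul, ← Complex.ofReal_mul, Real.mul_self_sqrt (Nat.cast_nonneg N)]
      simp
    rw [dft, dft, map_mul, map_sum, map_div₀, map_one, Complex.conj_ofReal, ← hsq]
    simp only [Finset.mul_sum, Finset.sum_mul]
    rw [Finset.sum_comm]
    refine Finset.sum_congr rfl fun n _ => Finset.sum_congr rfl fun n' _ => ?_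
    rw [map_mul, ← Complex.exp_conj]
    have he : Complex.exp (2 * Real.pi * Complex.I * (k : ℕ) * ((n' - n + d : ℤ) : ℂ) / N) =
        Complex.exp (-Complex.I * ((P.freq N k * ((n : ℝ) * P.Ts) : ℝ) : ℂ)) *
        Complex.exp (conj (-Complex.I * ((P.freq N k * ((n' : ℝ) * P.Ts) : ℝ) : ℂ))) *
        Complex.exp (Complex.I * ((P.freq N k * (d * P.Ts) : ℝ) : ℂ)) := by
      rw [← Complex.exp_add, ← Complex.exp_add, map_mul, Complex.conj_ofReal, map_neg,
        Complex.conj_I, freq]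
      congr 1
      push_cast
      field_simp
      ring
    rw [he]
    ring
  simp_rw [hterm]
  rw [← Finset.mul_sum, Finset.sum_comm, ← Fin.sum_univ_eq_sum_range
    (fun n => x ((n : ℤ) + 1) * conj (x' (((n : ℤ) - d) % N + 1))) N, Finset.mul_sum]
  refine Finset.sum_congr rfl fun n _ => ?_
  rw [Finset.sum_comm]
  simp_rw [← Finset.mul_sum, sum_exp_two_pi_div hN]
  have hNpos : (0 : ℤ) < N := by exact_mod_cast Nat.pos_of_ne_zero hN
  have hm0 := Int.emod_nonneg ((n : ℤ) - d) hNpos.ne'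
  have hmN := Int.emod_lt_of_pos ((n : ℤ) - d) hNpos
  obtain ⟨m, hm⟩ := Int.eq_ofNat_of_zero_le hm0
  have hmN' : m < N := by omega
  rw [Finset.sum_eq_single (⟨m, hmN'⟩ : Fin N)]
  · have hdvd : (N : ℤ) ∣ ((m : ℤ) - n + d) := by
      rw [← hm]
      have := Int.emod_add_mul_ediv ((n : ℤ) - d) N
      exact ⟨-(((n : ℤ) - d) / N), by linarith⟩
    rw [if_pos hdvd, hm]
    field_simp
  · intro n' _ hne
    rw [if_neg, mul_zero]
    intro hdvd
    apply hne
    have h2 : (n' : ℤ) = ((n : ℤ) - d) % N := by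
      have h3 : (((n : ℤ) - d) - n') % N = 0 := by
        apply Int.emod_eq_zero_of_dvd
        rwa [← dvd_neg, show -(((n : ℤ) - d) - n') = n' - n + d by ring]
      rw [← Int.emod_eq_emod_iff_emod_sub_eq_zero] at h3
      rw [h3, Int.emod_eq_of_lt (by positivity) (by exact_mod_cast n'.2)]
    ext
    simp only
    omega
  · simp

/-- The circular correlation differs from the linear one in at most `|d|` terms. -/
lemma norm_dftCorr_sub_le (hTs : P.Ts ≠ 0) {N : ℕ} (hN : N ≠ 0) (x x' : ℤ → ℂ) (d : ℤ) :
    ‖P.dftCorr N x x' d -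
      (1 / (N : ℂ)) * ∑ n ∈ Finset.range N, x ((n : ℤ) + 1) * conj (x' ((n : ℤ) + 1 - d))‖ ≤
      (1 / (N : ℝ)) * ∑ n ∈ (Finset.range N).filter (fun n : ℕ => ¬ (d ≤ n ∧ (n : ℤ) < N + d)),
        (‖x ((n : ℤ) + 1)‖ ^ 2 +
          (‖x' (((n : ℤ) - d) % N + 1)‖ ^ 2 + ‖x' ((n : ℤ) + 1 - d)‖ ^ 2)) := by
  rw [P.dftCorr_eq hTs hN, ← mul_sub, ← Finset.sum_sub_distrib, norm_mul, norm_div, norm_one,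
    Complex.norm_natCast]
  gcongr
  -- For `d ≤ n < N + d` the shift does not wrap around, so the circular and linear terms cancel.
  -- Only the boundary terms remain, and these are estimated by `2xy ≤ x² + y²`.
  rw [← Finset.sum_filter_add_sum_filter_not _ (fun n : ℕ => d ≤ n ∧ (n : ℤ) < N + d),
    Finset.sum_eq_zero, zero_add]
  · refine (norm_sum_le _ _).trans (Finset.sum_le_sum fun n _ => ?_)
    refine (norm_sub_le _ _).trans ?_
    rw [norm_mul, norm_mul, RCLike.norm_conj, RCLike.norm_conj]
    nlinarith [sq_nonneg (‖x ((n : ℤ) + 1)‖ - ‖x' (((n : ℤ) - d) % N + 1)‖),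
      sq_nonneg (‖x ((n : ℤ) + 1)‖ - ‖x' ((n : ℤ) + 1 - d)‖),
      sq_nonneg (‖x' (((n : ℤ) - d) % N + 1)‖), sq_nonneg (‖x' ((n : ℤ) + 1 - d)‖)]
  · intro n hn
    rw [Finset.mem_filter] at hn
    rw [Int.emod_eq_of_lt (by omega) (by omega), show (n : ℤ) - d + 1 = n + 1 - d by ring, sub_self]

lemma card_filter_boundary_le (N : ℕ) (d : ℤ) :
    ((Finset.range N).filter (fun n : ℕ => ¬ (d ≤ n ∧ (n : ℤ) < N + d))).card ≤ d.natAbs := by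
  rcases le_total 0 d with hd | hd
  · calc _ ≤ (Finset.range d.natAbs).card := Finset.card_le_card fun n hn => by
          simp only [Finset.mem_filter, Finset.mem_range] at hn ⊢
          omega
      _ = _ := Finset.card_range _
  · calc _ ≤ (Finset.Ico (N - d.natAbs) N).card := Finset.card_le_card fun n hn => by
          simp only [Finset.mem_filter, Finset.mem_range, Finset.mem_Ico] at hn ⊢
          omega
      _ ≤ _ := by rw [Nat.card_Ico]; omega

end Scenario

/-! ### The arcsine law -/

lemma sgn_of_pos {x : ℝ} (hx : 0 < x) : sgn x = 1 := if_pos hx.le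

lemma sgn_of_neg {x : ℝ} (hx : x < 0) : sgn x = -1 := if_neg (not_le.2 hx)

lemma sgn_mul_of_pos {r : ℝ} (hr : 0 < r) (x : ℝ) : sgn (r * x) = sgn x := by
  simp only [sgn, mul_nonneg_iff_of_pos_left hr]

lemma measurable_sgn : Measurable sgn :=
  Measurable.ite measurableSet_Ici measurable_const measurable_const

lemma abs_sgn (x : ℝ) : |sgn x| = 1 := by
  unfold sgn
  split_ifs <;> simp

/-- The standard Gaussian density on the plane is radial, so in polar coordinates a function of the
angle alone separates from the radius. The radial factor can stay unevaluated. -/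
lemma integral_prod_gaussianReal_of_angular (f : ℝ × ℝ → ℝ) (g : ℝ → ℝ)
    (h : ∀ r > 0, ∀ φ, f (r * Real.cos φ, r * Real.sin φ) = g φ) :
    ∫ p, f p ∂((gaussianReal 0 1).prod (gaussianReal 0 1)) =
      (∫ r in Set.Ioi (0 : ℝ), r * ((2 * Real.pi)⁻¹ * Real.exp (-r ^ 2 / 2))) *
        ∫ φ in Set.Ioo (-Real.pi) Real.pi, g φ := by
  rw [gaussianReal_of_var_ne_zero _ one_ne_zero,
    prod_withDensity (measurable_gaussianPDF _ _) (measurable_gaussianPDF _ _),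
    integral_withDensity_eq_integral_toReal_smul (by fun_prop)
      (ae_of_all _ fun p => ENNReal.mul_lt_top gaussianPDF_lt_top gaussianPDF_lt_top),
    ← Measure.volume_eq_prod, ← integral_comp_polarCoord_symm, ← setIntegral_prod_mul,
    ← Measure.volume_eq_prod, polarCoord_target]
  refine setIntegral_congr_fun (measurableSet_Ioi.prod measurableSet_Ioo) fun p hp => ?_
  have hr : 0 < p.1 := hp.1
  simp only [polarCoord_symm_apply, smul_eq_mul, h p.1 hr, ENNReal.toReal_mul,
    toReal_gaussianPDF, gaussianPDFReal_def]
  have hs : (Real.sqrt (2 * Real.pi * ((1 : NNReal) : ℝ)))⁻¹ *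
      (Real.sqrt (2 * Real.pi * ((1 : NNReal) : ℝ)))⁻¹ = (2 * Real.pi)⁻¹ := by
    rw [← mul_inv, Real.mul_self_sqrt (by positivity)]
    simp
  have he : Real.exp (-(p.1 * Real.cos p.2 - 0) ^ 2 / (2 * ((1 : NNReal) : ℝ))) *
      Real.exp (-(p.1 * Real.sin p.2 - 0) ^ 2 / (2 * ((1 : NNReal) : ℝ))) =
      Real.exp (-p.1 ^ 2 / 2) := by
    rw [← Real.exp_add]
    congr 1
    rw [NNReal.coe_one]
    linear_combination (-p.1 ^ 2 / 2) * Real.sin_sq_add_cos_sq p.2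
  rw [← hs, ← he]
  ring

lemma integral_angular_eq_average (f : ℝ × ℝ → ℝ) (g : ℝ → ℝ)
    (h : ∀ r > 0, ∀ φ, f (r * Real.cos φ, r * Real.sin φ) = g φ) :
    ∫ p, f p ∂((gaussianReal 0 1).prod (gaussianReal 0 1)) =
      (2 * Real.pi)⁻¹ * ∫ φ in (-Real.pi)..Real.pi, g φ := by
  -- The constant function one determines the radial factor: the total mass is one and the angular
  -- integral is `2π`.
  have h1 := integral_prod_gaussianReal_of_angular (fun _ => 1) (fun _ => 1) (by simp)
  rw [integral_prod_gaussianReal_of_angular f g h, intervalIntegral.integral_of_le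
    (by linarith [Real.pi_pos]), integral_Ioc_eq_integral_Ioo]
  congr 1
  rw [integral_const, probReal_univ, setIntegral_const] at h1
  simp only [smul_eq_mul, mul_one, Real.volume_real_Ioo_of_le
    (show -Real.pi ≤ Real.pi by linarith [Real.pi_pos])] at h1
  rw [show Real.pi - -Real.pi = 2 * Real.pi by ring] at h1
  exact eq_inv_of_mul_eq_one_left h1.symm

/-- On the period `[-π/2, 3π/2]` the sign changes only at `-θ`, `π/2` and `π - θ`. The four pieces
have lengths `π/2 - θ`, `π/2 + θ`, `π/2 - θ`, `π/2 + θ` and signs `-`, `+`, `-`, `+`, which sum to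
`4θ`. -/
lemma integral_sgn_cos_mul_sgn_sin {θ : ℝ} (h1 : -(Real.pi / 2) ≤ θ) (h2 : θ ≤ Real.pi / 2) :
    ∫ φ in (-Real.pi)..Real.pi, sgn (Real.cos φ) * sgn (Real.sin (φ + θ)) = 4 * θ := by
  have hpi := Real.pi_pos
  set g : ℝ → ℝ := fun φ => sgn (Real.cos φ) * sgn (Real.sin (φ + θ)) with hg
  have hper : Function.Periodic g (2 * Real.pi) := fun φ => by
    simp only [hg, Real.cos_add_two_pi, show φ + 2 * Real.pi + θ = (φ + θ) + 2 * Real.pi by ring,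
      Real.sin_add_two_pi]
  have hint (a b : ℝ) : IntervalIntegrable g volume a b := by
    refine (intervalIntegrable_const (c := (1 : ℝ))).mono_fun ?_ (ae_of_all _ fun φ => ?_)
    · exact ((measurable_sgn.comp Real.measurable_cos).mul
        (measurable_sgn.comp (by fun_prop))).aestronglyMeasurable
    · simp [hg, abs_sgn]
  have hpiece {a b c : ℝ} (hab : a ≤ b) (hc : ∀ φ ∈ Set.Ioo a b, g φ = c) :
      ∫ φ in a..b, g φ = (b - a) * c := by
    rw [intervalIntegral.integral_congr_Ioo_of_le hab hc, intervalIntegral.integral_const,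
      smul_eq_mul]
  have e0 := hper.intervalIntegral_add_eq (-Real.pi) (-(Real.pi / 2))
  rw [show -Real.pi + 2 * Real.pi = Real.pi by ring,
    show -(Real.pi / 2) + 2 * Real.pi = 3 * Real.pi / 2 by ring] at e0
  rw [e0, ← intervalIntegral.integral_add_adjacent_intervals (hint _ (-θ)) (hint _ _),
    ← intervalIntegral.integral_add_adjacent_intervals (hint (-θ) (Real.pi / 2)) (hint _ _),
    ← intervalIntegral.integral_add_adjacent_intervals (hint (Real.pi / 2) (Real.pi - θ))
      (hint _ _)]
  have hcos {φ : ℝ} (a : Real.pi / 2 < φ) (b : φ < 3 * Real.pi / 2) : Real.cos φ < 0 :=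
    Real.cos_neg_of_pi_div_two_lt_of_lt a (by linarith)
  have hsin {φ : ℝ} (a : Real.pi < φ) (b : φ < 2 * Real.pi) : Real.sin φ < 0 := by
    have := Real.sin_pos_of_pos_of_lt_pi (x := φ - Real.pi) (by linarith) (by linarith)
    rw [Real.sin_sub_pi] at this
    linarith
  rw [hpiece (c := -1) (by linarith), hpiece (c := 1) (by linarith),
    hpiece (c := -1) (by linarith), hpiece (c := 1) (by linarith)]
  · ring
  · rintro φ ⟨a, b⟩
    simp only [hg]
    rw [sgn_of_neg (hcos (by linarith) (by linarith)),
      sgn_of_neg (hsin (by linarith) (by linarith))]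
    norm_num
  · rintro φ ⟨a, b⟩
    simp only [hg]
    rw [sgn_of_neg (hcos (by linarith) (by linarith)),
      sgn_of_pos (Real.sin_pos_of_pos_of_lt_pi (by linarith) (by linarith))]
    norm_num
  · rintro φ ⟨a, b⟩
    simp only [hg]
    rw [sgn_of_pos (Real.cos_pos_of_mem_Ioo ⟨by linarith, by linarith⟩),
      sgn_of_pos (Real.sin_pos_of_pos_of_lt_pi (by linarith) (by linarith))]
    norm_num
  · rintro φ ⟨a, b⟩
    simp only [hg]
    rw [sgn_of_pos (Real.cos_pos_of_mem_Ioo ⟨by linarith, by linarith⟩),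
      sgn_of_neg (Real.sin_neg_of_neg_of_neg_pi_lt (by linarith) (by linarith))]
    norm_num

variable {Ω Ω' : Type*} [MeasurableSpace Ω] [MeasurableSpace Ω']

/-- The characteristic function of a Gaussian law depends only on the mean and variance of each
continuous linear functional. For centered variables the variance is the second moment. -/
lemma map_eq_of_dual_moments {E : Type*} [NormedAddCommGroup E] [NormedSpace ℝ E]
    [MeasurableSpace E] [BorelSpace E] [SecondCountableTopology E] [CompleteSpace E]
    {μ : Measure Ω} {ν : Measure Ω'} {X : Ω → E} {Y : Ω' → E}
    (hX : HasGaussianLaw X μ) (hY : HasGaussianLaw Y ν)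
    (hX0 : ∀ l : StrongDual ℝ E, ∫ ω, l (X ω) ∂μ = 0)
    (hY0 : ∀ l : StrongDual ℝ E, ∫ ω, l (Y ω) ∂ν = 0)
    (h : ∀ l : StrongDual ℝ E, ∫ ω, l (X ω) ^ 2 ∂μ = ∫ ω, l (Y ω) ^ 2 ∂ν) :
    μ.map X = ν.map Y := by
  have := hX.isGaussian_map
  have := hY.isGaussian_map
  refine Measure.ext_of_charFunDual (funext fun l => ?_)
  rw [hX.charFunDual_map_eq_fun, hY.charFunDual_map_eq_fun, hX0, hY0,
    variance_of_integral_eq_zero (hX.map_fun l).aemeasurable (hX0 l),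
    variance_of_integral_eq_zero (hY.map_fun l).aemeasurable (hY0 l), h]

lemma integral_sq_add {μ : Measure Ω} {X Y : Ω → ℝ} (hX : MemLp X 2 μ) (hY : MemLp Y 2 μ)
    (α β : ℝ) :
    ∫ ω, (α * X ω + β * Y ω) ^ 2 ∂μ = α ^ 2 * ∫ ω, X ω * X ω ∂μ +
      2 * α * β * ∫ ω, X ω * Y ω ∂μ + β ^ 2 * ∫ ω, Y ω * Y ω ∂μ := by
  have iXX : Integrable (fun ω => X ω * X ω) μ := hX.integrable_mul hX
  have iYY : Integrable (fun ω => Y ω * Y ω) μ := hY.integrable_mul hY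
  have iXY : Integrable (fun ω => X ω * Y ω) μ := hX.integrable_mul hY
  have i1 : Integrable (fun ω => α ^ 2 * (X ω * X ω) + 2 * α * β * (X ω * Y ω)) μ :=
    (iXX.const_mul _).add (iXY.const_mul _)
  rw [← integral_const_mul, ← integral_const_mul, ← integral_const_mul,
    ← integral_add (iXX.const_mul _) (iXY.const_mul _), ← integral_add i1 (iYY.const_mul _)]
  refine integral_congr_ae (ae_of_all _ fun ω => ?_)
  ring

lemma integral_dual_prodMk {μ : Measure Ω} {X Y : Ω → ℝ}
    (hG : HasGaussianLaw (fun ω => (X ω, Y ω)) μ)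
    (hX0 : ∫ ω, X ω ∂μ = 0) (hY0 : ∫ ω, Y ω ∂μ = 0) (l : StrongDual ℝ (ℝ × ℝ)) :
    ∫ ω, l (X ω, Y ω) ∂μ = 0 ∧ ∫ ω, l (X ω, Y ω) ^ 2 ∂μ =
      l (1, 0) ^ 2 * ∫ ω, X ω * X ω ∂μ + 2 * l (1, 0) * l (0, 1) * ∫ ω, X ω * Y ω ∂μ +
        l (0, 1) ^ 2 * ∫ ω, Y ω * Y ω ∂μ := by
  have hl (x y : ℝ) : l (x, y) = l (1, 0) * x + l (0, 1) * y := by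
    have : (x, y) = x • ((1, 0) : ℝ × ℝ) + y • ((0, 1) : ℝ × ℝ) := by simp
    rw [this, map_add, map_smul, map_smul, smul_eq_mul, smul_eq_mul, mul_comm x, mul_comm y]
  simp_rw [fun ω => hl (X ω) (Y ω)]
  refine ⟨?_, integral_sq_add hG.fst.memLp_two hG.snd.memLp_two _ _⟩
  rw [integral_add (hG.fst.integrable.const_mul _) (hG.snd.integrable.const_mul _),
    integral_const_mul, integral_const_mul, hX0, hY0]
  simp

lemma map_prodMk_eq_of_moments {μ : Measure Ω} {ν : Measure Ω'} {X Y : Ω → ℝ} {X' Y' : Ω' → ℝ}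
    (hG : HasGaussianLaw (fun ω => (X ω, Y ω)) μ) (hG' : HasGaussianLaw (fun ω => (X' ω, Y' ω)) ν)
    (hX0 : ∫ ω, X ω ∂μ = 0) (hY0 : ∫ ω, Y ω ∂μ = 0)
    (hX0' : ∫ ω, X' ω ∂ν = 0) (hY0' : ∫ ω, Y' ω ∂ν = 0)
    (hXX : ∫ ω, X ω * X ω ∂μ = ∫ ω, X' ω * X' ω ∂ν)
    (hYY : ∫ ω, Y ω * Y ω ∂μ = ∫ ω, Y' ω * Y' ω ∂ν)
    (hXY : ∫ ω, X ω * Y ω ∂μ = ∫ ω, X' ω * Y' ω ∂ν) :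
    μ.map (fun ω => (X ω, Y ω)) = ν.map (fun ω => (X' ω, Y' ω)) := by
  refine map_eq_of_dual_moments hG hG' (fun l => (integral_dual_prodMk hG hX0 hY0 l).1)
    (fun l => (integral_dual_prodMk hG' hX0' hY0' l).1) fun l => ?_
  rw [(integral_dual_prodMk hG hX0 hY0 l).2, (integral_dual_prodMk hG' hX0' hY0' l).2, hXX, hYY, hXY]

/-- The arcsine law for a centered Gaussian pair. -/
lemma integral_sgn_mul_sgn {μ : Measure Ω} {X Y : Ω → ℝ}
    (hG : HasGaussianLaw (fun ω => (X ω, Y ω)) μ)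
    (hX0 : ∫ ω, X ω ∂μ = 0) (hY0 : ∫ ω, Y ω ∂μ = 0) {a b c : ℝ} (ha : 0 < a) (hb : 0 < b)
    (hXX : ∫ ω, X ω * X ω ∂μ = a ^ 2) (hYY : ∫ ω, Y ω * Y ω ∂μ = b ^ 2)
    (hXY : ∫ ω, X ω * Y ω ∂μ = a * b * c) :
    |c| ≤ 1 ∧ ∫ ω, sgn (X ω) * sgn (Y ω) ∂μ = 2 / Real.pi * Real.arcsin c := by
  have hX := hG.fst.memLp_two
  have hY := hG.snd.memLp_two
  -- Cauchy–Schwarz in the form `E(bX ± aY)² ≥ 0`; the two signs `e = ±1` give the two bounds on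
  -- `c`.
  have hc (e : ℝ) (he : e ^ 2 = 1) : 0 ≤ 2 * (a * b) ^ 2 * (1 + e * c) := by
    have : 0 ≤ ∫ ω, (b * X ω + e * a * Y ω) ^ 2 ∂μ := integral_nonneg fun ω => sq_nonneg _
    rw [integral_sq_add hX hY, hXX, hYY, hXY] at this
    linear_combination this + a ^ 2 * b ^ 2 * he
  have hc1 : |c| ≤ 1 := by
    have hab : 0 < 2 * (a * b) ^ 2 := by positivity
    have h1 := nonneg_of_mul_nonneg_right (hc 1 (by norm_num)) hab
    have h2 := nonneg_of_mul_nonneg_right (hc (-1) (by norm_num)) hab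
    rw [abs_le]
    constructor <;> linarith
  refine ⟨hc1, ?_⟩
  set θ := Real.arcsin c with hθ
  have hsin : Real.sin θ = c := Real.sin_arcsin (abs_le.1 hc1).1 (abs_le.1 hc1).2
  let γ : Measure (ℝ × ℝ) := (gaussianReal 0 1).prod (gaussianReal 0 1)
  have hγ : HasGaussianLaw (fun p : ℝ × ℝ => (p.1, p.2)) γ := IsGaussian.hasGaussianLaw_id
  have hG1 : HasGaussianLaw (fun ω => (a⁻¹ * X ω, b⁻¹ * Y ω)) μ :=
    hG.map_fun ((a⁻¹ • ContinuousLinearMap.fst ℝ ℝ ℝ).prod (b⁻¹ • ContinuousLinearMap.snd ℝ ℝ ℝ))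
  -- With `θ = arcsin c`, this pair built from independent standard normals has unit variances and
  -- correlation `sin θ = c`, hence the law of the normalized pair `(X/a, Y/b)`.
  have hG2 : HasGaussianLaw
      (fun p : ℝ × ℝ => (p.1, Real.sin θ * p.1 + Real.cos θ * p.2)) γ :=
    hγ.map_fun ((ContinuousLinearMap.fst ℝ ℝ ℝ).prod
      (Real.sin θ • ContinuousLinearMap.fst ℝ ℝ ℝ + Real.cos θ • ContinuousLinearMap.snd ℝ ℝ ℝ))
  have hm0 : ∫ x, x ∂(gaussianReal 0 1) = 0 := integral_id_gaussianReal
  have hm2 : ∫ x, x * x ∂(gaussianReal 0 1) = 1 := by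
    have := variance_of_integral_eq_zero (X := id) aemeasurable_id hm0
    rw [variance_id_gaussianReal] at this
    simpa [pow_two] using this.symm
  have p1 : ∫ p : ℝ × ℝ, p.1 ∂γ = 0 := by
    simpa [hm0] using integral_prod_mul (μ := gaussianReal 0 1) (ν := gaussianReal 0 1)
      (fun x : ℝ => x) (fun _ : ℝ => (1 : ℝ))
  have p2 : ∫ p : ℝ × ℝ, p.2 ∂γ = 0 := by
    simpa [hm0] using integral_prod_mul (μ := gaussianReal 0 1) (ν := gaussianReal 0 1)
      (fun _ : ℝ => (1 : ℝ)) (fun x : ℝ => x)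
  have p11 : ∫ p : ℝ × ℝ, p.1 * p.1 ∂γ = 1 := by
    simpa [hm2] using integral_prod_mul (μ := gaussianReal 0 1) (ν := gaussianReal 0 1)
      (fun x : ℝ => x * x) (fun _ : ℝ => (1 : ℝ))
  have p22 : ∫ p : ℝ × ℝ, p.2 * p.2 ∂γ = 1 := by
    simpa [hm2] using integral_prod_mul (μ := gaussianReal 0 1) (ν := gaussianReal 0 1)
      (fun _ : ℝ => (1 : ℝ)) (fun x : ℝ => x * x)
  have p12 : ∫ p : ℝ × ℝ, p.1 * p.2 ∂γ = 0 := by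
    simpa [hm0] using integral_prod_mul (μ := gaussianReal 0 1) (ν := gaussianReal 0 1)
      (fun x : ℝ => x) (fun x : ℝ => x)
  have m1 := hγ.fst.memLp_two
  have m2 := hγ.snd.memLp_two
  have i1 : Integrable (fun p : ℝ × ℝ => p.1) γ := hγ.fst.integrable
  have i2 : Integrable (fun p : ℝ × ℝ => p.2) γ := hγ.snd.integrable
  have i11 : Integrable (fun p : ℝ × ℝ => p.1 * p.1) γ := m1.integrable_mul m1
  have i12 : Integrable (fun p : ℝ × ℝ => p.1 * p.2) γ := m1.integrable_mul m2
  have hlaw := map_prodMk_eq_of_moments hG1 hG2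
    (by rw [integral_const_mul, hX0, mul_zero]) (by rw [integral_const_mul, hY0, mul_zero]) p1
    (by rw [integral_add (i1.const_mul _) (i2.const_mul _), integral_const_mul,
          integral_const_mul, p1, p2]; simp)
    (by
      rw [p11]
      calc ∫ ω, a⁻¹ * X ω * (a⁻¹ * X ω) ∂μ = (a⁻¹) ^ 2 * ∫ ω, X ω * X ω ∂μ := by
            rw [← integral_const_mul]
            exact integral_congr_ae (ae_of_all _ fun ω => by ring)
        _ = 1 := by rw [hXX]; field_simp)
    (by
      calc ∫ ω, b⁻¹ * Y ω * (b⁻¹ * Y ω) ∂μ = (b⁻¹) ^ 2 * ∫ ω, Y ω * Y ω ∂μ := by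
            rw [← integral_const_mul]
            exact integral_congr_ae (ae_of_all _ fun ω => by ring)
        _ = 1 := by rw [hYY]; field_simp
        _ = Real.sin θ ^ 2 * ∫ p : ℝ × ℝ, p.1 * p.1 ∂γ +
            2 * Real.sin θ * Real.cos θ * ∫ p : ℝ × ℝ, p.1 * p.2 ∂γ +
            Real.cos θ ^ 2 * ∫ p : ℝ × ℝ, p.2 * p.2 ∂γ := by
          rw [p11, p12, p22]
          linear_combination -(Real.sin_sq_add_cos_sq θ)
        _ = _ := by
          rw [← integral_sq_add m1 m2]
          exact integral_congr_ae (ae_of_all _ fun p => by ring))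
    (by
      calc ∫ ω, a⁻¹ * X ω * (b⁻¹ * Y ω) ∂μ = (a⁻¹ * b⁻¹) * ∫ ω, X ω * Y ω ∂μ := by
            rw [← integral_const_mul]
            exact integral_congr_ae (ae_of_all _ fun ω => by ring)
        _ = Real.sin θ := by rw [hXY, hsin]; field_simp
        _ = Real.sin θ * ∫ p : ℝ × ℝ, p.1 * p.1 ∂γ + Real.cos θ * ∫ p : ℝ × ℝ, p.1 * p.2 ∂γ := by
          rw [p11, p12]; ring
        _ = _ := by
          rw [← integral_const_mul, ← integral_const_mul,
            ← integral_add (i11.const_mul _) (i12.const_mul _)]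
          exact integral_congr_ae (ae_of_all _ fun p => by ring))
  have hmeas : Measurable fun p : ℝ × ℝ => sgn p.1 * sgn p.2 :=
    (measurable_sgn.comp measurable_fst).mul (measurable_sgn.comp measurable_snd)
  calc ∫ ω, sgn (X ω) * sgn (Y ω) ∂μ = ∫ ω, sgn (a⁻¹ * X ω) * sgn (b⁻¹ * Y ω) ∂μ := by
        simp_rw [sgn_mul_of_pos (inv_pos.2 ha), sgn_mul_of_pos (inv_pos.2 hb)]
    _ = ∫ p : ℝ × ℝ, sgn p.1 * sgn p.2 ∂(μ.map fun ω => (a⁻¹ * X ω, b⁻¹ * Y ω)) :=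
        (integral_map hG1.aemeasurable hmeas.aestronglyMeasurable).symm
    _ = ∫ p : ℝ × ℝ, sgn p.1 * sgn (Real.sin θ * p.1 + Real.cos θ * p.2) ∂γ := by
        rw [hlaw, integral_map hG2.aemeasurable hmeas.aestronglyMeasurable]
    _ = (2 * Real.pi)⁻¹ *
        ∫ φ in (-Real.pi)..Real.pi, sgn (Real.cos φ) * sgn (Real.sin (φ + θ)) := by
        -- In polar coordinates the second variable is `r sin(φ + θ)`, so the sign product depends
        -- on the angle only.
        refine integral_angular_eq_average _ _ fun r hr φ => ?_
        dsimp only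
        rw [show Real.sin θ * (r * Real.cos φ) + Real.cos θ * (r * Real.sin φ) =
          r * Real.sin (φ + θ) by rw [Real.sin_add]; ring, sgn_mul_of_pos hr, sgn_mul_of_pos hr]
    _ = 2 / Real.pi * θ := by
        rw [integral_sgn_cos_mul_sgn_sin (Real.neg_pi_div_two_le_arcsin c)
          (Real.arcsin_le_pi_div_two c)]
        have := Real.pi_pos
        field_simp
        ring

variable {Ω : Type*} [MeasurableSpace Ω] {μ : Measure Ω}

/-- A product of real parts is half the real part of `zw + z w̄`, and circularity removes the first
term. Taking `u`, `w` in `{1, j}` selects real or imaginary parts, since `Re(-jX) = Im X`. -/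
lemma integral_re_mul_re {X Y : Ω → ℂ} (hX : MemLp X 2 μ) (hY : MemLp Y 2 μ)
    (hXY : ∫ ω, X ω * Y ω ∂μ = 0) (u w : ℂ) :
    ∫ ω, (conj u * X ω).re * (conj w * Y ω).re ∂μ =
      (conj u * w * ∫ ω, X ω * conj (Y ω) ∂μ).re / 2 := by
  have hYc : MemLp (fun ω => conj (Y ω)) 2 μ := hY.star
  have i1 : Integrable (fun ω => X ω * Y ω) μ := hX.integrable_mul hY
  have i2 : Integrable (fun ω => X ω * conj (Y ω)) μ := hX.integrable_mul hYc
  have h1 : ∀ ω, (conj u * X ω).re * (conj w * Y ω).re = RCLike.re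
      (conj u * conj w / 2 * (X ω * Y ω) + conj u * w / 2 * (X ω * conj (Y ω))) := fun ω => by
    simp only [RCLike.re_to_complex, Complex.add_re, Complex.mul_re, Complex.mul_im,
      Complex.conj_re, Complex.conj_im, Complex.div_ofNat_re, Complex.div_ofNat_im]
    ring
  simp_rw [h1]
  have i3 : Integrable (fun ω => conj u * conj w / 2 * (X ω * Y ω) +
      conj u * w / 2 * (X ω * conj (Y ω))) μ := (i1.const_mul _).add (i2.const_mul _)
  rw [integral_re i3, integral_add (i1.const_mul _) (i2.const_mul _), integral_const_mul, integral_const_mul, hXY,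
    mul_zero, zero_add, div_mul_eq_mul_div]
  simp

/-- The arcsine law for one-bit quantized circular Gaussian variables. -/
lemma csine_integral_quantize {X Y : Ω → ℂ} (hG : HasGaussianLaw (fun ω => (X ω, Y ω)) μ)
    (hX0 : ∫ ω, X ω ∂μ = 0) (hY0 : ∫ ω, Y ω ∂μ = 0)
    (hXX : ∫ ω, X ω * X ω ∂μ = 0) (hYY : ∫ ω, Y ω * Y ω ∂μ = 0) (hXY : ∫ ω, X ω * Y ω ∂μ = 0)
    {a b : ℝ} {c : ℂ} (ha : 0 < a) (hb : 0 < b)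
    (hXc : ∫ ω, X ω * conj (X ω) ∂μ = (a : ℂ) ^ 2) (hYc : ∫ ω, Y ω * conj (Y ω) ∂μ = (b : ℂ) ^ 2)
    (hXYc : ∫ ω, X ω * conj (Y ω) ∂μ = a * b * c) :
    csine (((Real.pi / 2 : ℝ) : ℂ) * ∫ ω, quantize (X ω) * conj (quantize (Y ω)) ∂μ) = c := by
  have := hG.isProbabilityMeasure
  have hX := hG.fst.memLp_two
  have hY := hG.snd.memLp_two
  have hmean {Z : Ω → ℂ} (hZ : Integrable Z μ) (hZ0 : ∫ ω, Z ω ∂μ = 0) (u : ℂ) :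
      ∫ ω, (conj u * Z ω).re ∂μ = 0 := by
    have := integral_re (𝕜 := ℂ) (hZ.const_mul (conj u))
    rw [integral_const_mul, hZ0, mul_zero] at this
    simpa using this
  have hsq : Real.sqrt 2 * Real.sqrt 2 = 2 := Real.mul_self_sqrt (by norm_num)
  have hs2 : 0 < Real.sqrt 2 := by positivity
  have hsq2 : Real.sqrt 2 ^ 2 = 2 := by rw [pow_two, hsq]
  -- The arcsine law for one of the four real pairs obtained by rotating `X` and `Y`. By circularity
  -- the real parts have standard deviations `a/√2` and `b/√2`, and their correlation is `Re(ū w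
  -- c)`.
  have key (u w : ℂ) (hu : conj u * u = 1) (hw : conj w * w = 1) :
      |(conj u * w * c).re| ≤ 1 ∧
      ∫ ω, sgn (conj u * X ω).re * sgn (conj w * Y ω).re ∂μ =
        2 / Real.pi * Real.arcsin (conj u * w * c).re := by
    refine integral_sgn_mul_sgn (a := a / Real.sqrt 2) (b := b / Real.sqrt 2) ?_
      (hmean hG.fst.integrable hX0 u) (hmean hG.snd.integrable hY0 w) (by positivity)
      (by positivity) ?_ ?_ ?_
    · exact hG.map_fun
        ((Complex.reCLM ∘L ContinuousLinearMap.mul ℝ ℂ (conj u) ∘L .fst ℝ ℂ ℂ).prod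
          (Complex.reCLM ∘L ContinuousLinearMap.mul ℝ ℂ (conj w) ∘L .snd ℝ ℂ ℂ))
    · rw [integral_re_mul_re hX hX hXX, hu, hXc, one_mul, div_pow, hsq2]
      norm_cast
    · rw [integral_re_mul_re hY hY hYY, hw, hYc, one_mul, div_pow, hsq2]
      norm_cast
    · rw [integral_re_mul_re hX hY hXY, hXYc, show conj u * w * (a * b * c) =
        ((a * b : ℝ) : ℂ) * (conj u * w * c) by push_cast; ring, Complex.re_ofReal_mul]
      field_simp
      rw [hsq2]
  have hI : conj Complex.I * Complex.I = 1 := by simp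
  obtain ⟨b1, k1⟩ := key 1 1 (by simp) (by simp)
  obtain ⟨-, k2⟩ := key Complex.I Complex.I hI hI
  obtain ⟨b3, k3⟩ := key Complex.I 1 hI (by simp)
  obtain ⟨-, k4⟩ := key 1 Complex.I (by simp) hI
  simp only [map_one, one_mul, mul_one, Complex.conj_I, neg_mul, Complex.neg_re,
    Complex.I_mul_re, neg_neg, Complex.I_mul_I] at b1 b3 k1 k2 k3 k4
  have mX : AEMeasurable X μ := hG.fst.aemeasurable
  have mY : AEMeasurable Y μ := hG.snd.aemeasurable
  have hint {U V : Ω → ℝ} (hU : AEMeasurable U μ) (hV : AEMeasurable V μ) :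
      Integrable (fun ω => sgn (U ω) * sgn (V ω)) μ := by
    refine Integrable.of_bound (C := 1) ((measurable_sgn.comp_aemeasurable hU).mul
      (measurable_sgn.comp_aemeasurable hV)).aestronglyMeasurable (ae_of_all _ fun ω => ?_)
    simp [abs_sgn]
  have mXr : AEMeasurable (fun ω => (X ω).re) μ := Complex.measurable_re.comp_aemeasurable mX
  have mXi : AEMeasurable (fun ω => (X ω).im) μ := Complex.measurable_im.comp_aemeasurable mX
  have mYr : AEMeasurable (fun ω => (Y ω).re) μ := Complex.measurable_re.comp_aemeasurable mY
  have mYi : AEMeasurable (fun ω => (Y ω).im) μ := Complex.measurable_im.comp_aemeasurable mY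
  have hq (z w : ℂ) : quantize z * conj (quantize w) =
      (((sgn z.re * sgn w.re + sgn z.im * sgn w.im) / 2 : ℝ) : ℂ) +
        Complex.I * (((sgn z.im * sgn w.re - sgn z.re * sgn w.im) / 2 : ℝ) : ℂ) := by
    have h2 : ((Real.sqrt 2 : ℝ) : ℂ) * ((Real.sqrt 2 : ℝ) : ℂ) = 2 := by exact_mod_cast hsq
    simp only [quantize, map_div₀, map_add, map_mul, Complex.conj_ofReal, Complex.conj_I]
    rw [div_mul_div_comm, h2]
    push_cast
    linear_combination (-(sgn z.im : ℂ) * sgn w.im / 2) * Complex.I_sq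
  simp_rw [hq]
  have hA : Integrable (fun ω => (sgn (X ω).re * sgn (Y ω).re + sgn (X ω).im * sgn (Y ω).im) / 2)
      μ := ((hint mXr mYr).add (hint mXi mYi)).div_const 2
  have hB : Integrable (fun ω => (sgn (X ω).im * sgn (Y ω).re - sgn (X ω).re * sgn (Y ω).im) / 2)
      μ := ((hint mXi mYr).sub (hint mXr mYi)).div_const 2
  rw [integral_add hA.ofReal (hB.ofReal.const_mul _), integral_const_mul, integral_complex_ofReal,
    integral_complex_ofReal, integral_div, integral_div,
    integral_add (hint mXr mYr) (hint mXi mYi), integral_sub (hint mXi mYr) (hint mXr mYi),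
    k1, k2, k3, k4, Real.arcsin_neg]
  -- The two summands in the real part agree, and so do those in the imaginary part, which absorbs
  -- the factor `1/2` from the quantizer. The factor `π/2` cancels `2/π`, and the arcsines of `Re c`
  -- and `Im c` remain.
  have hval : ((Real.pi / 2 : ℝ) : ℂ) *
      ((((2 / Real.pi * Real.arcsin c.re + 2 / Real.pi * Real.arcsin c.re) / 2 : ℝ) : ℂ) +
        Complex.I * (((2 / Real.pi * Real.arcsin c.im - 2 / Real.pi * -Real.arcsin c.im) / 2 : ℝ) :
          ℂ)) = (Real.arcsin c.re : ℂ) + (Real.arcsin c.im : ℂ) * Complex.I := by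
    have := Real.pi_ne_zero
    have h3 : (Real.pi : ℂ) ≠ 0 := by exact_mod_cast this
    push_cast
    field_simp
    ring
  rw [hval, csine, ← Complex.mk_eq_add_mul_I]
  dsimp only
  rw [Real.sin_arcsin (abs_le.1 b1).1 (abs_le.1 b1).2,
    Real.sin_arcsin (abs_le.1 b3).1 (abs_le.1 b3).2, mul_comm, Complex.re_add_im]

lemma norm_quantize (z : ℂ) : ‖quantize z‖ = 1 := by
  have h : ‖quantize z‖ ^ 2 = 1 := by
    have h1 := sq_abs (sgn z.re)
    have h2 := sq_abs (sgn z.im)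
    rw [abs_sgn] at h1 h2
    rw [quantize, norm_div, div_pow, Complex.norm_real, Real.norm_eq_abs, sq_abs,
      Real.sq_sqrt (by norm_num), mul_comm, Complex.sq_norm, Complex.normSq_add_mul_I, ← h1, ← h2]
    norm_num
  exact (pow_eq_one_iff_of_nonneg (norm_nonneg _) two_ne_zero).1 h

lemma measurable_quantize : Measurable quantize := by
  unfold quantize
  have h1 := measurable_sgn.comp Complex.measurable_re
  have h2 := measurable_sgn.comp Complex.measurable_im
  exact ((Complex.measurable_ofReal.comp h1).add
    ((Complex.measurable_ofReal.comp h2).const_mul _)).div_const _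

lemma continuous_csine : Continuous csine := by
  unfold csine
  fun_prop

/-! ### Weak law of large numbers for weakly correlated Gaussian vectors -/

section WeakLaw

open scoped RealInnerProductSpace

variable {Ω : Type*} [MeasurableSpace Ω] {μ : Measure Ω}
  {E : Type*} [NormedAddCommGroup E] [InnerProductSpace ℝ E] [FiniteDimensional ℝ E]
  [MeasurableSpace E] [BorelSpace E]

/-- The variance of `⟪a, Z⟫ + ⟪b, W⟫` is the sum of the variances plus twice the covariance. The
cross-covariance is therefore the only deviation of the joint characteristic function from a
product. -/
lemma charFun_toLp_prodMk {Z W : Ω → E} (hG : HasGaussianLaw (fun ω => (Z ω, W ω)) μ)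
    (hZ0 : ∀ t, ∫ ω, ⟪t, Z ω⟫ ∂μ = 0) (hW0 : ∀ t, ∫ ω, ⟪t, W ω⟫ ∂μ = 0)
    (t : WithLp 2 (E × E)) :
    charFun (μ.map fun ω => WithLp.toLp 2 (Z ω, W ω)) t =
      charFun (μ.map Z) (WithLp.ofLp t).1 * charFun (μ.map W) (WithLp.ofLp t).2 *
        Complex.exp (-((∫ ω, ⟪(WithLp.ofLp t).1, Z ω⟫ * ⟪(WithLp.ofLp t).2, W ω⟫ ∂μ : ℝ) : ℂ)) := by
  have hZ := hG.fst
  have hW := hG.snd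
  set a := (WithLp.ofLp t).1
  set b := (WithLp.ofLp t).2
  have hin : ∀ ω, ⟪t, WithLp.toLp 2 (Z ω, W ω)⟫ = ⟪a, Z ω⟫ + ⟪b, W ω⟫ := fun ω =>
    WithLp.prod_inner_apply _ _
  have ha : HasGaussianLaw (fun ω => ⟪a, Z ω⟫) μ := hZ.map_fun (innerSL ℝ a)
  have hb : HasGaussianLaw (fun ω => ⟪b, W ω⟫) μ := hW.map_fun (innerSL ℝ b)
  have hsum0 : ∫ ω, ⟪a, Z ω⟫ + ⟪b, W ω⟫ ∂μ = 0 := by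
    rw [integral_add ha.integrable hb.integrable, hZ0, hW0, add_zero]
  have hsumm : AEMeasurable (fun ω => ⟪a, Z ω⟫ + ⟪b, W ω⟫) μ := ha.aemeasurable.add hb.aemeasurable
  rw [(hG.toLp_prodMk 2).charFun_map_eq, hZ.charFun_map_eq, hW.charFun_map_eq]
  simp_rw [hin]
  rw [hsum0, hZ0, hW0, variance_of_integral_eq_zero ha.aemeasurable (hZ0 a),
    variance_of_integral_eq_zero hb.aemeasurable (hW0 b),
    variance_of_integral_eq_zero hsumm hsum0]
  have h2 := integral_sq_add ha.memLp_two hb.memLp_two 1 1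
  simp only [one_mul, one_pow, mul_one] at h2
  rw [h2, ← Complex.exp_add, ← Complex.exp_add]
  congr 1
  push_cast
  simp_rw [pow_two]
  ring

variable [IsProbabilityMeasure μ]

/-- The joint characteristic functions converge to that of `ν ⊗ ν`, so by Lévy's continuity theorem
the joint laws converge weakly; the test function is `g ⊗ g`. -/
lemma tendsto_integral_mul_of_covariance {Z W : ℕ → Ω → E} {ν : Measure E}
    [IsProbabilityMeasure ν] (hG : ∀ k, HasGaussianLaw (fun ω => (Z k ω, W k ω)) μ)
    (hZ0 : ∀ k t, ∫ ω, ⟪t, Z k ω⟫ ∂μ = 0) (hW0 : ∀ k t, ∫ ω, ⟪t, W k ω⟫ ∂μ = 0)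
    (hZν : ∀ k, μ.map (Z k) = ν) (hWν : ∀ k, μ.map (W k) = ν)
    (hcov : ∀ t u, Tendsto (fun k => ∫ ω, ⟪t, Z k ω⟫ * ⟪u, W k ω⟫ ∂μ) atTop (𝓝 0))
    (g : BoundedContinuousFunction E ℝ) :
    Tendsto (fun k => ∫ ω, g (Z k ω) * g (W k ω) ∂μ) atTop (𝓝 ((∫ x, g x ∂ν) ^ 2)) := by
  have hm (k : ℕ) : AEMeasurable (fun ω => WithLp.toLp 2 (Z k ω, W k ω)) μ :=
    ((hG k).toLp_prodMk 2).aemeasurable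
  have hm2 : Measurable (WithLp.toLp 2 : E × E → WithLp 2 (E × E)) := by fun_prop
  let π (k : ℕ) : ProbabilityMeasure (WithLp 2 (E × E)) :=
    ⟨μ.map fun ω => WithLp.toLp 2 (Z k ω, W k ω), Measure.isProbabilityMeasure_map (hm k)⟩
  let π₀ : ProbabilityMeasure (WithLp 2 (E × E)) :=
    ⟨(ν.prod ν).map (WithLp.toLp 2), Measure.isProbabilityMeasure_map hm2.aemeasurable⟩
  have hπ : Tendsto π atTop (𝓝 π₀) := by
    refine ProbabilityMeasure.tendsto_of_tendsto_charFun fun t => ?_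
    change Tendsto (fun k => charFun (μ.map fun ω => WithLp.toLp 2 (Z k ω, W k ω)) t) atTop
      (𝓝 (charFun ((ν.prod ν).map (WithLp.toLp 2)) t))
    rw [charFun_prod]
    simp_rw [fun k => charFun_toLp_prodMk (hG k) (hZ0 k) (hW0 k) t, hZν, hWν]
    have h1 := (Complex.continuous_exp.tendsto _).comp
      (((Complex.continuous_ofReal.tendsto _).comp
        (hcov (WithLp.ofLp t).1 (WithLp.ofLp t).2)).neg)
    simpa using h1.const_mul (charFun ν (WithLp.ofLp t).1 * charFun ν (WithLp.ofLp t).2)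
  let φ : BoundedContinuousFunction (WithLp 2 (E × E)) ℝ :=
    (g.compContinuous ⟨fun x => (WithLp.ofLp x).1, by fun_prop⟩) *
      (g.compContinuous ⟨fun x => (WithLp.ofLp x).2, by fun_prop⟩)
  have hφ (x : WithLp 2 (E × E)) : φ x = g (WithLp.ofLp x).1 * g (WithLp.ofLp x).2 := rfl
  have h := ProbabilityMeasure.tendsto_iff_forall_integral_tendsto.1 hπ φ
  have e1 (k : ℕ) : ∫ x, φ x ∂(π k : Measure (WithLp 2 (E × E))) =
      ∫ ω, g (Z k ω) * g (W k ω) ∂μ :=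
    integral_map (hm k) φ.continuous.aestronglyMeasurable
  have e2 : ∫ x, φ x ∂(π₀ : Measure (WithLp 2 (E × E))) = (∫ x, g x ∂ν) ^ 2 := by
    refine (integral_map hm2.aemeasurable φ.continuous.aestronglyMeasurable).trans ?_
    rw [pow_two, ← integral_prod_mul]
    rfl
  simpa only [e1, e2] using h

/-- Uniformity over index pairs comes from contradiction: violating pairs with `h < 1/(k+1)` for
every `k` would form a sequence excluded by the weak convergence above. -/
lemma exists_forall_abs_integral_mul_sub_le {Z : ℕ → Ω → E} {ν : Measure E}
    [IsProbabilityMeasure ν] (hG : ∀ n m, HasGaussianLaw (fun ω => (Z n ω, Z m ω)) μ)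
    (h0 : ∀ n t, ∫ ω, ⟪t, Z n ω⟫ ∂μ = 0) (hν : ∀ n, μ.map (Z n) = ν) {h : ℕ → ℕ → ℝ}
    (hcov : ∀ n m t u, |∫ ω, ⟪t, Z n ω⟫ * ⟪u, Z m ω⟫ ∂μ| ≤ ‖t‖ * ‖u‖ * h n m)
    (hpos : ∀ n m, 0 ≤ h n m) (g : BoundedContinuousFunction E ℝ) {ε : ℝ} (hε : 0 < ε) :
    ∃ δ > 0, ∀ n m, h n m < δ → |∫ ω, g (Z n ω) * g (Z m ω) ∂μ - (∫ x, g x ∂ν) ^ 2| ≤ ε := by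
  by_contra! hcon
  choose n m hh hgt using fun k : ℕ => hcon (1 / ((k : ℝ) + 1)) (by positivity)
  have hhl : Tendsto (fun k => h (n k) (m k)) atTop (𝓝 0) :=
    squeeze_zero (fun _ => hpos _ _) (fun k => (hh k).le) tendsto_one_div_add_atTop_nhds_zero_nat
  have key := tendsto_integral_mul_of_covariance (fun k => hG (n k) (m k)) (fun k => h0 (n k))
    (fun k => h0 (m k)) (fun k => hν (n k)) (fun k => hν (m k)) (fun t u => by
      rw [tendsto_zero_iff_abs_tendsto_zero]
      refine squeeze_zero (fun _ => abs_nonneg _) (fun k => hcov _ _ t u) ?_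
      simpa using hhl.const_mul (‖t‖ * ‖u‖)) g
  rw [Metric.tendsto_atTop] at key
  obtain ⟨k, hk⟩ := key ε hε
  exact absurd (hk k le_rfl) (not_lt.2 (hgt k).le)

/-- The mean square error is the average of the covariances `γ n m` of `g(Z n)` and `g(Z m)`. Weakly
correlated pairs have small `γ`, and the other pairs are rare because `h²` vanishes on average. -/
lemma eventually_integral_sq_average_le {Z : ℕ → Ω → E} {ν : Measure E}
    [IsProbabilityMeasure ν] (hG : ∀ n m, HasGaussianLaw (fun ω => (Z n ω, Z m ω)) μ)
    (h0 : ∀ n t, ∫ ω, ⟪t, Z n ω⟫ ∂μ = 0) (hν : ∀ n, μ.map (Z n) = ν) {h : ℕ → ℕ → ℝ}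
    (hcov : ∀ n m t u, |∫ ω, ⟪t, Z n ω⟫ * ⟪u, Z m ω⟫ ∂μ| ≤ ‖t‖ * ‖u‖ * h n m)
    (hpos : ∀ n m, 0 ≤ h n m)
    (hces : Tendsto (fun N : ℕ => (∑ n ∈ Finset.range N, ∑ m ∈ Finset.range N, h n m ^ 2) /
      (N : ℝ) ^ 2) atTop (𝓝 0))
    (g : BoundedContinuousFunction E ℝ) {ε : ℝ} (hε : 0 < ε) :
    ∀ᶠ N : ℕ in atTop,
      ∫ ω, ((∑ n ∈ Finset.range N, g (Z n ω)) / N - ∫ x, g x ∂ν) ^ 2 ∂μ ≤ ε := by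
  obtain ⟨δ, hδ, hδε⟩ := exists_forall_abs_integral_mul_sub_le hG h0 hν hcov hpos g (half_pos hε)
  set c := ∫ x, g x ∂ν with hc
  have hZm (n : ℕ) : AEMeasurable (Z n) μ := (hG n n).fst.aemeasurable
  have hgm (n : ℕ) : AEStronglyMeasurable (fun ω => g (Z n ω)) μ :=
    (g.continuous.measurable.comp_aemeasurable (hZm n)).aestronglyMeasurable
  have hgi (n : ℕ) : Integrable (fun ω => g (Z n ω)) μ :=
    Integrable.of_bound (hgm n) ‖g‖ (ae_of_all _ fun ω => g.norm_coe_le_norm _)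
  have hggi (n m : ℕ) : Integrable (fun ω => g (Z n ω) * g (Z m ω)) μ := by
    refine Integrable.of_bound ((hgm n).mul (hgm m)) (‖g‖ * ‖g‖) (ae_of_all _ fun ω => ?_)
    rw [norm_mul]
    exact mul_le_mul (g.norm_coe_le_norm _) (g.norm_coe_le_norm _) (norm_nonneg _) (norm_nonneg _)
  have hgc (n : ℕ) : ∫ ω, g (Z n ω) ∂μ = c := by
    rw [hc, ← hν n, integral_map (hZm n) g.continuous.aestronglyMeasurable]
  set γ : ℕ → ℕ → ℝ := fun n m => ∫ ω, g (Z n ω) * g (Z m ω) ∂μ - c ^ 2 with hγ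
  have hcent (n m : ℕ) : Integrable (fun ω => (g (Z n ω) - c) * (g (Z m ω) - c)) μ ∧
      ∫ ω, (g (Z n ω) - c) * (g (Z m ω) - c) ∂μ = γ n m := by
    have e : (fun ω => (g (Z n ω) - c) * (g (Z m ω) - c)) = fun ω =>
        (g (Z n ω) * g (Z m ω) - c * g (Z m ω)) - (c * g (Z n ω) - c ^ 2) := by
      ext ω; ring
    have i1 : Integrable (fun ω => g (Z n ω) * g (Z m ω) - c * g (Z m ω)) μ :=
      (hggi n m).sub ((hgi m).const_mul c)
    have i2 : Integrable (fun ω => c * g (Z n ω) - c ^ 2) μ :=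
      ((hgi n).const_mul c).sub (integrable_const _)
    rw [e]
    refine ⟨i1.sub i2, ?_⟩
    rw [integral_sub i1 i2, integral_sub (hggi n m) ((hgi m).const_mul c),
      integral_sub ((hgi n).const_mul c) (integrable_const _), integral_const_mul,
      integral_const_mul, hgc, hgc, integral_const, probReal_univ]
    simp only [hγ, smul_eq_mul]
    ring
  have hγC (n m : ℕ) : |γ n m| ≤ 2 * ‖g‖ ^ 2 := by
    have hcn : |c| ≤ ‖g‖ := by
      have := norm_integral_le_of_norm_le_const (μ := ν)
        (ae_of_all _ fun x => g.norm_coe_le_norm x)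
      simpa using this
    have h1 : |∫ ω, g (Z n ω) * g (Z m ω) ∂μ| ≤ ‖g‖ * ‖g‖ := by
      have := norm_integral_le_of_norm_le_const (μ := μ) (C := ‖g‖ * ‖g‖)
        (f := fun ω => g (Z n ω) * g (Z m ω)) (ae_of_all _ fun ω => by
          rw [norm_mul]
          exact mul_le_mul (g.norm_coe_le_norm _) (g.norm_coe_le_norm _) (norm_nonneg _)
            (norm_nonneg _))
      simpa using this
    have h2 : c ^ 2 ≤ ‖g‖ ^ 2 := sq_le_sq' (abs_le.1 hcn).1 (abs_le.1 hcn).2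
    calc |γ n m| ≤ |∫ ω, g (Z n ω) * g (Z m ω) ∂μ| + |c ^ 2| := abs_sub _ _
      _ ≤ ‖g‖ * ‖g‖ + ‖g‖ ^ 2 := by
        rw [abs_of_nonneg (sq_nonneg c)]
        gcongr
      _ = 2 * ‖g‖ ^ 2 := by ring
  -- Chebyshev splitting at the threshold `δ`: if `h < δ` the first term suffices, and otherwise
  -- `h²/δ² ≥ 1` lets the crude bound `2‖g‖²` be absorbed in the second.
  have hγle (n m : ℕ) : γ n m ≤ ε / 2 + 2 * ‖g‖ ^ 2 / δ ^ 2 * h n m ^ 2 := by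
    rcases lt_or_ge (h n m) δ with hlt | hge
    · have := (le_abs_self _).trans (hδε n m hlt)
      have h2 : 0 ≤ 2 * ‖g‖ ^ 2 / δ ^ 2 * h n m ^ 2 := by positivity
      exact this.trans (by linarith)
    · have h1 := (le_abs_self _).trans (hγC n m)
      have h2 : 2 * ‖g‖ ^ 2 ≤ 2 * ‖g‖ ^ 2 / δ ^ 2 * h n m ^ 2 := by
        rw [div_mul_eq_mul_div, le_div_iff₀ (by positivity)]
        gcongr
      linarith
  have hev : ∀ᶠ N : ℕ in atTop, 2 * ‖g‖ ^ 2 / δ ^ 2 *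
      ((∑ n ∈ Finset.range N, ∑ m ∈ Finset.range N, h n m ^ 2) / (N : ℝ) ^ 2) < ε / 2 := by
    have := hces.const_mul (2 * ‖g‖ ^ 2 / δ ^ 2)
    rw [mul_zero] at this
    exact this.eventually_lt_const (half_pos hε)
  filter_upwards [hev, eventually_gt_atTop 0] with N hN hN0
  have hN' : (0 : ℝ) < N := by exact_mod_cast hN0
  have hexp : ∀ ω, ((∑ n ∈ Finset.range N, g (Z n ω)) / N - c) ^ 2 =
      (∑ n ∈ Finset.range N, ∑ m ∈ Finset.range N, (g (Z n ω) - c) * (g (Z m ω) - c)) /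
        (N : ℝ) ^ 2 := fun ω => by
    rw [← Finset.sum_mul_sum, Finset.sum_sub_distrib, Finset.sum_const, Finset.card_range,
      nsmul_eq_mul]
    field_simp
  simp_rw [hexp]
  rw [integral_div, integral_finsetSum _ fun n _ => integrable_finsetSum _ fun m _ => (hcent n m).1]
  simp_rw [fun n => integral_finsetSum (μ := μ) (Finset.range N) fun m _ => (hcent n m).1,
    fun n m => (hcent n m).2]
  calc (∑ n ∈ Finset.range N, ∑ m ∈ Finset.range N, γ n m) / (N : ℝ) ^ 2
      ≤ (∑ n ∈ Finset.range N, ∑ m ∈ Finset.range N,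
          (ε / 2 + 2 * ‖g‖ ^ 2 / δ ^ 2 * h n m ^ 2)) / (N : ℝ) ^ 2 := by
        gcongr with n _ m _
        exact hγle n m
    _ = ε / 2 + 2 * ‖g‖ ^ 2 / δ ^ 2 *
        ((∑ n ∈ Finset.range N, ∑ m ∈ Finset.range N, h n m ^ 2) / (N : ℝ) ^ 2) := by
        simp_rw [Finset.sum_add_distrib, ← Finset.mul_sum, Finset.sum_const, Finset.card_range,
          nsmul_eq_mul]
        field_simp
    _ ≤ ε := by linarith

/-- A bounded continuous `g` close to `f` in `L¹(ν)` is equally close along every `Z n`, since all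
of them have the law `ν`. Thus `f` needs no continuity. -/
lemma tendsto_integral_abs_average {Z : ℕ → Ω → E} {ν : Measure E}
    [IsProbabilityMeasure ν] (hG : ∀ n m, HasGaussianLaw (fun ω => (Z n ω, Z m ω)) μ)
    (h0 : ∀ n t, ∫ ω, ⟪t, Z n ω⟫ ∂μ = 0) (hν : ∀ n, μ.map (Z n) = ν) {h : ℕ → ℕ → ℝ}
    (hcov : ∀ n m t u, |∫ ω, ⟪t, Z n ω⟫ * ⟪u, Z m ω⟫ ∂μ| ≤ ‖t‖ * ‖u‖ * h n m)
    (hpos : ∀ n m, 0 ≤ h n m)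
    (hces : Tendsto (fun N : ℕ => (∑ n ∈ Finset.range N, ∑ m ∈ Finset.range N, h n m ^ 2) /
      (N : ℝ) ^ 2) atTop (𝓝 0))
    {f : E → ℝ} (hf : Integrable f ν) :
    Tendsto (fun N : ℕ => ∫ ω, |(∑ n ∈ Finset.range N, f (Z n ω)) / N - ∫ x, f x ∂ν| ∂μ)
      atTop (𝓝 0) := by
  rw [Metric.tendsto_nhds]
  intro ε hε
  -- The final bound is `ε/2`, made of four contributions of `ε/8`: the approximation along the
  -- sequence, the approximation of the mean, and two from `|A| ≤ ε/8 + (8/ε)A²`.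
  obtain ⟨g, hfg, hgi⟩ := hf.exists_boundedContinuous_integral_sub_le (ε := ε / 8) (by positivity)
  have hev := eventually_integral_sq_average_le hG h0 hν hcov hpos hces g
    (ε := (ε / 8) ^ 2) (by positivity)
  filter_upwards [hev, eventually_gt_atTop 0] with N hN hN0
  have hN' : (0 : ℝ) < N := by exact_mod_cast hN0
  rw [Real.dist_0_eq_abs, abs_of_nonneg (integral_nonneg fun _ => abs_nonneg _)]
  have hZm (n : ℕ) : AEMeasurable (Z n) μ := (hG n n).fst.aemeasurable
  have hfgi : Integrable (fun x => f x - g x) ν := hf.sub hgi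
  have hdi (n : ℕ) : Integrable (fun ω => |f (Z n ω) - g (Z n ω)|) μ := by
    have : Integrable (fun x => |f x - g x|) (μ.map (Z n)) := by rw [hν]; exact hfgi.abs
    exact this.comp_aemeasurable (hZm n)
  have hd (n : ℕ) : ∫ ω, |f (Z n ω) - g (Z n ω)| ∂μ ≤ ε / 8 := by
    rw [← integral_map (f := fun x => |f x - g x|) (hZm n)
      (by rw [hν]; exact hfgi.abs.aestronglyMeasurable), hν]
    exact hfg
  have hgm (n : ℕ) : AEStronglyMeasurable (fun ω => g (Z n ω)) μ :=
    (g.continuous.measurable.comp_aemeasurable (hZm n)).aestronglyMeasurable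
  have hAm : MemLp (fun ω => (∑ n ∈ Finset.range N, g (Z n ω)) / N - ∫ x, g x ∂ν) 2 μ := by
    have h1 : ∀ n ∈ Finset.range N, MemLp (fun ω => g (Z n ω)) 2 μ := fun n _ =>
      MemLp.of_bound (hgm n) ‖g‖ (ae_of_all _ fun ω => g.norm_coe_le_norm _)
    have h2 := ((memLp_finsetSum _ h1).const_mul ((N : ℝ)⁻¹)).sub
      (memLp_const (∫ x, g x ∂ν))
    refine h2.ae_eq (ae_of_all _ fun ω => ?_)
    simp [div_eq_inv_mul]
  have hmeans : |∫ x, g x ∂ν - ∫ x, f x ∂ν| ≤ ε / 8 := by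
    rw [abs_sub_comm, ← integral_sub hf hgi]
    exact (abs_integral_le_integral_abs).trans hfg
  have hpt (ω : Ω) : |(∑ n ∈ Finset.range N, f (Z n ω)) / N - ∫ x, f x ∂ν| ≤
      (∑ n ∈ Finset.range N, |f (Z n ω) - g (Z n ω)|) / N + (ε / 8 +
        (8 / ε) * ((∑ n ∈ Finset.range N, g (Z n ω)) / N - ∫ x, g x ∂ν) ^ 2) + ε / 8 := by
    set A := (∑ n ∈ Finset.range N, g (Z n ω)) / N - ∫ x, g x ∂ν with hA
    have e : (∑ n ∈ Finset.range N, f (Z n ω)) / N - ∫ x, f x ∂ν =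
        (∑ n ∈ Finset.range N, (f (Z n ω) - g (Z n ω))) / N + A +
          (∫ x, g x ∂ν - ∫ x, f x ∂ν) := by
      rw [hA, Finset.sum_sub_distrib]
      ring
    -- A pointwise arithmetic-geometric inequality that turns the `L²` bound for bounded continuous
    -- functions into an `L¹` bound.
    have hA' : |A| ≤ ε / 8 + 8 / ε * A ^ 2 := by
      have : |A| * ε ≤ (ε / 8 + 8 / ε * A ^ 2) * ε := by
        have h3 : (ε / 8 + 8 / ε * A ^ 2) * ε = ε ^ 2 / 8 + 8 * A ^ 2 := by field_simp
        rw [h3, ← sq_abs A]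
        nlinarith [sq_nonneg (ε - 8 * |A|), sq_nonneg ε, sq_nonneg (|A|),
          sq_nonneg (ε - 4 * |A|)]
      exact le_of_mul_le_mul_right this hε
    rw [e]
    refine (abs_add_le _ _).trans (add_le_add ((abs_add_le _ _).trans (add_le_add ?_ hA')) hmeans)
    rw [abs_div, abs_of_pos hN']
    gcongr
    exact Finset.abs_sum_le_sum_abs _ _
  have i1 : Integrable (fun ω => (∑ n ∈ Finset.range N, |f (Z n ω) - g (Z n ω)|) / N) μ :=
    (integrable_finsetSum _ fun n _ => hdi n).div_const _
  have i2 : Integrable (fun ω => ε / 8 +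
      (8 / ε) * ((∑ n ∈ Finset.range N, g (Z n ω)) / N - ∫ x, g x ∂ν) ^ 2) μ :=
    (integrable_const _).add (hAm.integrable_sq.const_mul _)
  have i12 : Integrable (fun ω => (∑ n ∈ Finset.range N, |f (Z n ω) - g (Z n ω)|) / N + (ε / 8 +
        (8 / ε) * ((∑ n ∈ Finset.range N, g (Z n ω)) / N - ∫ x, g x ∂ν) ^ 2)) μ := i1.add i2
  calc _ ≤ ∫ ω, ((∑ n ∈ Finset.range N, |f (Z n ω) - g (Z n ω)|) / N + (ε / 8 +
        (8 / ε) * ((∑ n ∈ Finset.range N, g (Z n ω)) / N - ∫ x, g x ∂ν) ^ 2) + ε / 8) ∂μ :=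
        integral_mono_of_nonneg (ae_of_all _ fun _ => abs_nonneg _)
          (i12.add (integrable_const _)) (ae_of_all _ hpt)
    _ = (∑ n ∈ Finset.range N, ∫ ω, |f (Z n ω) - g (Z n ω)| ∂μ) / N + (ε / 8 +
        (8 / ε) * ∫ ω, ((∑ n ∈ Finset.range N, g (Z n ω)) / N - ∫ x, g x ∂ν) ^ 2 ∂μ) + ε / 8 := by
        rw [integral_add i12 (integrable_const _), integral_add i1 i2,
          integral_add (integrable_const _) (hAm.integrable_sq.const_mul _), integral_div,
          integral_finsetSum _ (fun n _ => hdi n), integral_const_mul, integral_const,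
          probReal_univ, one_smul]
    _ ≤ (∑ n ∈ Finset.range N, ε / 8) / N + (ε / 8 + (8 / ε) * (ε / 8) ^ 2) + ε / 8 := by
        gcongr with n _
        exact hd n
    _ = ε / 2 := by
        rw [Finset.sum_const, Finset.card_range, nsmul_eq_mul]
        field_simp
        norm_num
    _ < ε := half_lt_self hε

/-- Averages of an integrable function along a stationary sequence of Gaussian vectors whose
squared covariances vanish on average converge in mean to the expectation. -/
theorem tendsto_integral_norm_average {Z : ℕ → Ω → E}
    (hG : ∀ n m, HasGaussianLaw (fun ω => (Z n ω, Z m ω)) μ)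
    (h0 : ∀ n t, ∫ ω, ⟪t, Z n ω⟫ ∂μ = 0)
    (hvar : ∀ n t, ∫ ω, ⟪t, Z n ω⟫ ^ 2 ∂μ = ∫ ω, ⟪t, Z 0 ω⟫ ^ 2 ∂μ) {h : ℕ → ℕ → ℝ}
    (hcov : ∀ n m t u, |∫ ω, ⟪t, Z n ω⟫ * ⟪u, Z m ω⟫ ∂μ| ≤ ‖t‖ * ‖u‖ * h n m)
    (hpos : ∀ n m, 0 ≤ h n m)
    (hces : Tendsto (fun N : ℕ => (∑ n ∈ Finset.range N, ∑ m ∈ Finset.range N, h n m ^ 2) /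
      (N : ℝ) ^ 2) atTop (𝓝 0))
    {f : E → ℂ} (hfm : Measurable f) (hf : Integrable (fun ω => f (Z 0 ω)) μ) :
    (∀ n, Integrable (fun ω => f (Z n ω)) μ) ∧
    Tendsto (fun N : ℕ => ∫ ω, ‖(1 / (N : ℂ)) * ∑ n ∈ Finset.range N, f (Z n ω) -
      ∫ ω, f (Z 0 ω) ∂μ‖ ∂μ) atTop (𝓝 0) := by
  have hZm (n : ℕ) : AEMeasurable (Z n) μ := (hG n n).fst.aemeasurable
  set ν := μ.map (Z 0) with hνdef
  have : IsProbabilityMeasure ν := Measure.isProbabilityMeasure_map (hZm 0)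
  have hdual (l : StrongDual ℝ E) (x : E) : l x = ⟪(InnerProductSpace.toDual ℝ E).symm l, x⟫ :=
    (InnerProductSpace.toDual_symm_apply).symm
  -- Constancy in `n` of the variances of all linear functionals already forces the centered
  -- Gaussian vectors to be identically distributed.
  have hν (n : ℕ) : μ.map (Z n) = ν := by
    refine map_eq_of_dual_moments (hG n n).fst (hG 0 0).fst (fun l => ?_) (fun l => ?_)
      fun l => ?_
    · simp_rw [hdual]; exact h0 _ _
    · simp_rw [hdual]; exact h0 _ _
    · simp_rw [hdual]; exact hvar _ _
  have hfν : Integrable f ν :=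
    (integrable_map_measure hfm.aestronglyMeasurable (hZm 0)).2 hf
  have hfn (n : ℕ) : Integrable (fun ω => f (Z n ω)) μ :=
    (integrable_map_measure hfm.aestronglyMeasurable (hZm n)).1 (hν n ▸ hfν)
  refine ⟨hfn, ?_⟩
  have hre := tendsto_integral_abs_average hG h0 hν hcov hpos hces hfν.re
  have him := tendsto_integral_abs_average hG h0 hν hcov hpos hces hfν.im
  have hsum := hre.add him
  rw [add_zero] at hsum
  have e0 : ∫ ω, f (Z 0 ω) ∂μ = ∫ x, f x ∂ν := (integral_map (hZm 0) hfm.aestronglyMeasurable).symm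
  refine squeeze_zero (fun _ => integral_nonneg fun _ => norm_nonneg _) (fun N => ?_) hsum
  have iR : Integrable (fun ω => (∑ n ∈ Finset.range N, RCLike.re (f (Z n ω))) / (N : ℝ) -
      ∫ x, RCLike.re (f x) ∂ν) μ :=
    ((integrable_finsetSum _ fun n _ => (hfn n).re).div_const _).sub (integrable_const _)
  have iI : Integrable (fun ω => (∑ n ∈ Finset.range N, RCLike.im (f (Z n ω))) / (N : ℝ) -
      ∫ x, RCLike.im (f x) ∂ν) μ :=
    ((integrable_finsetSum _ fun n _ => (hfn n).im).div_const _).sub (integrable_const _)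
  rw [← integral_add iR.abs iI.abs]
  refine integral_mono_of_nonneg (ae_of_all _ fun _ => norm_nonneg _) (iR.abs.add iI.abs)
    (ae_of_all _ fun ω => ?_)
  refine (Complex.norm_le_abs_re_add_abs_im _).trans (le_of_eq ?_)
  have hN : (1 / (N : ℂ)) = ((1 / N : ℝ) : ℂ) := by push_cast; rfl
  rw [e0, integral_re hfν, integral_im hfν, hN]
  simp only [Complex.sub_re, Complex.sub_im, Complex.re_ofReal_mul, Complex.im_ofReal_mul,
    Complex.re_sum, Complex.im_sum, RCLike.re_to_complex, RCLike.im_to_complex, mul_one,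
    div_eq_inv_mul]

end WeakLaw

/-! ### Sequences that vanish on average -/

/-- The averages of `G` over `[-N, N]` tend to zero. -/
def CesaroNull (G : ℤ → ℝ) : Prop :=
  Tendsto (fun N : ℕ => (∑ k ∈ Finset.Icc (-(N : ℤ)) N, G k) / N) atTop (𝓝 0)

lemma CesaroNull.add {F G : ℤ → ℝ} (hF : CesaroNull F) (hG : CesaroNull G) :
    CesaroNull (fun k => F k + G k) := by
  simpa [CesaroNull, Finset.sum_add_distrib, add_div] using Filter.Tendsto.add hF hG

lemma CesaroNull.const_mul {G : ℤ → ℝ} (hG : CesaroNull G) (c : ℝ) :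
    CesaroNull (fun k => c * G k) := by
  simpa [CesaroNull, ← Finset.mul_sum, mul_div_assoc] using Filter.Tendsto.const_mul c hG

lemma CesaroNull.mono {F G : ℤ → ℝ} (hG : CesaroNull G) (h0 : ∀ k, 0 ≤ F k)
    (h : ∀ k, F k ≤ G k) : CesaroNull F := by
  refine squeeze_zero (fun N => ?_) (fun N => ?_) hG
  · exact div_nonneg (Finset.sum_nonneg fun k _ => h0 k) (Nat.cast_nonneg N)
  · gcongr with k _
    exact h k

lemma cesaroNull_ite_eq_zero (c : ℝ) : CesaroNull (fun k => if k = 0 then c else 0) := by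
  have (N : ℕ) : (∑ k ∈ Finset.Icc (-(N : ℤ)) N, if k = 0 then c else 0) = c := by
    rw [Finset.sum_ite_eq', if_pos]
    simp
  simp only [CesaroNull, this]
  exact tendsto_const_div_atTop_nhds_zero_nat c

/-- A window shifted by `a` lies in the window enlarged by `|a|`, and `(N + |a|)/N` tends to one. -/
lemma CesaroNull.comp_add {G : ℤ → ℝ} (hG : CesaroNull G) (h0 : ∀ k, 0 ≤ G k) (a : ℤ) :
    CesaroNull (fun k => G (k + a)) := by
  have h1 : Tendsto (fun N : ℕ => (∑ k ∈ Finset.Icc (-((N + a.natAbs : ℕ) : ℤ))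
      ((N + a.natAbs : ℕ) : ℤ), G k) / ((N + a.natAbs : ℕ) : ℝ)) atTop (𝓝 0) :=
    hG.comp (tendsto_add_atTop_nat a.natAbs)
  have h2 : Tendsto (fun N : ℕ => ((N + a.natAbs : ℕ) : ℝ) / N) atTop (𝓝 1) := by
    have h3 : Tendsto (fun N : ℕ => 1 + (a.natAbs : ℝ) / N) atTop (𝓝 (1 + 0)) :=
      tendsto_const_nhds.add (tendsto_const_div_atTop_nhds_zero_nat _)
    rw [add_zero] at h3
    refine h3.congr' ?_
    filter_upwards [eventually_gt_atTop 0] with N hN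
    have : (N : ℝ) ≠ 0 := by positivity
    push_cast
    field_simp
  have h3 := h1.mul h2
  rw [zero_mul] at h3
  refine squeeze_zero' (Eventually.of_forall fun N => div_nonneg
    (Finset.sum_nonneg fun k _ => h0 _) (Nat.cast_nonneg N)) ?_ h3
  filter_upwards [eventually_gt_atTop 0] with N hN
  have hN' : (0 : ℝ) < N := by exact_mod_cast hN
  have hN'' : (0 : ℝ) < ((N + a.natAbs : ℕ) : ℝ) := by positivity
  rw [div_mul_div_cancel₀ hN''.ne']
  gcongr
  rw [← Finset.sum_image (f := G) (g := fun k => k + a) (fun x _ y _ hxy => by simpa using hxy)]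
  refine Finset.sum_le_sum_of_subset_of_nonneg (fun k hk => ?_) fun k _ _ => h0 k
  simp only [Finset.mem_image, Finset.mem_Icc] at hk ⊢
  omega

lemma cesaroNull_of_even {G : ℤ → ℝ} (heven : ∀ k, G (-k) = G k) (h0 : ∀ k, 0 ≤ G k)
    (h : Tendsto (fun N : ℕ => (1 / (N : ℝ)) * ∑ m ∈ Finset.range N, G m) atTop (𝓝 0)) :
    CesaroNull G := by
  have h1 := h.comp (tendsto_add_atTop_nat 1)
  -- One factor `2` accounts for the two halves of the symmetric window, the other for `N + 1 ≤ 2N`.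
  have h2 := h1.const_mul 4
  rw [mul_zero] at h2
  refine squeeze_zero' (Eventually.of_forall fun N => div_nonneg
    (Finset.sum_nonneg fun k _ => h0 _) (Nat.cast_nonneg N)) ?_ h2
  filter_upwards [eventually_gt_atTop 0] with N hN
  have hN' : (1 : ℝ) ≤ N := by exact_mod_cast hN
  have hle : ∑ k ∈ Finset.Icc (-(N : ℤ)) N, G k ≤ 2 * ∑ m ∈ Finset.range (N + 1), G m := by
    calc ∑ k ∈ Finset.Icc (-(N : ℤ)) N, G k
        ≤ ∑ k ∈ (Finset.range (N + 1)).image (fun m : ℕ => (m : ℤ)) ∪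
            (Finset.range (N + 1)).image (fun m : ℕ => -(m : ℤ)), G k := by
          refine Finset.sum_le_sum_of_subset_of_nonneg (fun k hk => ?_) fun k _ _ => h0 k
          simp only [Finset.mem_union, Finset.mem_image, Finset.mem_range, Finset.mem_Icc] at hk ⊢
          rcases le_total 0 k with hk0 | hk0
          · exact Or.inl ⟨k.natAbs, by omega, by omega⟩
          · exact Or.inr ⟨k.natAbs, by omega, by omega⟩
      _ ≤ ∑ k ∈ (Finset.range (N + 1)).image (fun m : ℕ => (m : ℤ)), G k +
            ∑ k ∈ (Finset.range (N + 1)).image (fun m : ℕ => -(m : ℤ)), G k := by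
          rw [← Finset.sum_union_inter]
          exact le_add_of_nonneg_right (Finset.sum_nonneg fun k _ => h0 k)
      _ = 2 * ∑ m ∈ Finset.range (N + 1), G m := by
          rw [Finset.sum_image (fun x _ y _ hxy => by simpa using hxy),
            Finset.sum_image (fun x _ y _ hxy => by simpa using hxy)]
          simp_rw [heven]
          ring
  simp only [Function.comp_apply]
  have hS : 0 ≤ ∑ m ∈ Finset.range (N + 1), G m := Finset.sum_nonneg fun k _ => h0 _
  rw [div_le_iff₀ (by linarith)]
  refine hle.trans ?_
  have : (1 : ℝ) / 2 ≤ 1 / ((N + 1 : ℕ) : ℝ) * N := by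
    push_cast
    rw [div_mul_eq_mul_div, one_mul, div_le_div_iff₀ (by norm_num) (by linarith)]
    linarith
  nlinarith

/-- For fixed `n` the differences `n - m` are distinct and lie in `[-N, N]`. Each of the `N` rows is
thus bounded by the full window sum, which is `o(N)`. -/
lemma CesaroNull.tendsto_sum_sum {G : ℤ → ℝ} (hG : CesaroNull G) (h0 : ∀ k, 0 ≤ G k) :
    Tendsto (fun N : ℕ => (∑ n ∈ Finset.range N, ∑ m ∈ Finset.range N, G ((n : ℤ) - m)) /
      (N : ℝ) ^ 2) atTop (𝓝 0) := by
  refine squeeze_zero (fun N => div_nonneg (Finset.sum_nonneg fun n _ =>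
    Finset.sum_nonneg fun m _ => h0 _) (by positivity)) (fun N => ?_) hG
  have hle : ∑ n ∈ Finset.range N, ∑ m ∈ Finset.range N, G ((n : ℤ) - m) ≤
      ∑ n ∈ Finset.range N, ∑ k ∈ Finset.Icc (-(N : ℤ)) N, G k := by
    refine Finset.sum_le_sum fun n hn => ?_
    rw [← Finset.sum_image (f := G) (g := fun m : ℕ => (n : ℤ) - m)
      (fun x _ y _ hxy => by simpa using hxy)]
    refine Finset.sum_le_sum_of_subset_of_nonneg (fun k hk => ?_) fun k _ _ => h0 k
    simp only [Finset.mem_image, Finset.mem_Icc, Finset.mem_range] at hk hn ⊢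
    omega
  rw [Finset.sum_const, Finset.card_range, nsmul_eq_mul] at hle
  rcases Nat.eq_zero_or_pos N with rfl | hN
  · simp
  · have hN' : (0 : ℝ) < N := by exact_mod_cast hN
    rw [div_le_div_iff₀ (by positivity) hN']
    nlinarith

/-! ### Circular Gaussian processes -/

section Circular

open scoped RealInnerProductSpace

variable {Ω T : Type*} [MeasurableSpace Ω] {μ : Measure Ω} {R : T → Ω → ℂ}

lemma hasGaussianLaw_toLp_pairs (hR : IsGaussianProcess R μ) (a b c d : T) :
    HasGaussianLaw (fun ω => (WithLp.toLp 2 (R a ω, R b ω), WithLp.toLp 2 (R c ω, R d ω))) μ := by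
  -- Reindexing by `Fin 4` allows the four indices to coincide.
  have h := (hR.comp_right ![a, b, c, d]).hasGaussianLaw Finset.univ
  let pr (i : Fin 4) : (↥(Finset.univ : Finset (Fin 4)) → ℂ) →L[ℝ] ℂ :=
    ContinuousLinearMap.proj ⟨i, Finset.mem_univ i⟩
  exact h.map_fun
    (((WithLp.prodContinuousLinearEquiv 2 ℝ ℂ ℂ).symm.toContinuousLinearMap ∘L
      ((pr 0).prod (pr 1))).prod
    ((WithLp.prodContinuousLinearEquiv 2 ℝ ℂ ℂ).symm.toContinuousLinearMap ∘L
      ((pr 2).prod (pr 3))))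

lemma inner_toLp_prodMk (w : WithLp 2 (ℂ × ℂ)) (x y : ℂ) : ⟪w, WithLp.toLp 2 (x, y)⟫ =
    (conj (WithLp.ofLp w).1 * x).re + (conj (WithLp.ofLp w).2 * y).re := by
  rw [WithLp.prod_inner_apply, Complex.inner, Complex.inner, mul_comm (conj _) x,
    mul_comm (conj _) y]

lemma integral_inner_mul_inner (hR : IsGaussianProcess R μ)
    (hcirc : ∀ a b, ∫ ω, R a ω * R b ω ∂μ = 0) (a b c d : T) (t u : WithLp 2 (ℂ × ℂ)) :
    ∫ ω, ⟪t, WithLp.toLp 2 (R a ω, R b ω)⟫ * ⟪u, WithLp.toLp 2 (R c ω, R d ω)⟫ ∂μ =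
      (conj (WithLp.ofLp t).1 * (WithLp.ofLp u).1 * ∫ ω, R a ω * conj (R c ω) ∂μ).re / 2 +
      (conj (WithLp.ofLp t).1 * (WithLp.ofLp u).2 * ∫ ω, R a ω * conj (R d ω) ∂μ).re / 2 +
      ((conj (WithLp.ofLp t).2 * (WithLp.ofLp u).1 * ∫ ω, R b ω * conj (R c ω) ∂μ).re / 2 +
      (conj (WithLp.ofLp t).2 * (WithLp.ofLp u).2 * ∫ ω, R b ω * conj (R d ω) ∂μ).re / 2) := by
  have hm (q : T) : MemLp (R q) 2 μ := (hR.hasGaussianLaw_eval q).memLp_two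
  have hi (w z : ℂ) (q q' : T) :
      Integrable (fun ω => (conj w * R q ω).re * (conj z * R q' ω).re) μ :=
    ((hm q).const_mul (conj w)).re.integrable_mul ((hm q').const_mul (conj z)).re
  have hi2 (w z z' : ℂ) (q q' q'' : T) : Integrable (fun ω =>
      (conj w * R q ω).re * (conj z * R q' ω).re + (conj w * R q ω).re * (conj z' * R q'' ω).re) μ :=
    (hi _ _ _ _).add (hi _ _ _ _)
  simp_rw [inner_toLp_prodMk, add_mul, mul_add]
  rw [integral_add (hi2 _ _ _ _ _ _) (hi2 _ _ _ _ _ _),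
    integral_add (hi _ _ _ _) (hi _ _ _ _), integral_add (hi _ _ _ _) (hi _ _ _ _)]
  simp_rw [integral_re_mul_re (hm _) (hm _) (hcirc _ _)]

lemma abs_integral_inner_mul_inner_le (hR : IsGaussianProcess R μ)
    (hcirc : ∀ a b, ∫ ω, R a ω * R b ω ∂μ = 0) (a b c d : T) (t u : WithLp 2 (ℂ × ℂ)) :
    |∫ ω, ⟪t, WithLp.toLp 2 (R a ω, R b ω)⟫ * ⟪u, WithLp.toLp 2 (R c ω, R d ω)⟫ ∂μ| ≤
      ‖t‖ * ‖u‖ * (‖∫ ω, R a ω * conj (R c ω) ∂μ‖ + ‖∫ ω, R a ω * conj (R d ω) ∂μ‖ +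
        (‖∫ ω, R b ω * conj (R c ω) ∂μ‖ + ‖∫ ω, R b ω * conj (R d ω) ∂μ‖)) := by
  have h1 (w : WithLp 2 (ℂ × ℂ)) : ‖(WithLp.ofLp w).1‖ ≤ ‖w‖ ∧ ‖(WithLp.ofLp w).2‖ ≤ ‖w‖ := by
    have h := WithLp.prod_norm_sq_eq_of_L2 w
    constructor <;> refine le_of_sq_le_sq ?_ (norm_nonneg _) <;> rw [h]
    · exact le_add_of_nonneg_right (sq_nonneg _)
    · exact le_add_of_nonneg_left (sq_nonneg _)
  have h2 (x y z : ℂ) (hx : ‖x‖ ≤ ‖t‖) (hy : ‖y‖ ≤ ‖u‖) :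
      |(conj x * y * z).re / 2| ≤ ‖t‖ * ‖u‖ * ‖z‖ := by
    rw [abs_div, abs_of_pos (by norm_num : (0 : ℝ) < 2)]
    have h3 : |(conj x * y * z).re| ≤ ‖t‖ * ‖u‖ * ‖z‖ := by
      refine (Complex.abs_re_le_norm _).trans ?_
      rw [norm_mul, norm_mul, RCLike.norm_conj]
      gcongr
    have h4 : 0 ≤ ‖t‖ * ‖u‖ * ‖z‖ := by positivity
    linarith
  rw [integral_inner_mul_inner hR hcirc, mul_add, mul_add, mul_add]
  refine (abs_add_le _ _).trans (add_le_add ((abs_add_le _ _).trans (add_le_add ?_ ?_))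
    ((abs_add_le _ _).trans (add_le_add ?_ ?_)))
  exacts [h2 _ _ _ (h1 t).1 (h1 u).1, h2 _ _ _ (h1 t).1 (h1 u).2, h2 _ _ _ (h1 t).2 (h1 u).1,
    h2 _ _ _ (h1 t).2 (h1 u).2]

/-- The weak law of large numbers for functions of two antenna outputs at a fixed lag. -/
lemma tendsto_integral_norm_average_pair [IsProbabilityMeasure μ] (hR : IsGaussianProcess R μ)
    (hmean : ∀ a, ∫ ω, R a ω ∂μ = 0) (hcirc : ∀ a b, ∫ ω, R a ω * R b ω ∂μ = 0)
    {x : Fin 2 → ℕ → T} {C : Fin 2 → Fin 2 → ℤ → ℂ}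
    (hC : ∀ k l n m, ∫ ω, R (x k n) ω * conj (R (x l m) ω) ∂μ = C k l ((n : ℤ) - m))
    (hces : ∀ k l, CesaroNull fun n => ‖C k l n‖ ^ 2) {f : ℂ × ℂ → ℂ} (hfm : Measurable f)
    (hf : Integrable (fun ω => f (R (x 0 0) ω, R (x 1 0) ω)) μ) :
    (∀ n, Integrable (fun ω => f (R (x 0 n) ω, R (x 1 n) ω)) μ) ∧
    Tendsto (fun N : ℕ => ∫ ω, ‖(1 / (N : ℂ)) *
      ∑ n ∈ Finset.range N, f (R (x 0 n) ω, R (x 1 n) ω) -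
        ∫ ω, f (R (x 0 0) ω, R (x 1 0) ω) ∂μ‖ ∂μ) atTop (𝓝 0) := by
  have hint (q : T) : Integrable (R q) μ := (hR.hasGaussianLaw_eval q).integrable
  let h : ℕ → ℕ → ℝ := fun n m => ‖C 0 0 ((n : ℤ) - m)‖ + ‖C 0 1 ((n : ℤ) - m)‖ +
    (‖C 1 0 ((n : ℤ) - m)‖ + ‖C 1 1 ((n : ℤ) - m)‖)
  let G : ℤ → ℝ := fun k => 4 * (‖C 0 0 k‖ ^ 2 + ‖C 0 1 k‖ ^ 2 + (‖C 1 0 k‖ ^ 2 + ‖C 1 1 k‖ ^ 2))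
  have hG : CesaroNull G :=
    (((hces 0 0).add (hces 0 1)).add ((hces 1 0).add (hces 1 1))).const_mul 4
  -- The square of a sum of four terms is at most four times the sum of their squares, which reduces
  -- the Cesàro condition on `h²` to the single covariances.
  have hhG (n m : ℕ) : h n m ^ 2 ≤ G ((n : ℤ) - m) := by
    simp only [h, G]
    generalize ‖C 0 0 ((n : ℤ) - m)‖ = p
    generalize ‖C 0 1 ((n : ℤ) - m)‖ = q
    generalize ‖C 1 0 ((n : ℤ) - m)‖ = r
    generalize ‖C 1 1 ((n : ℤ) - m)‖ = s
    nlinarith [sq_nonneg (p - q), sq_nonneg (p - r), sq_nonneg (p - s), sq_nonneg (q - r),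
      sq_nonneg (q - s), sq_nonneg (r - s)]
  have hofLp : Measurable (WithLp.ofLp : WithLp 2 (ℂ × ℂ) → ℂ × ℂ) := by fun_prop
  refine tendsto_integral_norm_average (E := WithLp 2 (ℂ × ℂ)) (h := h)
    (Z := fun n ω => WithLp.toLp 2 (R (x 0 n) ω, R (x 1 n) ω))
    (f := fun z => f (WithLp.ofLp z))
    (fun n m => hasGaussianLaw_toLp_pairs hR _ _ _ _) (fun n t => ?_) (fun n t => ?_)
    (fun n m t u => ?_) (fun n m => by positivity) ?_ (hfm.comp hofLp) hf
  · have hin (ω : Ω) : ⟪t, WithLp.toLp 2 (R (x 0 n) ω, R (x 1 n) ω)⟫ =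
        RCLike.re (conj (WithLp.ofLp t).1 * R (x 0 n) ω + conj (WithLp.ofLp t).2 * R (x 1 n) ω) := by
      rw [inner_toLp_prodMk, map_add]
      rfl
    simp_rw [hin]
    have hi : Integrable (fun ω => conj (WithLp.ofLp t).1 * R (x 0 n) ω +
        conj (WithLp.ofLp t).2 * R (x 1 n) ω) μ :=
      ((hint _).const_mul _).add ((hint _).const_mul _)
    rw [integral_re hi, integral_add ((hint _).const_mul _) ((hint _).const_mul _),
      integral_const_mul, integral_const_mul, hmean, hmean]
    simp
  · simp_rw [pow_two, integral_inner_mul_inner hR hcirc, hC, sub_self]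
  · refine (abs_integral_inner_mul_inner_le hR hcirc _ _ _ _ t u).trans (le_of_eq ?_)
    simp_rw [hC, h]
  · refine squeeze_zero (fun N => by positivity) (fun N => ?_)
      (hG.tendsto_sum_sum fun k => by positivity)
    gcongr with n _ m _
    exact hhG n m

end Circular

/-! ### Joint Gaussianity -/

section Joint

variable {Ω S T : Type*} [MeasurableSpace Ω] {μ : Measure Ω}

lemma isGaussianProcess_of_iIndepFun {X : T → Ω → ℂ} (hX : ∀ t, HasGaussianLaw (X t) μ)
    (h : iIndepFun X μ) : IsGaussianProcess X μ where
  hasGaussianLaw I :=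
    (h.precomp (g := fun i : I => (i : T)) Subtype.val_injective).hasGaussianLaw fun i => hX i

/-- A finite set of indices splits into a left and a right part. The two corresponding vectors are
independent and Gaussian, hence jointly Gaussian, and the original vector is a linear rearrangement
of the pair. -/
lemma isGaussianProcess_sumElim {X : S → Ω → ℂ} {Y : T → Ω → ℂ} (hX : IsGaussianProcess X μ)
    (hY : IsGaussianProcess Y μ) (h : IndepFun (fun ω s => X s ω) (fun ω t => Y t ω) μ) :
    IsGaussianProcess (Sum.elim X Y) μ where
  hasGaussianLaw I := by
    have hind : IndepFun (fun ω => I.toLeft.restrict (X · ω)) (fun ω => I.toRight.restrict (Y · ω))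
        μ := h.comp (φ := I.toLeft.restrict) (ψ := I.toRight.restrict)
          (Finset.measurable_restrict _) (Finset.measurable_restrict _)
    have hpair := hind.hasGaussianLaw (hX.hasGaussianLaw _) (hY.hasGaussianLaw _)
    let K : ((I.toLeft → ℂ) × (I.toRight → ℂ)) →ₗ[ℝ] (I → ℂ) :=
      { toFun := fun x i => match i with
          | ⟨.inl s, hs⟩ => x.1 ⟨s, Finset.mem_toLeft.2 hs⟩
          | ⟨.inr t, ht⟩ => x.2 ⟨t, Finset.mem_toRight.2 ht⟩
        map_add' := fun x y => by ext ⟨i | i, hi⟩ <;> rfl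
        map_smul' := fun c x => by ext ⟨i | i, hi⟩ <;> rfl }
    have hK := hpair.map_fun (LinearMap.toContinuousLinearMap K)
    have e : (fun ω => I.restrict (Sum.elim X Y · ω)) = fun ω => LinearMap.toContinuousLinearMap K
        (I.toLeft.restrict (X · ω), I.toRight.restrict (Y · ω)) := by
      funext ω i
      obtain ⟨i | i, hi⟩ := i <;> rfl
    rw [e]
    exact hK

/-- The mixed signal–noise moments vanish. Leaving the second pair free makes this serve both plain
and conjugated products. -/
lemma integral_add_mul_add {x y x' y' : Ω → ℂ} (hx : MemLp x 2 μ) (hy : MemLp y 2 μ)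
    (hx' : MemLp x' 2 μ) (hy' : MemLp y' 2 μ) (α β : ℂ)
    (h1 : ∫ ω, x ω * y' ω ∂μ = 0) (h2 : ∫ ω, y ω * x' ω ∂μ = 0) :
    ∫ ω, (α * x ω + y ω) * (β * x' ω + y' ω) ∂μ =
      α * β * ∫ ω, x ω * x' ω ∂μ + ∫ ω, y ω * y' ω ∂μ := by
  have i1 : Integrable (fun ω => x ω * x' ω) μ := hx.integrable_mul hx'
  have i2 : Integrable (fun ω => x ω * y' ω) μ := hx.integrable_mul hy'
  have i3 : Integrable (fun ω => y ω * x' ω) μ := hy.integrable_mul hx'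
  have i4 : Integrable (fun ω => y ω * y' ω) μ := hy.integrable_mul hy'
  have i12 : Integrable (fun ω => α * β * (x ω * x' ω) + α * (x ω * y' ω)) μ :=
    (i1.const_mul _).add (i2.const_mul _)
  have i34 : Integrable (fun ω => β * (y ω * x' ω) + y ω * y' ω) μ := (i3.const_mul _).add i4
  have e : ∀ ω, (α * x ω + y ω) * (β * x' ω + y' ω) =
      (α * β * (x ω * x' ω) + α * (x ω * y' ω)) + (β * (y ω * x' ω) + y ω * y' ω) := fun ω => by
    ring
  simp_rw [e]
  rw [integral_add i12 i34, integral_add (i1.const_mul _) (i2.const_mul _),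
    integral_add (i3.const_mul _) i4, integral_const_mul, integral_const_mul, integral_const_mul,
    h1, h2]
  ring

end Joint

/-! ### Moments of the received signals. -/

namespace Scenario

variable {L M K : ℕ} (P : Scenario L M K) {Ω : Type*} [MeasurableSpace Ω] {μ : Measure Ω}
  {s : ℝ → Ω → ℂ} {v : Fin L → ℤ → Fin M → Ω → ℂ}

/-- The covariance of `r_i[n + k]` at antenna `c` and `r_j[n]` at antenna `d` in closed form. -/
noncomputable def modelCov (i j : Fin L) (k : ℤ) (c d : Fin M) : ℂ :=
  P.b i * conj (P.b j) * P.Rs ((k : ℝ) * P.Ts - P.delta i j P.pos) *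
    (P.a i P.pos c * conj (P.a j P.pos d)) + (if i = j ∧ k = 0 ∧ c = d then (P.σsq i : ℂ) else 0)

variable {P}

namespace IsModel

lemma noise_process (h : P.IsModel μ s v) :
    IsGaussianProcess (fun i : Fin L × ℤ × Fin M => v i.1 i.2.1 i.2.2) μ :=
  isGaussianProcess_of_iIndepFun (fun _ => h.noise_gaussian _ _ _) h.noise_indep

/-- Each received sample is a real-linear function of two coordinates of the joint Gaussian process
of signal and noise. -/
lemma received_process (h : P.IsModel μ s v) :
    IsGaussianProcess (fun (q : Fin L × ℤ × Fin M) ω => P.received s v ω q.1 q.2.1 q.2.2) μ := by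
  classical
  have hsum := isGaussianProcess_sumElim h.signal_gaussian h.noise_process h.signal_noise_indep
  refine hsum.of_isGaussianProcess fun q => ?_
  let t : ℝ := (q.2.1 : ℝ) * P.Ts - P.τ q.1 P.pos
  let I : Finset (ℝ ⊕ (Fin L × ℤ × Fin M)) := {Sum.inl t, Sum.inr q}
  let pr (i : I) : (I → ℂ) →L[ℝ] ℂ := ContinuousLinearMap.proj i
  exact ⟨I, ContinuousLinearMap.mul ℝ ℂ (P.b q.1 * P.a q.1 P.pos q.2.2) ∘L
    pr ⟨Sum.inl t, by simp [I]⟩ + pr ⟨Sum.inr q, by simp [I]⟩, fun ω => rfl⟩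

lemma memLp_signal (h : P.IsModel μ s v) (t : ℝ) : MemLp (s t) 2 μ :=
  (h.signal_gaussian.hasGaussianLaw_eval t).memLp_two

lemma memLp_noise (h : P.IsModel μ s v) (ℓ : Fin L) (n : ℤ) (m : Fin M) : MemLp (v ℓ n m) 2 μ :=
  (h.noise_gaussian ℓ n m).memLp_two

lemma memLp_received (h : P.IsModel μ s v) (ℓ : Fin L) (n : ℤ) (m : Fin M) :
    MemLp (fun ω => P.received s v ω ℓ n m) 2 μ :=
  (h.received_process.hasGaussianLaw_eval (ℓ, n, m)).memLp_two

lemma indepFun_signal_noise (h : P.IsModel μ s v) (t : ℝ) (ℓ : Fin L) (n : ℤ) (m : Fin M) :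
    IndepFun (s t) (v ℓ n m) μ :=
  h.signal_noise_indep.comp (φ := fun f : ℝ → ℂ => f t)
    (ψ := fun f : Fin L × ℤ × Fin M → ℂ => f (ℓ, n, m)) (by fun_prop) (by fun_prop)

lemma integral_signal_mul_noise (h : P.IsModel μ s v) (t : ℝ) (ℓ : Fin L) (n : ℤ) (m : Fin M) :
    ∫ ω, s t ω * v ℓ n m ω ∂μ = 0 ∧ ∫ ω, s t ω * conj (v ℓ n m ω) ∂μ = 0 ∧
      ∫ ω, v ℓ n m ω * conj (s t ω) ∂μ = 0 := by
  have hs := (h.memLp_signal t).aestronglyMeasurable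
  have hv := (h.memLp_noise ℓ n m).aestronglyMeasurable
  have hi := h.indepFun_signal_noise t ℓ n m
  have hc : Measurable (fun z : ℂ => conj z) := Complex.continuous_conj.measurable
  refine ⟨?_, ?_, ?_⟩
  · rw [hi.integral_fun_mul_eq_mul_integral hs hv, h.noise_mean, mul_zero]
  · refine ((hi.comp measurable_id hc).integral_fun_mul_eq_mul_integral hs
      (Complex.continuous_conj.comp_aestronglyMeasurable hv)).trans ?_
    simp [h.signal_mean]
  · refine ((hi.comp hc measurable_id).symm.integral_fun_mul_eq_mul_integral hv
      (Complex.continuous_conj.comp_aestronglyMeasurable hs)).trans ?_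
    simp [h.noise_mean]

lemma integral_noise_mul_noise (h : P.IsModel μ s v) (q q' : Fin L × ℤ × Fin M) :
    ∫ ω, v q.1 q.2.1 q.2.2 ω * v q'.1 q'.2.1 q'.2.2 ω ∂μ = 0 ∧
      ∫ ω, v q.1 q.2.1 q.2.2 ω * conj (v q'.1 q'.2.1 q'.2.2 ω) ∂μ =
        if q = q' then (P.σsq q.1 : ℂ) else 0 := by
  by_cases hq : q = q'
  · subst hq
    refine ⟨h.noise_circular _ _ _, ?_⟩
    simp_rw [if_pos, Complex.mul_conj']
    rw [← h.noise_var q.1 q.2.1 q.2.2, ← integral_complex_ofReal]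
    push_cast
    rfl
  · have hi := h.noise_indep.indepFun hq
    have hv := (h.memLp_noise q.1 q.2.1 q.2.2).aestronglyMeasurable
    have hv' := (h.memLp_noise q'.1 q'.2.1 q'.2.2).aestronglyMeasurable
    have hc : Measurable (fun z : ℂ => conj z) := Complex.continuous_conj.measurable
    rw [if_neg hq]
    constructor
    · rw [hi.integral_fun_mul_eq_mul_integral hv hv', h.noise_mean, zero_mul]
    · refine ((hi.comp measurable_id hc).integral_fun_mul_eq_mul_integral hv
        (Complex.continuous_conj.comp_aestronglyMeasurable hv')).trans ?_
      simp [h.noise_mean]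

lemma integral_received (h : P.IsModel μ s v) (q : Fin L × ℤ × Fin M) :
    ∫ ω, P.received s v ω q.1 q.2.1 q.2.2 ∂μ = 0 := by
  have hs := (h.signal_gaussian.hasGaussianLaw_eval
    ((q.2.1 : ℝ) * P.Ts - P.τ q.1 P.pos)).integrable
  have hv := (h.noise_gaussian q.1 q.2.1 q.2.2).integrable
  simp only [received]
  rw [integral_add (hs.const_mul _) hv, integral_const_mul, h.signal_mean, h.noise_mean, mul_zero,
    add_zero]

lemma integral_received_mul (h : P.IsModel μ s v) (q q' : Fin L × ℤ × Fin M) :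
    ∫ ω, P.received s v ω q.1 q.2.1 q.2.2 * P.received s v ω q'.1 q'.2.1 q'.2.2 ∂μ = 0 := by
  simp only [received]
  rw [integral_add_mul_add (h.memLp_signal _) (h.memLp_noise _ _ _) (h.memLp_signal _)
    (h.memLp_noise _ _ _), h.signal_circular, (h.integral_noise_mul_noise q q').1]
  · simp
  · exact (h.integral_signal_mul_noise _ _ _ _).1
  · simp_rw [mul_comm (v _ _ _ _)]
    exact (h.integral_signal_mul_noise _ _ _ _).1

lemma integral_received_mul_conj (h : P.IsModel μ s v) (i j : Fin L) (n m : ℤ) (c d : Fin M) :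
    ∫ ω, P.received s v ω i n c * conj (P.received s v ω j m d) ∂μ =
      P.modelCov i j (n - m) c d := by
  simp only [received, map_add, map_mul]
  have hs' : MemLp (fun ω => conj (s ((m : ℝ) * P.Ts - P.τ j P.pos) ω)) 2 μ :=
    (h.memLp_signal _).star
  have hv' : MemLp (fun ω => conj (v j m d ω)) 2 μ := (h.memLp_noise _ _ _).star
  rw [integral_add_mul_add (h.memLp_signal _) (h.memLp_noise _ _ _) hs' hv'
    _ _ (h.integral_signal_mul_noise _ _ _ _).2.1 (h.integral_signal_mul_noise _ _ _ _).2.2,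
    (h.integral_noise_mul_noise (i, n, c) (j, m, d)).2]
  -- The lag is chosen so that subtracting it from the emission time `nT_s - τ_i` gives the emission
  -- time `mT_s - τ_j` of the other sample.
  have hcov := h.signal_cov ((n : ℝ) * P.Ts - P.τ i P.pos)
    (((n - m : ℤ) : ℝ) * P.Ts - P.delta i j P.pos)
  rw [show (n : ℝ) * P.Ts - P.τ i P.pos - (((n - m : ℤ) : ℝ) * P.Ts - P.delta i j P.pos) =
    (m : ℝ) * P.Ts - P.τ j P.pos by rw [delta]; push_cast; ring] at hcov
  rw [hcov, modelCov]
  congr 1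
  · ring
  · simp only [Prod.mk.injEq, sub_eq_zero]

lemma covAt_eq (h : P.IsModel μ s v) (i j : Fin L) (n m : ℤ) (c d : Fin M) :
    P.covAt μ s v i j n m c d = P.modelCov i j m c d := by
  rw [covAt, Matrix.of_apply, h.integral_received_mul_conj, sub_sub_cancel]

lemma cov_eq (h : P.IsModel μ s v) (i j : Fin L) (m : ℤ) (c d : Fin M) :
    P.cov μ s v i j m c d = P.modelCov i j m c d := h.covAt_eq i j 0 m c d

lemma Rs_neg (h : P.IsModel μ s v) (t : ℝ) : P.Rs (-t) = conj (P.Rs t) := by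
  rw [← h.signal_cov 0 (-t), ← h.signal_cov t t, ← integral_conj]
  simp only [sub_neg_eq_add, zero_add, sub_self, map_mul, Complex.conj_conj]
  simp_rw [mul_comm]

lemma Rs_zero (h : P.IsModel μ s v) : ((P.Rs 0).re : ℂ) = P.Rs 0 := by
  have := h.Rs_neg 0
  rw [neg_zero] at this
  exact Complex.conj_eq_iff_re.1 this.symm

lemma conj_modelCov (h : P.IsModel μ s v) (i j : Fin L) (k : ℤ) (c d : Fin M) :
    conj (P.modelCov i j k c d) = P.modelCov j i (-k) d c := by
  have h1 : ((-k : ℤ) : ℝ) * P.Ts - P.delta j i P.pos =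
      -((k : ℝ) * P.Ts - P.delta i j P.pos) := by
    simp only [delta]; push_cast; ring
  rw [modelCov, modelCov, h1, h.Rs_neg]
  simp only [map_add, map_mul, Complex.conj_conj, apply_ite conj, Complex.conj_ofReal, map_zero]
  congr 1
  · ring
  · by_cases hij : i = j
    · subst hij
      simp only [true_and, neg_eq_zero, eq_comm]
    · rw [if_neg (fun hh => hij hh.1), if_neg (fun hh => hij hh.1.symm)]

/-- The gain `1/M` of each antenna makes `ρ_i` the standard deviation of every output of station
`i`, which is the normalization that the arcsine law uses. -/
lemma modelCov_self (h : P.IsModel μ s v) (hP : P.Admissible) (i : Fin L) (c : Fin M) :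
    P.modelCov i i 0 c c = (P.ρ i : ℂ) ^ 2 := by
  have h1 : P.a i P.pos c * conj (P.a i P.pos c) = ((1 / (M : ℝ) : ℝ) : ℂ) := by
    rw [Complex.mul_conj', ← hP.gain i P.pos c]
    push_cast
    rfl
  have h2 : (P.ρ i : ℂ) ^ 2 = ((P.ρsq i : ℝ) : ℂ) := by
    rw [← Complex.ofReal_pow, ρ, Real.sq_sqrt (hP.ρsq_pos i).le]
  rw [modelCov, h1, h2, delta, sub_self, Int.cast_zero, zero_mul, sub_zero, ← h.Rs_zero,
    Complex.mul_conj', if_pos ⟨rfl, rfl, rfl⟩, ρsq]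
  push_cast
  ring

/-- Because the true delays are integer multiples of `T_s`, the signal part samples `R_s` on a
shifted copy of the grid on which ergodicity is assumed. The noise part lives at lag zero only, and
`(x + y)² ≤ 2x² + 2y²` separates the two. -/
lemma cesaroNull_modelCov (h : P.IsModel μ s v) (hP : P.Admissible) (i j : Fin L) (c d : Fin M) :
    CesaroNull fun k => ‖P.modelCov i j k c d‖ ^ 2 := by
  obtain ⟨p, hp⟩ := hP.pos_delays i
  obtain ⟨q, hq⟩ := hP.pos_delays j
  have hR : CesaroNull fun k : ℤ => ‖P.Rs ((k : ℝ) * P.Ts)‖ ^ 2 := by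
    refine cesaroNull_of_even (fun k => ?_) (fun k => by positivity) ?_
    · rw [Int.cast_neg, neg_mul, h.Rs_neg, RCLike.norm_conj]
    · simpa using hP.ergodic
  have hsh := hR.comp_add (fun k => by positivity) (-(p - q))
  refine ((hsh.const_mul (2 * ‖P.b i * conj (P.b j) *
    (P.a i P.pos c * conj (P.a j P.pos d))‖ ^ 2)).add
    (cesaroNull_ite_eq_zero (2 * (P.σsq i) ^ 2))).mono (fun k => by positivity) fun k => ?_
  have e1 : (k : ℝ) * P.Ts - P.delta i j P.pos = ((k + -(p - q) : ℤ) : ℝ) * P.Ts := by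
    rw [delta, hp, hq]; push_cast; ring
  have e2 : ‖(if i = j ∧ k = 0 ∧ c = d then (P.σsq i : ℂ) else 0)‖ ^ 2 ≤
      if k = 0 then (P.σsq i) ^ 2 else 0 := by
    split_ifs with h1 h2 h2
    · simp
    · exact absurd h1.2.1 h2
    · simpa using sq_nonneg _
    · simp
  rw [modelCov, e1]
  set A := P.Rs (((k + -(p - q) : ℤ) : ℝ) * P.Ts)
  set B : ℂ := if i = j ∧ k = 0 ∧ c = d then (P.σsq i : ℂ) else 0
  have e3 : ‖P.b i * conj (P.b j) * A * (P.a i P.pos c * conj (P.a j P.pos d))‖ =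
      ‖P.b i * conj (P.b j) * (P.a i P.pos c * conj (P.a j P.pos d))‖ * ‖A‖ := by
    rw [← norm_mul]; congr 1; ring
  have e4 : (if k = 0 then 2 * (P.σsq i) ^ 2 else 0) = 2 * if k = 0 then (P.σsq i) ^ 2 else 0 := by
    split_ifs <;> simp
  have e5 := norm_add_le (P.b i * conj (P.b j) * A * (P.a i P.pos c * conj (P.a j P.pos d))) B
  rw [e3] at e5
  rw [e4]
  set D := ‖P.b i * conj (P.b j) * (P.a i P.pos c * conj (P.a j P.pos d))‖
  calc _ ≤ (D * ‖A‖ + ‖B‖) ^ 2 := by gcongr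
    _ ≤ 2 * D ^ 2 * ‖A‖ ^ 2 + 2 * ‖B‖ ^ 2 := by nlinarith [sq_nonneg (D * ‖A‖ - ‖B‖)]
    _ ≤ _ := by gcongr

end IsModel

/-! ### The parallel scenario -/

lemma Admissible.ρ_pos (hP : P.Admissible) (ℓ : Fin L) : 0 < P.ρ ℓ :=
  Real.sqrt_pos.2 (hP.ρsq_pos ℓ)

lemma Admissible.sq_ρ (hP : P.Admissible) (ℓ : Fin L) : P.ρ ℓ ^ 2 = P.ρsq ℓ :=
  Real.sq_sqrt (hP.ρsq_pos ℓ).le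

lemma Admissible.parallel_ρsq (hP : P.Admissible) (ℓ : Fin L) : P.parallel.ρsq ℓ = 1 := by
  have h0 := (hP.ρsq_pos ℓ).ne'
  change ‖P.b ℓ / (P.ρ ℓ : ℂ)‖ ^ 2 * (P.Rs 0).re / M + P.σsq ℓ / P.ρsq ℓ = 1
  rw [norm_div, Complex.norm_real, Real.norm_of_nonneg (hP.ρ_pos ℓ).le, div_pow, hP.sq_ρ]
  calc _ = P.ρsq ℓ / P.ρsq ℓ := by rw [ρsq]; ring
    _ = 1 := div_self h0

lemma Admissible.parallel_ρ (hP : P.Admissible) (ℓ : Fin L) : P.parallel.ρ ℓ = 1 := by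
  rw [ρ, hP.parallel_ρsq, Real.sqrt_one]

lemma Admissible.parallel (hP : P.Admissible) : P.parallel.Admissible where
  Ts_pos := hP.Ts_pos
  gain := hP.gain
  σsq_nonneg ℓ := div_nonneg (hP.σsq_nonneg ℓ) (hP.ρsq_pos ℓ).le
  ρsq_pos ℓ := by rw [hP.parallel_ρsq]; exact one_pos
  pos_delays := hP.pos_delays
  ergodic := hP.ergodic

lemma IsModel.parallel (h : P.IsModel μ s v) (hP : P.Admissible) :
    P.parallel.IsModel μ s (fun ℓ n m ω => v ℓ n m ω / (P.ρ ℓ : ℂ)) where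
  signal_gaussian := h.signal_gaussian
  signal_mean := h.signal_mean
  signal_circular := h.signal_circular
  signal_cov := h.signal_cov
  noise_gaussian ℓ n m := by
    have := (h.noise_gaussian ℓ n m).map_fun (ContinuousLinearMap.mul ℝ ℂ ((P.ρ ℓ : ℂ)⁻¹))
    refine this.congr (ae_of_all _ fun ω => ?_)
    simp [div_eq_inv_mul]
  noise_mean ℓ n m := by rw [integral_div, h.noise_mean, zero_div]
  noise_circular ℓ n m := by
    simp_rw [div_mul_div_comm]
    rw [integral_div, h.noise_circular, zero_div]
  noise_var ℓ n m := by
    have e : ∀ ω, ‖v ℓ n m ω / (P.ρ ℓ : ℂ)‖ ^ 2 = ‖v ℓ n m ω‖ ^ 2 / P.ρsq ℓ := fun ω => by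
      rw [norm_div, Complex.norm_real, Real.norm_of_nonneg (hP.ρ_pos ℓ).le, div_pow, hP.sq_ρ]
    simp_rw [e]
    rw [integral_div, h.noise_var]
    rfl
  noise_indep := h.noise_indep.comp (fun i z => z / (P.ρ i.1 : ℂ)) fun i =>
    measurable_id.div_const _
  signal_noise_indep := h.signal_noise_indep.comp (φ := id)
    (ψ := fun (f : Fin L × ℤ × Fin M → ℂ) (i : Fin L × ℤ × Fin M) => f i / (P.ρ i.1 : ℂ))
    measurable_id (measurable_pi_lambda _ fun i => (measurable_pi_apply i).div_const _)

/-- The normalized covariances of a scenario are the covariances of its parallel scenario. -/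
lemma Admissible.modelCov_parallel (hP : P.Admissible) (i j : Fin L) (k : ℤ) (c d : Fin M) :
    P.parallel.modelCov i j k c d = P.modelCov i j k c d / ((P.ρ i : ℂ) * (P.ρ j : ℂ)) := by
  change P.b i / (P.ρ i : ℂ) * conj (P.b j / (P.ρ j : ℂ)) *
    P.Rs ((k : ℝ) * P.Ts - P.delta i j P.pos) * (P.a i P.pos c * conj (P.a j P.pos d)) +
    (if i = j ∧ k = 0 ∧ c = d then ((P.σsq i / P.ρsq i : ℝ) : ℂ) else 0) = _
  rw [modelCov, add_div, map_div₀, Complex.conj_ofReal]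
  congr 1
  · rw [div_mul_div_comm]
    ring
  · split_ifs with h
    · rw [← h.1, ← hP.sq_ρ]
      push_cast
      rw [pow_two]
    · rw [zero_div]

end Scenario

/-! ### Convergence in probability to constants -/

section InMeasure

variable {Ω : Type*} [MeasurableSpace Ω] {μ : Measure Ω}

/-- Convergence in mean is used only for the integrable majorant `W`, so no measurability of `X`
enters. -/
lemma tendstoInMeasure_of_norm_sub_le {X : ℕ → Ω → ℂ} {c : ℂ} {W : ℕ → Ω → ℝ}
    (hW0 : ∀ N ω, 0 ≤ W N ω) (hWi : ∀ N, Integrable (W N) μ)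
    (hW : Tendsto (fun N => ∫ ω, W N ω ∂μ) atTop (𝓝 0))
    (hle : ∀ᶠ N in atTop, ∀ ω, ‖X N ω - c‖ ≤ W N ω) :
    TendstoInMeasure μ X atTop (fun _ => c) := by
  have hWm : TendstoInMeasure μ W atTop (fun _ => 0) := by
    refine tendstoInMeasure_of_tendsto_eLpNorm one_ne_zero
      (fun N => (hWi N).aestronglyMeasurable) aestronglyMeasurable_const ?_
    have e (N : ℕ) : eLpNorm (W N - fun _ => 0) 1 μ = ENNReal.ofReal (∫ ω, W N ω ∂μ) := by
      rw [show (W N - fun _ => (0 : ℝ)) = W N from sub_zero _, eLpNorm_one_eq_lintegral_enorm,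
        ← ofReal_integral_norm_eq_lintegral_enorm (hWi N)]
      simp_rw [Real.norm_of_nonneg (hW0 N _)]
    simp_rw [e]
    have := (ENNReal.continuous_ofReal.tendsto 0).comp hW
    simpa [Function.comp_def] using this
  rw [tendstoInMeasure_iff_norm] at hWm ⊢
  intro ε hε
  refine tendsto_of_tendsto_of_tendsto_of_le_of_le' tendsto_const_nhds (hWm ε hε)
    (Eventually.of_forall fun _ => zero_le) ?_
  filter_upwards [hle] with N hN
  refine measure_mono fun ω hω => ?_
  simp only [Set.mem_ofPred_eq, sub_zero] at hω ⊢
  rw [Real.norm_of_nonneg (hW0 N ω)]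
  exact hω.trans (hN ω)

/-- The continuous mapping theorem for finitely many variables with constant limits. -/
lemma tendstoInMeasure_comp {ι E F : Type*} [Fintype ι] [PseudoMetricSpace E]
    [PseudoMetricSpace F] {X : ι → ℕ → Ω → E} {c : ι → E}
    (hX : ∀ i, TendstoInMeasure μ (X i) atTop (fun _ => c i)) {g : (ι → E) → F}
    (hg : ContinuousAt g c) :
    TendstoInMeasure μ (fun N ω => g fun i => X i N ω) atTop (fun _ => g c) := by
  rw [tendstoInMeasure_iff_dist]
  intro ε hε
  obtain ⟨δ, hδ, hδε⟩ := Metric.continuousAt_iff.1 hg ε hε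
  have hsum : Tendsto (fun N => ∑ i, μ {ω | δ ≤ dist (X i N ω) (c i)}) atTop (𝓝 0) := by
    have := tendsto_finsetSum Finset.univ fun i _ => tendstoInMeasure_iff_dist.1 (hX i) δ hδ
    simpa using this
  refine tendsto_of_tendsto_of_tendsto_of_le_of_le tendsto_const_nhds hsum
    (fun _ => zero_le) fun N => ?_
  refine (measure_mono fun ω hω => ?_).trans (measure_iUnion_fintype_le μ _)
  simp only [Set.mem_iUnion, Set.mem_ofPred_eq] at hω ⊢
  by_contra! hcon
  exact absurd (hδε ((dist_pi_lt_iff hδ).2 hcon)) (not_lt.2 hω)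

lemma tendstoInMeasure_comp_one {E F : Type*} [PseudoMetricSpace E] [PseudoMetricSpace F]
    {X : ℕ → Ω → E} {c : E} (hX : TendstoInMeasure μ X atTop (fun _ => c)) {g : E → F}
    (hg : Continuous g) :
    TendstoInMeasure μ (fun N ω => g (X N ω)) atTop (fun _ => g c) :=
  tendstoInMeasure_comp (ι := Unit) (X := fun _ => X) (c := fun _ => c) (fun _ => hX)
    (g := fun x => g (x ())) (hg.comp (continuous_apply ())).continuousAt

lemma tendstoInMeasure_sub {X Y : ℕ → Ω → ℂ} {c d : ℂ}
    (hX : TendstoInMeasure μ X atTop (fun _ => c)) (hY : TendstoInMeasure μ Y atTop (fun _ => d)) :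
    TendstoInMeasure μ (fun N ω => X N ω - Y N ω) atTop (fun _ => c - d) := by
  have := tendstoInMeasure_comp (ι := Bool) (X := fun b => if b then X else Y)
    (c := fun b => if b then c else d) (fun b => by cases b <;> simpa)
    (g := fun x => x true - x false) (by fun_prop)
  simpa using this

end InMeasure

/-! ### Consistency of the sample correlations. -/

namespace Scenario

variable {L M K : ℕ} {P : Scenario L M K} {Ω : Type*} [MeasurableSpace Ω] {μ : Measure Ω}
  {s : ℝ → Ω → ℂ} {v : Fin L → ℤ → Fin M → Ω → ℂ}

lemma delta_eq_lag (hTs : 0 < P.Ts) {p : EuclideanSpace ℝ (Fin K)} (hp : P.IntegerDelays p)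
    (i j : Fin L) : P.delta i j p = P.lag i j p * P.Ts := by
  obtain ⟨k, hk⟩ := hp i
  obtain ⟨l, hl⟩ := hp j
  have e : P.delta i j p / P.Ts = ((k - l : ℤ) : ℝ) := by
    rw [delta, hk, hl]
    push_cast
    field_simp
  rw [lag, e, round_intCast, ← e, div_mul_cancel₀ _ hTs.ne']

lemma sampleCov_eq_dftCorr {p : EuclideanSpace ℝ (Fin K)} {i j : Fin L} {d : ℤ}
    (h : P.delta i j p = d * P.Ts) (N : ℕ) (x : Fin L → ℤ → Fin M → ℂ) (c e : Fin M) :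
    P.sampleCov N x i j p c e = P.dftCorr N (fun n => x i n c) (fun n => x j n e) d := by
  rw [sampleCov, Matrix.of_apply, dftCorr, h]

namespace IsModel

lemma integral_sq_norm_received (h : P.IsModel μ s v) (hP : P.Admissible) (i : Fin L) (n : ℤ)
    (c : Fin M) : ∫ ω, ‖P.received s v ω i n c‖ ^ 2 ∂μ = P.ρsq i := by
  have h1 := h.integral_received_mul_conj i i n n c c
  rw [sub_self, h.modelCov_self hP] at h1
  simp_rw [Complex.mul_conj'] at h1
  have h2 := integral_complex_ofReal (μ := μ) (f := fun ω => ‖P.received s v ω i n c‖ ^ 2)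
  push_cast at h2
  rw [h2] at h1
  rw [← hP.sq_ρ]
  exact_mod_cast h1

/-- Consistency of the sample correlations of memoryless functions of the received signals. -/
lemma tendstoInMeasure_dftCorr [IsProbabilityMeasure μ] (h : P.IsModel μ s v) (hP : P.Admissible)
    {f : ℂ → ℂ} (hfm : Measurable f) (hf : ∀ z, ‖f z‖ ^ 2 ≤ 1 + ‖z‖ ^ 2) (i j : Fin L)
    (c e : Fin M) (d : ℤ) :
    TendstoInMeasure μ (fun N ω => P.dftCorr N (fun n => f (P.received s v ω i n c))
      (fun n => f (P.received s v ω j n e)) d) atTop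
      (fun _ => ∫ ω, f (P.received s v ω i 1 c) * conj (f (P.received s v ω j (1 - d) e)) ∂μ) := by
  have hsqi (i : Fin L) (n : ℤ) (c : Fin M) :
      Integrable (fun ω => 1 + ‖P.received s v ω i n c‖ ^ 2) μ :=
    (integrable_const 1).add (h.memLp_received i n c).norm.integrable_sq
  have hmeas (i : Fin L) (n : ℤ) (c : Fin M) :
      AEStronglyMeasurable (fun ω => f (P.received s v ω i n c)) μ :=
    (hfm.comp_aemeasurable (h.memLp_received i n c).aestronglyMeasurable.aemeasurable
      ).aestronglyMeasurable
  have hfi (i : Fin L) (n : ℤ) (c : Fin M) :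
      Integrable (fun ω => ‖f (P.received s v ω i n c)‖ ^ 2) μ :=
    (hsqi i n c).mono' ((hmeas i n c).norm.pow 2) (ae_of_all _ fun ω => by
      rw [Real.norm_of_nonneg (by positivity)]
      exact hf _)
  have hfL2 (i : Fin L) (n : ℤ) (c : Fin M) : MemLp (fun ω => f (P.received s v ω i n c)) 2 μ :=
    (memLp_two_iff_integrable_sq_norm (hmeas i n c)).2 (hfi i n c)
  have hbound (i : Fin L) (n : ℤ) (c : Fin M) :
      ∫ ω, ‖f (P.received s v ω i n c)‖ ^ 2 ∂μ ≤ 1 + P.ρsq i := by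
    refine (integral_mono (hfi i n c) (hsqi i n c) fun ω => hf _).trans (le_of_eq ?_)
    rw [integral_add (integrable_const _) (h.memLp_received i n c).norm.integrable_sq,
      h.integral_sq_norm_received hP]
    simp
  set avg : ℕ → Ω → ℂ := fun N ω => (1 / (N : ℂ)) * ∑ n ∈ Finset.range N,
    f (P.received s v ω i ((n : ℤ) + 1) c) * conj (f (P.received s v ω j ((n : ℤ) + 1 - d) e))
    with havg
  set m := ∫ ω, f (P.received s v ω i 1 c) * conj (f (P.received s v ω j (1 - d) e)) ∂μ with hm
  -- The samples affected by wrap-around. `B` bounds their contribution; there are at most `|d|` of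
  -- them and each summand has bounded mean, so the mean of `B` is O(1/N).
  let bd (N : ℕ) : Finset ℕ :=
    (Finset.range N).filter (fun n : ℕ => ¬ (d ≤ n ∧ (n : ℤ) < N + d))
  let B : ℕ → Ω → ℝ := fun N ω => (1 / (N : ℝ)) * ∑ n ∈ bd N,
    (‖f (P.received s v ω i ((n : ℤ) + 1) c)‖ ^ 2 +
      (‖f (P.received s v ω j (((n : ℤ) - d) % N + 1) e)‖ ^ 2 +
        ‖f (P.received s v ω j ((n : ℤ) + 1 - d) e)‖ ^ 2))
  have hBi (N : ℕ) : Integrable (B N) μ :=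
    (integrable_finsetSum _ fun n _ => (hfi _ _ _).add ((hfi _ _ _).add (hfi _ _ _))).const_mul _
  have hBle (N : ℕ) : ∫ ω, B N ω ∂μ ≤
      d.natAbs * ((1 + P.ρsq i) + ((1 + P.ρsq j) + (1 + P.ρsq j))) / N := by
    have h1 (n : ℕ) : ∫ ω, (‖f (P.received s v ω i ((n : ℤ) + 1) c)‖ ^ 2 +
        (‖f (P.received s v ω j (((n : ℤ) - d) % N + 1) e)‖ ^ 2 +
          ‖f (P.received s v ω j ((n : ℤ) + 1 - d) e)‖ ^ 2)) ∂μ ≤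
        (1 + P.ρsq i) + ((1 + P.ρsq j) + (1 + P.ρsq j)) := by
      have i2 : Integrable (fun ω => ‖f (P.received s v ω j (((n : ℤ) - d) % N + 1) e)‖ ^ 2 +
          ‖f (P.received s v ω j ((n : ℤ) + 1 - d) e)‖ ^ 2) μ := (hfi _ _ _).add (hfi _ _ _)
      rw [integral_add (hfi _ _ _) i2, integral_add (hfi _ _ _) (hfi _ _ _)]
      gcongr <;> exact hbound _ _ _
    have hpos : 0 ≤ (1 + P.ρsq i) + ((1 + P.ρsq j) + (1 + P.ρsq j)) := by
      have := hP.ρsq_pos i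
      have := hP.ρsq_pos j
      positivity
    simp only [B]
    have hi3 (n : ℕ) : Integrable (fun ω => ‖f (P.received s v ω i ((n : ℤ) + 1) c)‖ ^ 2 +
        (‖f (P.received s v ω j (((n : ℤ) - d) % N + 1) e)‖ ^ 2 +
          ‖f (P.received s v ω j ((n : ℤ) + 1 - d) e)‖ ^ 2)) μ :=
      (hfi _ _ _).add ((hfi _ _ _).add (hfi _ _ _))
    rw [integral_const_mul, integral_finsetSum _ fun n _ => hi3 n, one_div, ← div_eq_inv_mul]
    gcongr
    refine (Finset.sum_le_sum fun n _ => h1 n).trans ?_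
    rw [Finset.sum_const, nsmul_eq_mul]
    gcongr
    exact card_filter_boundary_le N d
  have hBt : Tendsto (fun N => ∫ ω, B N ω ∂μ) atTop (𝓝 0) :=
    squeeze_zero (fun N => integral_nonneg fun ω => by positivity) hBle
      (tendsto_const_div_atTop_nhds_zero_nat _)
  -- The weak law is applied to the pairs `(r_i[n+1], r_j[n+1-d])`. The two components carry the
  -- time offsets `0` and `-d`, which shift the argument of the cross-covariances by the difference
  -- of the offsets.
  let C : Fin 2 → Fin 2 → ℤ → ℂ := fun k l n =>
    P.modelCov (![i, j] k) (![i, j] l) (n + (![(0 : ℤ), -d] k - ![(0 : ℤ), -d] l))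
      (![c, e] k) (![c, e] l)
  have hpair := tendsto_integral_norm_average_pair (C := C)
    (x := fun k n => (![i, j] k, (n : ℤ) + 1 + ![(0 : ℤ), -d] k, ![c, e] k))
    (f := fun z => f z.1 * conj (f z.2))
    h.received_process h.integral_received h.integral_received_mul (fun k l n m => by
      rw [h.integral_received_mul_conj]
      simp only [C]
      congr 1
      ring) (fun k l =>
        (h.cesaroNull_modelCov hP _ _ _ _).comp_add (fun k => by positivity) _)
    ((hfm.comp measurable_fst).mul
      (Complex.continuous_conj.measurable.comp (hfm.comp measurable_snd)))
    ((hfL2 _ _ _).integrable_mul (hfL2 _ _ _).star)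
  simp only [Matrix.cons_val_zero, Matrix.cons_val_one, add_zero, Nat.cast_zero, zero_add,
    ← sub_eq_add_neg] at hpair
  obtain ⟨hpi, hpt⟩ := hpair
  have hAi (N : ℕ) : Integrable (fun ω => ‖avg N ω - m‖) μ :=
    (((integrable_finsetSum _ fun n _ => hpi n).const_mul _).sub (integrable_const _)).norm
  refine tendstoInMeasure_of_norm_sub_le (W := fun N ω => B N ω + ‖avg N ω - m‖)
    (fun N ω => by positivity) (fun N => (hBi N).add (hAi N)) ?_ ?_
  · simp_rw [fun N => integral_add (hBi N) (hAi N)]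
    have := hBt.add hpt
    rw [add_zero] at this
    exact this
  · filter_upwards [eventually_gt_atTop 0] with N hN ω
    refine (norm_sub_le_norm_sub_add_norm_sub _ (avg N ω) _).trans ?_
    gcongr
    exact P.norm_dftCorr_sub_le hP.Ts_pos.ne' hN.ne' _ _ d

lemma tendstoInMeasure_dftCorr_received [IsProbabilityMeasure μ] (h : P.IsModel μ s v)
    (hP : P.Admissible) (i j : Fin L) (c e : Fin M) (d : ℤ) :
    TendstoInMeasure μ (fun N ω => P.dftCorr N (fun n => P.received s v ω i n c)
      (fun n => P.received s v ω j n e) d) atTop (fun _ => P.modelCov i j d c e) := by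
  have := h.tendstoInMeasure_dftCorr hP (f := id) measurable_id
    (fun z => le_add_of_nonneg_left zero_le_one) i j c e d
  simp only [id_eq] at this
  rwa [h.integral_received_mul_conj, sub_sub_cancel] at this

/-- Consistency of the one-bit estimates of the normalized covariances. -/
lemma tendstoInMeasure_csine_dftCorr_oneBit [IsProbabilityMeasure μ] (h : P.IsModel μ s v)
    (hP : P.Admissible) (i j : Fin L) (c e : Fin M) (d : ℤ) :
    TendstoInMeasure μ (fun N ω => csine (((Real.pi / 2 : ℝ) : ℂ) *
      P.dftCorr N (fun n => P.oneBit s v ω i n c) (fun n => P.oneBit s v ω j n e) d)) atTop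
      (fun _ => P.modelCov i j d c e / ((P.ρ i : ℂ) * (P.ρ j : ℂ))) := by
  have hq (z : ℂ) : ‖quantize z‖ ^ 2 ≤ 1 + ‖z‖ ^ 2 := by
    rw [norm_quantize, one_pow]
    exact le_add_of_nonneg_right (by positivity)
  have h1 := tendstoInMeasure_comp_one
    (h.tendstoInMeasure_dftCorr hP measurable_quantize hq i j c e d)
    (g := fun z => csine (((Real.pi / 2 : ℝ) : ℂ) * z)) (continuous_csine.comp (by fun_prop))
  have hi0 : (P.ρ i : ℂ) ≠ 0 := by exact_mod_cast (hP.ρ_pos i).ne'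
  have hj0 : (P.ρ j : ℂ) ≠ 0 := by exact_mod_cast (hP.ρ_pos j).ne'
  -- At lag `d` the two antenna outputs have standard deviations `ρ_i` and `ρ_j`, so the sine of the
  -- arcsine law returns their normalized covariance.
  have hval := csine_integral_quantize
    (c := P.modelCov i j d c e / ((P.ρ i : ℂ) * (P.ρ j : ℂ)))
    (h.received_process.hasGaussianLaw_prodMk (s := (i, 1, c)) (t := (j, 1 - d, e)))
    (h.integral_received (i, 1, c)) (h.integral_received (j, 1 - d, e))
    (h.integral_received_mul (i, 1, c) (i, 1, c))
    (h.integral_received_mul (j, 1 - d, e) (j, 1 - d, e))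
    (h.integral_received_mul (i, 1, c) (j, 1 - d, e)) (hP.ρ_pos i) (hP.ρ_pos j)
    (by rw [h.integral_received_mul_conj, sub_self, h.modelCov_self hP])
    (by rw [h.integral_received_mul_conj, sub_self, h.modelCov_self hP])
    (by rw [h.integral_received_mul_conj, sub_sub_cancel]; field_simp)
  dsimp only at hval
  rw [hval] at h1
  exact h1

end IsModel

end Scenario

/-! ### Asymptotic maximization -/

section Argmax

variable {Ω E : Type*} [MeasurableSpace Ω] {μ : Measure Ω} {Θ : Set E} {F : E → ℝ}

/-- If `|G - F| ≤ err` on `Θ`, a maximizer of `G` loses at most `2 err` in `F`, so a loss of `ε`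
forces `err ≥ ε/2`. Only monotonicity of the outer measure is used, so `phat` may be nonmeasurable.
-/
lemma asymptoticallyMaximizes_of_uniform {G : ℕ → Ω → E → ℝ} {err : ℕ → Ω → ℝ} {phat : ℕ → Ω → E}
    (herr : TendstoInMeasure μ err atTop (fun _ => 0))
    (hG : ∀ N ω, ∀ p ∈ Θ, |G N ω p - F p| ≤ err N ω)
    (hmax : ∀ᶠ N in atTop, ∀ᵐ ω ∂μ, phat N ω ∈ Θ ∧ ∀ p ∈ Θ, G N ω p ≤ G N ω (phat N ω)) :
    AsymptoticallyMaximizes μ F Θ phat := by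
  intro ε hε
  refine tendsto_of_tendsto_of_tendsto_of_le_of_le' tendsto_const_nhds
    (tendstoInMeasure_iff_norm.1 herr (ε / 2) (half_pos hε))
    (Eventually.of_forall fun _ => zero_le) ?_
  filter_upwards [hmax] with N hN
  refine measure_mono_ae ?_
  filter_upwards [hN] with ω hω
  rintro ⟨p, hp, hle⟩
  have h1 := abs_le.1 (hG N ω p hp)
  have h2 := abs_le.1 (hG N ω _ hω.1)
  have h3 := hω.2 p hp
  change ε / 2 ≤ ‖err N ω - 0‖
  rw [sub_zero]
  refine le_trans ?_ (le_abs_self _)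
  linarith [h1.1, h2.2]

/-- When the estimate is at distance at least `ε` from `p₀`, the point `p₀` itself beats it by `δ`,
an event of vanishing probability. -/
lemma AsymptoticallyMaximizes.tendstoInMeasure [PseudoMetricSpace E] {phat : ℕ → Ω → E}
    (h : AsymptoticallyMaximizes μ F Θ phat) (hΘ : ∀ N, ∀ᵐ ω ∂μ, phat N ω ∈ Θ) {p₀ : E}
    (hp₀ : IsWellSeparatedMax F Θ p₀) :
    TendstoInMeasure μ phat atTop (fun _ => p₀) := by
  rw [tendstoInMeasure_iff_dist]
  intro ε hε
  obtain ⟨δ, hδ, hsep⟩ := hp₀.2 ε hε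
  refine tendsto_of_tendsto_of_tendsto_of_le_of_le tendsto_const_nhds (h δ hδ)
    (fun _ => zero_le) fun N => measure_mono_ae ?_
  filter_upwards [hΘ N] with ω hω hdist
  exact ⟨p₀, hp₀.1, hsep _ hω hdist⟩

lemma tendstoInMeasure_dist [PseudoMetricSpace E] {X Y : ℕ → Ω → E} {c : E}
    (hX : TendstoInMeasure μ X atTop (fun _ => c)) (hY : TendstoInMeasure μ Y atTop (fun _ => c)) :
    TendstoInMeasure μ (fun N ω => dist (X N ω) (Y N ω)) atTop (fun _ => 0) := by
  have := tendstoInMeasure_comp (ι := Bool) (X := fun b => if b then X else Y)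
    (c := fun _ => c) (fun b => by cases b <;> simpa)
    (g := fun x => dist (x true) (x false)) (by fun_prop)
  simpa using this

end Argmax

/-- Oddness of the sine; it keeps the one-bit matrix Hermitian, as the eigenvalue estimates require.
-/
lemma csine_conj (z : ℂ) : csine (conj z) = conj (csine z) := by
  simp [csine, ← Complex.sin_conj]

namespace Scenario

variable {L M K : ℕ} {P : Scenario L M K}

/-! ### Beamforming -/

section Beamform

lemma beamform_apply (C : Fin L → Fin L → Matrix (Fin M) (Fin M) ℂ)
    (p : EuclideanSpace ℝ (Fin K)) (i j : Fin L) :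
    P.beamform C p i j = ∑ c, ∑ e, conj (P.a i p c) * C i j c e * P.a j p e := by
  simp [beamform, dotProduct, Matrix.mulVec, Finset.mul_sum, mul_assoc]

lemma beamform_smul (k : ℂ) (C : Fin L → Fin L → Matrix (Fin M) (Fin M) ℂ)
    (p : EuclideanSpace ℝ (Fin K)) :
    P.beamform (fun i j => k • C i j) p = k • P.beamform C p := by
  ext i j
  simp only [beamform_apply, Matrix.smul_apply, smul_eq_mul, Finset.mul_sum]
  refine Finset.sum_congr rfl fun c _ => Finset.sum_congr rfl fun e _ => ?_
  ring

lemma isHermitian_beamform {C : Fin L → Fin L → Matrix (Fin M) (Fin M) ℂ}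
    (hC : ∀ i j c e, conj (C i j c e) = C j i e c) (p : EuclideanSpace ℝ (Fin K)) :
    (P.beamform C p).IsHermitian := by
  ext i j
  rw [Matrix.conjTranspose_apply, beamform_apply, beamform_apply, ← starRingEnd_apply, map_sum,
    Finset.sum_comm]
  refine Finset.sum_congr rfl fun c _ => ?_
  rw [map_sum]
  refine Finset.sum_congr rfl fun e _ => ?_
  rw [map_mul, map_mul, hC, Complex.conj_conj]
  ring

/-- The entries of the array responses have modulus `M^{-1/2} ≤ 1` at every position, which makes
the bound uniform in `p`, apart from the choice of `C` and `C'`. -/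
lemma norm_beamform_sub_le (hM : 0 < M) (hgain : ∀ ℓ p m, ‖P.a ℓ p m‖ ^ 2 = 1 / (M : ℝ))
    (C C' : Fin L → Fin L → Matrix (Fin M) (Fin M) ℂ) (p : EuclideanSpace ℝ (Fin K))
    (i j : Fin L) :
    ‖P.beamform C p i j - P.beamform C' p i j‖ ≤ ∑ c, ∑ e, ‖C i j c e - C' i j c e‖ := by
  have ha (ℓ : Fin L) (m : Fin M) : ‖P.a ℓ p m‖ ≤ 1 := by
    refine (sq_le_one_iff₀ (norm_nonneg _)).1 ?_
    rw [hgain]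
    exact div_le_one_of_le₀ (by exact_mod_cast hM) (by positivity)
  simp only [beamform_apply, ← Finset.sum_sub_distrib]
  refine (norm_sum_le _ _).trans (Finset.sum_le_sum fun c _ => (norm_sum_le _ _).trans
    (Finset.sum_le_sum fun e _ => ?_))
  rw [← sub_mul, ← mul_sub, norm_mul, norm_mul, RCLike.norm_conj]
  calc _ ≤ 1 * ‖C i j c e - C' i j c e‖ * 1 := by gcongr <;> exact ha _ _
    _ = _ := by ring

lemma tendstoInMeasure_beamform {Ω : Type*} [MeasurableSpace Ω] {μ : Measure Ω}
    {R : ℕ → Ω → Fin L → Fin L → Matrix (Fin M) (Fin M) ℂ}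
    {C : Fin L → Fin L → Matrix (Fin M) (Fin M) ℂ}
    (hR : ∀ i j c e, TendstoInMeasure μ (fun N ω => R N ω i j c e) atTop (fun _ => C i j c e))
    (p : EuclideanSpace ℝ (Fin K)) (i j : Fin L) :
    TendstoInMeasure μ (fun N ω => P.beamform (R N ω) p i j) atTop
      (fun _ => P.beamform C p i j) := by
  simp only [beamform_apply]
  exact tendstoInMeasure_comp (ι := Fin M × Fin M) (X := fun t N ω => R N ω i j t.1 t.2)
    (c := fun t => C i j t.1 t.2) (fun t => hR i j t.1 t.2)
    (g := fun x => ∑ c, ∑ e, conj (P.a i p c) * x (c, e) * P.a j p e)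
    (by fun_prop : Continuous _).continuousAt

/-- The phases of stations `i` and `j` combine into `e^{jω_kΔ_ij}`. This puts the Gram matrix `D(p)`
into the same beamformed form as the one-bit matrix. -/
lemma smul_D (N : ℕ) (r : Fin L → ℤ → Fin M → ℂ) (p : EuclideanSpace ℝ (Fin K)) :
    (1 / (N : ℂ)) • P.D N r p = P.beamform (fun i j => P.sampleCov N r i j p) p := by
  ext i j
  rw [beamform_apply]
  have hexp (k : Fin N) : conj (Complex.exp (-Complex.I * ((P.freq N k * P.τ i p : ℝ) : ℂ))) *
      Complex.exp (-Complex.I * ((P.freq N k * P.τ j p : ℝ) : ℂ)) =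
        Complex.exp (Complex.I * ((P.freq N k * P.delta i j p : ℝ) : ℂ)) := by
    rw [← Complex.exp_conj, ← Complex.exp_add]
    congr 1
    simp only [map_mul, map_neg, Complex.conj_I, Complex.conj_ofReal, delta]
    push_cast
    ring
  simp only [D, sampleCov, Umat, Matrix.smul_apply, Matrix.mul_apply, Matrix.conjTranspose_apply,
    Matrix.of_apply, smul_eq_mul, ← starRingEnd_apply, map_mul, map_sum, Complex.conj_conj,
    ← hexp, Finset.mul_sum, Finset.sum_mul]
  rw [Finset.sum_congr rfl fun c _ => Finset.sum_comm, Finset.sum_comm]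
  refine Finset.sum_congr rfl fun k _ => ?_
  rw [Finset.sum_comm]
  refine Finset.sum_congr rfl fun c _ => Finset.sum_congr rfl fun e _ => ?_
  ring

end Beamform

lemma conj_dftCorr (N : ℕ) (x x' : ℤ → ℂ) (d : ℤ) :
    conj (P.dftCorr N x x' d) = P.dftCorr N x' x (-d) := by
  simp only [dftCorr, map_mul, map_sum, ← Complex.exp_conj, Complex.conj_conj, map_div₀, map_one,
    Complex.conj_natCast, Complex.conj_I, Complex.conj_ofReal]
  congr 1
  refine Finset.sum_congr rfl fun k _ => ?_
  rw [mul_comm (conj (P.dft N x k))]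
  congr 2
  push_cast
  ring

lemma lag_symm (hTs : 0 < P.Ts) {p : EuclideanSpace ℝ (Fin K)} (hp : P.IntegerDelays p)
    (i j : Fin L) : P.lag j i p = -P.lag i j p := by
  have h : ((P.lag j i p : ℝ)) * P.Ts = (-P.lag i j p : ℝ) * P.Ts := by
    rw [neg_mul, ← delta_eq_lag hTs hp, ← delta_eq_lag hTs hp, delta, delta, neg_sub]
  exact_mod_cast mul_right_cancel₀ hTs.ne' h

variable {Ω : Type*} [MeasurableSpace Ω] {μ : Measure Ω}
  {s : ℝ → Ω → ℂ} {v : Fin L → ℤ → Fin M → Ω → ℂ}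

/-- Only finitely many integer lags occur on `Θ`, however large `Θ` is. This turns convergence at
each lag into uniform convergence over positions. -/
lemma IsCandidateSet.exists_abs_lag_le {Θ : Set (EuclideanSpace ℝ (Fin K))}
    (hΘ : P.IsCandidateSet Θ) (hTs : 0 < P.Ts) :
    ∃ B : ℤ, ∀ p ∈ Θ, ∀ i j, P.lag i j p ∈ Finset.Icc (-B) B := by
  choose C hC using hΘ.bounded
  refine ⟨∑ i, ∑ j, ⌈|C i j / P.Ts|⌉, fun p hp i j => ?_⟩
  rw [Finset.mem_Icc, ← abs_le]
  have h1 : |P.lag i j p| ≤ ⌈|C i j / P.Ts|⌉ := by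
    have h2 : (|P.lag i j p| : ℝ) ≤ |C i j / P.Ts| := by
      refine le_trans ?_ (le_abs_self _)
      rw [le_div_iff₀ hTs]
      calc (|P.lag i j p| : ℝ) * P.Ts = |P.delta i j p| := by
            rw [delta_eq_lag hTs (hΘ.integerDelays p hp), abs_mul, abs_of_pos hTs]
        _ ≤ C i j := hC i j p hp
    exact_mod_cast h2.trans (Int.le_ceil _)
  have h0 (i j : Fin L) : 0 ≤ ⌈|C i j / P.Ts|⌉ := Int.ceil_nonneg (abs_nonneg _)
  exact h1.trans ((Finset.single_le_sum (f := fun j => ⌈|C i j / P.Ts|⌉) (fun j _ => h0 i j)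
    (Finset.mem_univ j)).trans (Finset.single_le_sum (f := fun i => ∑ j, ⌈|C i j / P.Ts|⌉)
      (fun i _ => Finset.sum_nonneg fun j _ => h0 i j) (Finset.mem_univ i)))

/-- Maximizers of the largest eigenvalue of beamformed consistent covariance estimates maximize its
limit asymptotically. -/
lemma asymptoticallyMaximizes_beamform (hL : 0 < L) (hM : 0 < M) (hP : P.Admissible)
    {Θ : Set (EuclideanSpace ℝ (Fin K))} (hΘ : P.IsCandidateSet Θ)
    {R : ℕ → Ω → Fin L → Fin L → ℤ → Matrix (Fin M) (Fin M) ℂ}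
    {C : Fin L → Fin L → ℤ → Matrix (Fin M) (Fin M) ℂ}
    (hRC : ∀ i j d c e,
      TendstoInMeasure μ (fun N ω => R N ω i j d c e) atTop (fun _ => C i j d c e))
    (hR : ∀ N ω i j d c e, conj (R N ω i j d c e) = R N ω j i (-d) e c)
    (hC : ∀ i j d c e, conj (C i j d c e) = C j i (-d) e c)
    {phat : ℕ → Ω → EuclideanSpace ℝ (Fin K)}
    (hmax : ∀ᶠ N in atTop, ∀ᵐ ω ∂μ, phat N ω ∈ Θ ∧ ∀ p ∈ Θ,
      lambdaMax (P.beamform (fun i j => R N ω i j (P.lag i j p)) p) ≤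
        lambdaMax (P.beamform (fun i j => R N ω i j (P.lag i j (phat N ω))) (phat N ω))) :
    AsymptoticallyMaximizes μ
      (fun p => lambdaMax (P.beamform (fun i j => C i j (P.lag i j p)) p)) Θ phat := by
  obtain ⟨B, hB⟩ := hΘ.exists_abs_lag_le hP.Ts_pos
  let S := Finset.Icc (-B) B
  -- The total estimation error over all stations, antennas and lags in `S`. It is a finite sum
  -- independent of `p`, so it tends to zero in probability and dominates the error at every
  -- candidate position.
  have herr := tendstoInMeasure_comp (ι := Fin L × Fin L × Fin M × Fin M × S)
    (X := fun t N ω => R N ω t.1 t.2.1 t.2.2.2.2 t.2.2.1 t.2.2.2.1)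
    (c := fun t => C t.1 t.2.1 t.2.2.2.2 t.2.2.1 t.2.2.2.1) (fun t => hRC _ _ _ _ _)
    (g := fun x => ∑ i, ∑ j, ∑ c, ∑ e, ∑ d : S, ‖x (i, j, c, e, d) - C i j d c e‖)
    (by fun_prop : Continuous _).continuousAt
  simp only [sub_self, norm_zero, Finset.sum_const_zero] at herr
  refine asymptoticallyMaximizes_of_uniform
    (G := fun N ω p => lambdaMax (P.beamform (fun i j => R N ω i j (P.lag i j p)) p))
    herr (fun N ω p hp => ?_) hmax
  have hp' := hΘ.integerDelays p hp
  refine (abs_lambdaMax_sub_le hL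
    (isHermitian_beamform (fun i j c e => by rw [hR, lag_symm hP.Ts_pos hp' i j]) p)
    (isHermitian_beamform (fun i j c e => by rw [hC, lag_symm hP.Ts_pos hp' i j]) p)).trans ?_
  refine Finset.sum_le_sum fun i _ => Finset.sum_le_sum fun j _ =>
    (norm_beamform_sub_le hM hP.gain _ _ p i j).trans
      (Finset.sum_le_sum fun c _ => Finset.sum_le_sum fun e _ => ?_)
  exact Finset.single_le_sum (f := fun d : S => ‖R N ω i j d c e - C i j d c e‖)
    (fun _ _ => norm_nonneg _) (Finset.mem_univ (⟨P.lag i j p, hB p hp i j⟩ : S))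

end Scenario

namespace Scenario

/-! ### Consistent estimates of the normalized covariances -/

section Consistency

variable {L M K : ℕ} {P : Scenario L M K} {Ω : Type*} [MeasurableSpace Ω] {μ : Measure Ω}
  {s : ℝ → Ω → ℂ} {v : Fin L → ℤ → Fin M → Ω → ℂ}

variable (P) in
/-- `(1/N) ∑_k x̄_i[k] x̄_j[k]^H exp(j ω_k d T_s)`. -/
noncomputable def corr (N : ℕ) (x : Fin L → ℤ → Fin M → ℂ) (i j : Fin L) (d : ℤ) :
    Matrix (Fin M) (Fin M) ℂ :=
  Matrix.of fun c e => P.dftCorr N (fun n => x i n c) (fun n => x j n e) d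

variable (P) in
/-- `sine ((π/2) (1/N) ∑_k ȳ_i[k] ȳ_j[k]^H exp(j ω_k d T_s))`. -/
noncomputable def oneBitCorr (N : ℕ) (y : Fin L → ℤ → Fin M → ℂ) (i j : Fin L) (d : ℤ) :
    Matrix (Fin M) (Fin M) ℂ :=
  Matrix.of fun c e => csine (((Real.pi / 2 : ℝ) : ℂ) * P.corr N y i j d c e)

lemma sampleCov_eq_corr (hTs : 0 < P.Ts) {p : EuclideanSpace ℝ (Fin K)} (hp : P.IntegerDelays p)
    (N : ℕ) (x : Fin L → ℤ → Fin M → ℂ) (i j : Fin L) :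
    P.sampleCov N x i j p = P.corr N x i j (P.lag i j p) := by
  ext c e
  exact sampleCov_eq_dftCorr (delta_eq_lag hTs hp i j) N x c e

lemma oneBitCov_eq_oneBitCorr (hTs : 0 < P.Ts) {p : EuclideanSpace ℝ (Fin K)}
    (hp : P.IntegerDelays p) (N : ℕ) (y : Fin L → ℤ → Fin M → ℂ) (i j : Fin L) :
    P.oneBitCov N y i j p = P.oneBitCorr N y i j (P.lag i j p) := by
  rw [oneBitCov, sampleCov_eq_corr hTs hp, oneBitCorr]

lemma conj_corr (N : ℕ) (x : Fin L → ℤ → Fin M → ℂ) (i j : Fin L) (d : ℤ) (c e : Fin M) :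
    conj (P.corr N x i j d c e) = P.corr N x j i (-d) e c :=
  conj_dftCorr _ _ _ _

lemma conj_oneBitCorr (N : ℕ) (y : Fin L → ℤ → Fin M → ℂ) (i j : Fin L) (d : ℤ) (c e : Fin M) :
    conj (P.oneBitCorr N y i j d c e) = P.oneBitCorr N y j i (-d) e c := by
  rw [oneBitCorr, oneBitCorr, Matrix.of_apply, Matrix.of_apply, ← conj_corr, ← csine_conj, map_mul,
    Complex.conj_ofReal]

lemma IsModel.normCov_eq (h : P.IsModel μ s v) (i j : Fin L) (d : ℤ) (c e : Fin M) :
    P.normCov μ s v i j d c e = P.modelCov i j d c e / ((P.ρ i : ℂ) * (P.ρ j : ℂ)) := by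
  rw [normCov, Matrix.of_apply, h.cov_eq]

lemma IsModel.conj_normCov (h : P.IsModel μ s v) (i j : Fin L) (d : ℤ) (c e : Fin M) :
    conj (P.normCov μ s v i j d c e) = P.normCov μ s v j i (-d) e c := by
  rw [h.normCov_eq, h.normCov_eq, map_div₀, h.conj_modelCov, map_mul, Complex.conj_ofReal,
    Complex.conj_ofReal, mul_comm (P.ρ i : ℂ)]

lemma Dbar_eq_smul_beamform (hTs : 0 < P.Ts) {p : EuclideanSpace ℝ (Fin K)}
    (hp : P.IntegerDelays p) (N : ℕ) (y : Fin L → ℤ → Fin M → ℂ) :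
    P.Dbar N y p = (N : ℂ) • P.beamform (fun i j => P.oneBitCorr N y i j (P.lag i j p)) p := by
  simp only [Dbar, oneBitCov_eq_oneBitCorr hTs hp]

lemma IsModel.tendstoInMeasure_oneBitCorr [IsProbabilityMeasure μ] (h : P.IsModel μ s v)
    (hP : P.Admissible) (i j : Fin L) (d : ℤ) (c e : Fin M) :
    TendstoInMeasure μ (fun N ω => P.oneBitCorr N (P.oneBit s v ω) i j d c e) atTop
      (fun _ => P.normCov μ s v i j d c e) := by
  rw [h.normCov_eq]
  exact h.tendstoInMeasure_csine_dftCorr_oneBit hP i j c e d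

lemma IsModel.tendstoInMeasure_smul_Dbar [IsProbabilityMeasure μ] (h : P.IsModel μ s v)
    (hP : P.Admissible) {p : EuclideanSpace ℝ (Fin K)} (hp : P.IntegerDelays p) (i j : Fin L) :
    TendstoInMeasure μ (fun (N : ℕ) ω => (1 / (N : ℂ)) * P.Dbar N (P.oneBit s v ω) p i j) atTop
      (fun _ => P.Dlim μ s v p i j) := by
  refine (tendstoInMeasure_beamform (P := P)
    (R := fun N ω i j => P.oneBitCorr N (P.oneBit s v ω) i j (P.lag i j p))
    (C := fun i j => P.normCov μ s v i j (P.lag i j p))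
    (fun i j c e => h.tendstoInMeasure_oneBitCorr hP i j _ c e) p i j).congr' ?_ ae_eq_rfl
  -- At `N = 0` the factor `1/N` is zero and does not cancel `N`; the identity holds from `N = 1`
  -- on.
  filter_upwards [eventually_gt_atTop 0] with N hN
  refine ae_of_all _ fun ω => ?_
  have hN' : (N : ℂ) ≠ 0 := by exact_mod_cast hN.ne'
  simp only [Dbar_eq_smul_beamform hP.Ts_pos hp, Matrix.smul_apply, smul_eq_mul]
  field_simp

/-- Unquantized data whose scaled sample correlations have the same limits as the one-bit
estimates lead to an asymptotically equivalent DPD matrix. -/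
lemma IsModel.tendstoInMeasure_Dbar_sub_D [IsProbabilityMeasure μ] (h : P.IsModel μ s v)
    (hP : P.Admissible) {r : Ω → Fin L → ℤ → Fin M → ℂ} {κ : ℝ}
    (hr : ∀ i j d c e, TendstoInMeasure μ (fun N ω => (κ : ℂ) * P.corr N (r ω) i j d c e) atTop
      (fun _ => P.normCov μ s v i j d c e))
    {p : EuclideanSpace ℝ (Fin K)} (hp : P.IntegerDelays p) (i j : Fin L) :
    TendstoInMeasure μ (fun (N : ℕ) ω => (1 / (N : ℂ)) * (P.Dbar N (P.oneBit s v ω) p i j -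
      (κ : ℂ) * P.D N (r ω) p i j)) atTop (fun _ => 0) := by
  -- Both normalized matrices converge to the constant `Dlim`, so their difference tends to zero
  -- whatever the joint law of the two data sets.
  have h1 := tendstoInMeasure_sub (h.tendstoInMeasure_smul_Dbar hP hp i j)
    (tendstoInMeasure_beamform (P := P)
      (R := fun N ω i j => (κ : ℂ) • P.corr N (r ω) i j (P.lag i j p))
      (C := fun i j => P.normCov μ s v i j (P.lag i j p))
      (fun i j c e => hr i j _ c e) p i j)
  simp only [beamform_smul, ← sampleCov_eq_corr hP.Ts_pos hp, ← smul_D] at h1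
  rw [← sub_self (P.Dlim μ s v p i j)]
  refine h1.congr_left fun N => ae_of_all _ fun ω => ?_
  simp only [Matrix.smul_apply, smul_eq_mul]
  ring

lemma IsModel.asymptoticallyMaximizes_oneBit [IsProbabilityMeasure μ] (h : P.IsModel μ s v)
    (hL : 0 < L) (hM : 0 < M) (hP : P.Admissible) {Θ : Set (EuclideanSpace ℝ (Fin K))}
    (hΘ : P.IsCandidateSet Θ) {phat : ℕ → Ω → EuclideanSpace ℝ (Fin K)}
    (hphat : ∀ N, ∀ᵐ ω ∂μ, P.IsOBDPDEstimate Θ N (P.oneBit s v ω) (phat N ω)) :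
    AsymptoticallyMaximizes μ (fun p => lambdaMax (P.Dlim μ s v p)) Θ phat := by
  refine asymptoticallyMaximizes_beamform hL hM hP hΘ
    (R := fun N ω => P.oneBitCorr N (P.oneBit s v ω)) (C := P.normCov μ s v)
    (h.tendstoInMeasure_oneBitCorr hP) (fun N ω => conj_oneBitCorr N _) h.conj_normCov ?_
  filter_upwards [eventually_gt_atTop 0] with N hN
  filter_upwards [hphat N] with ω hω
  refine ⟨hω.1, fun p hp => ?_⟩
  -- The one-bit matrix is `N` times the beamformed estimate, and a positive factor does not change
  -- the maximizers.
  have hscale (q : EuclideanSpace ℝ (Fin K)) (hq : q ∈ Θ) :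
      lambdaMax (P.Dbar N (P.oneBit s v ω) q) = N * lambdaMax
        (P.beamform (fun i j => P.oneBitCorr N (P.oneBit s v ω) i j (P.lag i j q)) q) := by
    have hq' := hΘ.integerDelays q hq
    rw [Dbar_eq_smul_beamform hP.Ts_pos hq']
    exact_mod_cast lambdaMax_smul hL (isHermitian_beamform (fun i j c e => by
      rw [conj_oneBitCorr, lag_symm hP.Ts_pos hq' i j]) q) N.cast_nonneg
  have h1 := hω.2 p hp
  rw [hscale p hp, hscale _ hω.1] at h1
  exact le_of_mul_le_mul_left h1 (by exact_mod_cast hN)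

/-- A minimizer of the least-squares cost maximizes `λ_max(D)`, and the nonnegative factor `κ/N`
preserves this. The scale `κ` covers parallel data (`κ = 1`) and the raw data under equal `ρ_ℓ` (`κ
= ρ⁻²`). -/
lemma IsModel.asymptoticallyMaximizes_unquantized (h : P.IsModel μ s v)
    (hL : 0 < L) (hM : 0 < M) (hP : P.Admissible) {Θ : Set (EuclideanSpace ℝ (Fin K))}
    (hΘ : P.IsCandidateSet Θ) {r : Ω → Fin L → ℤ → Fin M → ℂ} {κ : ℝ} (hκ : 0 ≤ κ)
    (hr : ∀ i j d c e, TendstoInMeasure μ (fun N ω => (κ : ℂ) * P.corr N (r ω) i j d c e) atTop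
      (fun _ => P.normCov μ s v i j d c e))
    {phat : ℕ → Ω → EuclideanSpace ℝ (Fin K)}
    (hphat : ∀ N, ∀ᵐ ω ∂μ, P.IsDPDEstimate Θ N (r ω) (phat N ω)) :
    AsymptoticallyMaximizes μ (fun p => lambdaMax (P.Dlim μ s v p)) Θ phat := by
  refine asymptoticallyMaximizes_beamform hL hM hP hΘ
    (R := fun N ω i j d => (κ : ℂ) • P.corr N (r ω) i j d) (C := P.normCov μ s v) hr
    (fun N ω i j d c e => ?_) h.conj_normCov (Eventually.of_forall fun N => ?_)
  · simp only [Matrix.smul_apply, smul_eq_mul, map_mul, Complex.conj_ofReal, conj_corr]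
  filter_upwards [hphat N] with ω hω
  refine ⟨hω.1, fun p hp => ?_⟩
  have hscale (q : EuclideanSpace ℝ (Fin K)) (hq : q ∈ Θ) :
      lambdaMax (P.beamform (fun i j => (κ : ℂ) • P.corr N (r ω) i j (P.lag i j q)) q) =
        κ * (1 / N) * lambdaMax (P.D N (r ω) q) := by
    simp only [beamform_smul, ← sampleCov_eq_corr hP.Ts_pos (hΘ.integerDelays q hq), ← smul_D,
      smul_smul]
    have h1 := lambdaMax_smul hL (P.isHermitian_D N (r ω) q)
      (c := κ * (1 / N)) (by positivity)
    push_cast at h1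
    exact h1
  rw [hscale p hp, hscale _ hω.1]
  have h1 := hω.lambdaMax_D_le hL hM hP.gain hp
  gcongr

lemma IsModel.tendstoInMeasure_corr_parallel [IsProbabilityMeasure μ] (h : P.IsModel μ s v)
    (hP : P.Admissible) {s' : ℝ → Ω → ℂ} {v' : Fin L → ℤ → Fin M → Ω → ℂ}
    (h' : P.parallel.IsModel μ s' v') (i j : Fin L) (d : ℤ) (c e : Fin M) :
    TendstoInMeasure μ
      (fun N ω => ((1 : ℝ) : ℂ) * P.corr N (P.parallel.received s' v' ω) i j d c e) atTop
      (fun _ => P.normCov μ s v i j d c e) := by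
  simp only [Complex.ofReal_one, one_mul]
  rw [h.normCov_eq, ← hP.modelCov_parallel]
  -- The parallel scenario has the same `Ts`, so its correlations are definitionally those computed
  -- with `P`.
  exact h'.tendstoInMeasure_dftCorr_received hP.parallel i j c e d

lemma IsModel.normCov_eq_of_ρ_eq (h : P.IsModel μ s v) {ρ : ℝ} (hρ : ∀ ℓ, P.ρ ℓ = ρ)
    (i j : Fin L) (d : ℤ) (c e : Fin M) :
    P.normCov μ s v i j d c e = ((ρ ^ (-2 : ℤ) : ℝ) : ℂ) * P.modelCov i j d c e := by
  rw [h.normCov_eq, hρ, hρ, div_eq_inv_mul, zpow_neg]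
  push_cast
  rw [← pow_two, zpow_ofNat]

lemma IsModel.tendstoInMeasure_corr_of_ρ_eq [IsProbabilityMeasure μ] (h : P.IsModel μ s v)
    (hP : P.Admissible) {ρ : ℝ} (hρ : ∀ ℓ, P.ρ ℓ = ρ) (i j : Fin L) (d : ℤ) (c e : Fin M) :
    TendstoInMeasure μ
      (fun N ω => ((ρ ^ (-2 : ℤ) : ℝ) : ℂ) * P.corr N (P.received s v ω) i j d c e) atTop
      (fun _ => P.normCov μ s v i j d c e) := by
  rw [h.normCov_eq_of_ρ_eq hρ]
  exact tendstoInMeasure_comp_one (h.tendstoInMeasure_dftCorr_received hP i j c e d)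
    (g := fun z => ((ρ ^ (-2 : ℤ) : ℝ) : ℂ) * z) (by fun_prop)

end Consistency

end Scenario

end OBDPD

open OBDPD in
theorem mainTheorem2 {L M K : ℕ} (hL : 0 < L) (hM : 0 < M)
    {Ω : Type*} [MeasurableSpace Ω] (μ : Measure Ω) [IsProbabilityMeasure μ]
    (P : Scenario L M K) (hP : P.Admissible)
    (s : ℝ → Ω → ℂ) (v : Fin L → ℤ → Fin M → Ω → ℂ) (hmodel : P.IsModel μ s v) :
    -- the covariances do not depend on the time index and have the model's closed form
    (∀ (i j : Fin L) (n m : ℤ),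
      P.covAt μ s v i j n m = P.cov μ s v i j m ∧
      ∀ c d : Fin M, P.cov μ s v i j m c d =
        P.b i * conj (P.b j) * P.Rs ((m : ℝ) * P.Ts - P.delta i j P.pos) *
          (P.a i P.pos c * conj (P.a j P.pos d)) +
        (if i = j ∧ m = 0 ∧ c = d then (P.σsq i : ℂ) else 0)) ∧
    -- consistency of the one-bit estimates of the normalized covariances
    (∀ p, P.IntegerDelays p → ∀ (i j : Fin L) (c d : Fin M),
      TendstoInMeasure μ (fun N ω => P.oneBitCov N (P.oneBit s v ω) i j p c d) atTop
        (fun _ => P.normCov μ s v i j (P.lag i j p) c d)) ∧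
    -- convergence of the (normalized) one-bit matrix
    (∀ p, P.IntegerDelays p → ∀ i j : Fin L,
      TendstoInMeasure μ (fun (N : ℕ) ω => (1 / (N : ℂ)) * P.Dbar N (P.oneBit s v ω) p i j) atTop
        (fun _ => P.Dlim μ s v p i j)) ∧
    -- all `ρ_ℓ` equal: the limits are `ρ⁻²` times the unquantized quantities
    (∀ ρ : ℝ, (∀ ℓ, P.ρ ℓ = ρ) → ∀ p, P.IntegerDelays p →
      (∀ (i j : Fin L) (c d : Fin M),
        TendstoInMeasure μ (fun N ω => P.oneBitCov N (P.oneBit s v ω) i j p c d) atTop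
          (fun _ => ((ρ ^ (-2 : ℤ) : ℝ) : ℂ) * P.cov μ s v i j (P.lag i j p) c d)) ∧
      ∀ i j : Fin L,
        TendstoInMeasure μ
          (fun (N : ℕ) ω => (1 / (N : ℂ)) * (P.Dbar N (P.oneBit s v ω) p i j -
            ((ρ ^ (-2 : ℤ) : ℝ) : ℂ) * P.D N (P.received s v ω) p i j)) atTop
          (fun _ => 0)) ∧
    -- a parallel scenario with the same emitter position exists, and all of its `ρ_ℓ` are `1`
    (P.parallel.Admissible ∧ (∀ ℓ, P.parallel.ρ ℓ = 1) ∧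
      P.parallel.IsModel μ s (fun ℓ n m ω => v ℓ n m ω / (P.ρ ℓ : ℂ))) ∧
    -- the one-bit matrix and the DPD matrix of any parallel unquantized scenario coincide
    -- asymptotically
    (∀ (s' : ℝ → Ω → ℂ) (v' : Fin L → ℤ → Fin M → Ω → ℂ), P.parallel.IsModel μ s' v' →
      ∀ p, P.IntegerDelays p → ∀ i j : Fin L,
        TendstoInMeasure μ
          (fun (N : ℕ) ω => (1 / (N : ℂ)) * (P.Dbar N (P.oneBit s v ω) p i j -
            P.parallel.D N (P.parallel.received s' v' ω) p i j)) atTop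
          (fun _ => 0)) ∧
    -- convergence of the position estimates
    (∀ (Θ : Set (EuclideanSpace ℝ (Fin K))), P.IsCandidateSet Θ →
      ∀ pOB : ℕ → Ω → EuclideanSpace ℝ (Fin K),
      (∀ N, ∀ᵐ ω ∂μ, P.IsOBDPDEstimate Θ N (P.oneBit s v ω) (pOB N ω)) →
      AsymptoticallyMaximizes μ (fun p => lambdaMax (P.Dlim μ s v p)) Θ pOB ∧
      (∀ p₀, IsWellSeparatedMax (fun p => lambdaMax (P.Dlim μ s v p)) Θ p₀ →
        TendstoInMeasure μ pOB atTop (fun _ => p₀)) ∧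
      -- comparison with the DPD estimate of any parallel unquantized scenario
      (∀ (s' : ℝ → Ω → ℂ) (v' : Fin L → ℤ → Fin M → Ω → ℂ), P.parallel.IsModel μ s' v' →
        ∀ pH : ℕ → Ω → EuclideanSpace ℝ (Fin K),
        (∀ N, ∀ᵐ ω ∂μ,
          P.parallel.IsDPDEstimate Θ N (P.parallel.received s' v' ω) (pH N ω)) →
        AsymptoticallyMaximizes μ (fun p => lambdaMax (P.Dlim μ s v p)) Θ pH ∧
        ∀ p₀, IsWellSeparatedMax (fun p => lambdaMax (P.Dlim μ s v p)) Θ p₀ →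
          TendstoInMeasure μ pH atTop (fun _ => p₀) ∧
          TendstoInMeasure μ (fun N ω => dist (pOB N ω) (pH N ω)) atTop (fun _ => 0)) ∧
      -- all `ρ_ℓ` equal: comparison with the DPD estimate from the unquantized data themselves
      ((∀ i j, P.ρ i = P.ρ j) →
        ∀ pH : ℕ → Ω → EuclideanSpace ℝ (Fin K),
        (∀ N, ∀ᵐ ω ∂μ, P.IsDPDEstimate Θ N (P.received s v ω) (pH N ω)) →
        AsymptoticallyMaximizes μ (fun p => lambdaMax (P.Dlim μ s v p)) Θ pH ∧
        ∀ p₀, IsWellSeparatedMax (fun p => lambdaMax (P.Dlim μ s v p)) Θ p₀ →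
          TendstoInMeasure μ pH atTop (fun _ => p₀) ∧
          TendstoInMeasure μ (fun N ω => dist (pOB N ω) (pH N ω)) atTop (fun _ => 0))) := by
  have hTs := hP.Ts_pos
  refine ⟨fun i j n m => ⟨?_, hmodel.cov_eq i j m⟩, ?_, ?_, ?_, ?_, ?_, ?_⟩
  · ext c d
    rw [hmodel.covAt_eq, hmodel.cov_eq]
  · intro p hp i j c d
    simp only [Scenario.oneBitCov_eq_oneBitCorr hTs hp]
    exact hmodel.tendstoInMeasure_oneBitCorr hP i j _ c d
  · exact fun p hp => hmodel.tendstoInMeasure_smul_Dbar hP hp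
  · intro ρ hρ p hp
    refine ⟨fun i j c d => ?_, hmodel.tendstoInMeasure_Dbar_sub_D hP
      (hmodel.tendstoInMeasure_corr_of_ρ_eq hP hρ) hp⟩
    simp only [Scenario.oneBitCov_eq_oneBitCorr hTs hp]
    rw [hmodel.cov_eq, ← hmodel.normCov_eq_of_ρ_eq hρ]
    exact hmodel.tendstoInMeasure_oneBitCorr hP i j _ c d
  · exact ⟨hP.parallel, hP.parallel_ρ, hmodel.parallel hP⟩
  · intro s' v' h' p hp i j
    have := hmodel.tendstoInMeasure_Dbar_sub_D hP
      (hmodel.tendstoInMeasure_corr_parallel hP h') hp i j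
    simp only [Complex.ofReal_one, one_mul] at this
    -- The DPD matrix depends on the scenario only through `Ts`, `a` and `τ`, so those of `P` and
    -- `P.parallel` agree definitionally on the same data.
    exact this
  · intro Θ hΘ pOB hpOB
    have hOB := hmodel.asymptoticallyMaximizes_oneBit hL hM hP hΘ hpOB
    have hOBt (p₀) (hp₀ : IsWellSeparatedMax (fun p => lambdaMax (P.Dlim μ s v p)) Θ p₀) :=
      hOB.tendstoInMeasure (fun N => (hpOB N).mono fun _ h => h.1) hp₀
    refine ⟨hOB, hOBt, fun s' v' h' pH hpH => ?_, fun hρ pH hpH => ?_⟩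
    · have hH := hmodel.asymptoticallyMaximizes_unquantized hL hM hP hΘ zero_le_one
        (hmodel.tendstoInMeasure_corr_parallel hP h') hpH
      refine ⟨hH, fun p₀ hp₀ => ?_⟩
      have hHt := hH.tendstoInMeasure (fun N => (hpH N).mono fun _ h => h.1) hp₀
      exact ⟨hHt, tendstoInMeasure_dist (hOBt p₀ hp₀) hHt⟩
    -- The common value of the `ρ_ℓ` is taken from station `0`, which exists because `L > 0`.
    · have hH := hmodel.asymptoticallyMaximizes_unquantized hL hM hP hΘ
        (zpow_nonneg (hP.ρ_pos ⟨0, hL⟩).le (-2))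
        (hmodel.tendstoInMeasure_corr_of_ρ_eq hP fun ℓ => hρ ℓ ⟨0, hL⟩) hpH
      refine ⟨hH, fun p₀ hp₀ => ?_⟩
      have hHt := hH.tendstoInMeasure (fun N => (hpH N).mono fun _ h => h.1) hp₀
      exact ⟨hHt, tendstoInMeasure_dist (hOBt p₀ hp₀) hHt⟩
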